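/- Let $\mathbb O$ be either the open unit disk $\mathbb D$ or the open upper half plane $\mathbb U=\{z:\operatorname{Im}z>0\}$, with boundary $\partial\mathbb O=\mathbb T$ or $\overline{\mathbb R}=\mathbb R\cup\{\infty\}$ respectively, and let $\alpha_0=0$ or $\alpha_0=i$ respectively. For $\alpha\in\mathbb O$ put $\varpi_\alpha(z)=1-\overline\alpha z$ (disk) or $\varpi_\alpha(z)=z-\overline\alpha$ (half plane), $\zeta_\alpha(z)=z_\alpha\,\frac{z-\alpha}{\varpi_\alpha(z)}$, where $z_{\alpha_0}=1$ and, for $\alpha\ne\alpha_0$, $z_\alpha=-|\alpha|/\alpha$ (disk) or $z_\alpha=|1+\alpha^2|/(1+\alpha^2)$ (half plane). Let $(\alpha_n)_{n\ge1}$ be a sequence in $\mathbb O$ and $\gamma=(\gamma_n)_{n\ge0}$ a sequence in $\mathbb D$; write the index $n$ for $\alpha_n$ ($\zeta_n=\zeta_{\alpha_n}$, $\varpi_n=\varpi_{\alpha_n}$, $z_n=z_{\alpha_n}$), $B_n=\zeta_1\cdots\zeta_n$, and $\mathbb O_0=\mathbb O\setminus\{\alpha_k:k\ge0\}$. The Wall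 rational functions are defined by $R_0=\gamma_0$, $S_0=S_0^*=1$, $R_0^*=\overline{\gamma_0}$ and, for $n\ge1$, $$R_n=R_{n-1}+\gamma_n\zeta_nS^*_{n-1},\quad S_n=S_{n-1}+\gamma_n\zeta_nR^*_{n-1},\quad R_n^*=\zeta_nR^*_{n-1}+\overline{\gamma_n}S_{n-1},\quad S_n^*=\zeta_nS^*_{n-1}+\overline{\gamma_n}R_{n-1}.$$ Let $\Phi_0=\Phi_0^*=1$ and, for $n\ge1$, with $\Lambda_n=-\overline{z_n}\gamma_{n-1}$ and $e_n=\sqrt{\frac{\varpi_n(\alpha_n)}{\varpi_{n-1}(\alpha_{n-1})}\frac1{1-|\Lambda_n|^2}}$, $$\begin{pmatrix}\Phi_n\\ \Phi_n^*\end{pmatrix}=e_n\frac{\varpi_{n-1}}{\varpi_n}\begin{pmatrix}1&\overline{\Lambda_n}\\ \Lambda_n&1\end{pmatrix}\begin{pmatrix}z_n\overline{z_{n-1}}\,\zeta_{n-1}\Phi_{n-1}\\ \Phi^*_{n-1}\end{pmatrix}.$$ Let $\mathfrak M$ be the set of Borel probability measures $\mu$ on $\partial\mathbb O$ with parameters $\gamma$,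 i.e. those for which $(\Phi_n)$ is an orthonormalization of $(B_n)$ in $L^2(\mu)$. For $z\in\mathbb O_0$ let $$F(z;\mu)=\int\frac{\zeta_0(t)+\zeta_0(z)}{\zeta_0(t)-\zeta_0(z)}\,d\mu(t),\qquad f(z;\mu)=\frac1{\zeta_0(z)}\,\frac{F(z;\mu)-1}{F(z;\mu)+1},$$ $\varDelta(z)=\{F(z;\mu):\mu\in\mathfrak M\}$ and $\tilde\varDelta(z)=\{f(z;\mu):\mu\in\mathfrak M\}$. A measure $\mu\in\mathfrak M$ is called N-extremal if $F(z;\mu)\in\partial\varDelta(z)$ for all $z\in\mathbb O_0$. Finally let $d\mu^{(n)}=dm_{\alpha_n}/|\Phi_n|^2$, where $dm_\alpha(t)=\frac{1-|\alpha|^2}{|t-\alpha|^2}\frac{dt}{2\pi it}$ (disk) or $dm_\alpha(t)=\frac{\operatorname{Im}\alpha}{|t-\alpha|^2}\frac{dt}{\pi}$ (half plane). **Proposition N2.** Assume the indeterminate case: $\mathfrak M$ has more than one element. If $\limsup_n|\gamma_n|=1$, then at least one limit point of $(R_n/S_n)$ lies on $\partial\tilde\varDelta$: there is a subsequence of $(R_n/S_n)$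 that converges, uniformly on compact subsets of $\mathbb O$, to a function $f$ with $f(z)\in\partial\tilde\varDelta(z)$ for every $z\in\mathbb O_0$ (in particular, for every $z\in\mathbb O_0$ some limit point of the sequence $(R_n(z)/S_n(z))$ lies on $\partial\tilde\varDelta(z)$). Equivalently, at least one limit measure of $(d\mu^{(n)})$, that is, the weak-$*$ limit of some subsequence, is N-extremal. -/

import Mathlib

noncomputable section

namespace RatORF

/-- The two settings that are treated in parallel: the open unit disk and the upper half plane. -/
inductive Domain
  | disk
  | halfPlane

/-- The region `𝕆`: the open unit disk, or the open upper half plane. -/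
def region : Domain → Set ℂ
  | .disk => {z | ‖z‖ < 1}
  | .halfPlane => {z | 0 < z.im}

/-- The base point `α₀`: `0` in the disk, `i` in the half plane. -/
def basePoint : Domain → ℂ
  | .disk => 0
  | .halfPlane => Complex.I

/-- The boundary `∂𝕆` in the Riemann sphere: the unit circle, or the extended real line. -/
def boundarySet : Domain → Set (OnePoint ℂ)
  | .disk => {t | ∃ z : ℂ, ‖z‖ = 1 ∧ t = (z : OnePoint ℂ)}
  | .halfPlane => {t | t = OnePoint.infty ∨ ∃ x : ℝ, t = ((x : ℂ) : OnePoint ℂ)}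

/-- The boundary `∂𝕆` as a topological space (subspace of the Riemann sphere). -/
def Bdry (O : Domain) : Type := {t : OnePoint ℂ // t ∈ boundarySet O}

instance (O : Domain) : TopologicalSpace (Bdry O) :=
  inferInstanceAs (TopologicalSpace {t : OnePoint ℂ // t ∈ boundarySet O})

instance (O : Domain) : MeasurableSpace (Bdry O) := borel (Bdry O)

instance (O : Domain) : BorelSpace (Bdry O) := ⟨rfl⟩

/-- First homogeneous coordinate: `t = [hnum t : hden t]`, where `z = [z : 1]`, `∞ = [1 : 0]`. -/
def hnum : OnePoint ℂ → ℂ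
  | OnePoint.infty => 1
  | OnePoint.some z => z

/-- Second homogeneous coordinate. -/
def hden : OnePoint ℂ → ℂ
  | OnePoint.infty => 0
  | OnePoint.some _ => 1

/-- `ϖ_α(t)`, that is `1 - ᾱ t` (disk) or `t - ᾱ` (half plane) for finite `t`. It is extended to
the sphere as a linear form in the homogeneous coordinates, so that the quotients `ϖ*_α / ϖ_α` and
`ϖ_α / ϖ_β` take at `∞` their limit values. -/
def varpi (O : Domain) (a : ℂ) (t : OnePoint ℂ) : ℂ :=
  match O with
  | .disk => hden t - star a * hnum t
  | .halfPlane => hnum t - star a * hden t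

/-- `ϖ*_α(t) = t - α`, in homogeneous coordinates. -/
def varpiStar (a : ℂ) (t : OnePoint ℂ) : ℂ := hnum t - a * hden t

open Classical in
/-- The unimodular constants `z_α`, with `z_{α₀} = 1`. -/
def zconst (O : Domain) (a : ℂ) : ℂ :=
  if a = basePoint O then 1
  else match O with
    | .disk => -((‖a‖ : ℂ) / a)
    | .halfPlane => (‖1 + a ^ 2‖ : ℂ) / (1 + a ^ 2)

/-- `ζ_α = z_α ϖ*_α / ϖ_α`. -/
def zeta (O : Domain) (a : ℂ) (t : OnePoint ℂ) : ℂ :=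
  zconst O a * (varpiStar a t / varpi O a t)

/-- The positive number `ϖ_α(α) / ϖ_{α₀}(α₀)`. -/
def weight (O : Domain) (a : ℂ) : ℝ :=
  match O with
  | .disk => 1 - ‖a‖ ^ 2
  | .halfPlane => a.im

theorem weight_eq (O : Domain) (a : ℂ) :
    (weight O a : ℂ) =
      varpi O a (a : OnePoint ℂ) / varpi O (basePoint O) (basePoint O : OnePoint ℂ) := by
  cases O
  · simp [weight, varpi, basePoint, hnum, hden, Complex.conj_mul']
  · have h : (a - star a : ℂ) = 2 * a.im * Complex.I := by
      simpa using Complex.sub_conj a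
    have h2 : (Complex.I - star Complex.I : ℂ) = 2 * Complex.I := by
      simp; ring
    simp only [weight, varpi, basePoint, hnum, hden, mul_one, h, h2]
    field_simp

/-! ### Wall rational functions -/

/-- The values at a point of `R_n`, `S_n`, `R*_n`, `S*_n`. -/
structure WallValues where
  R : ℂ
  S : ℂ
  Rstar : ℂ
  Sstar : ℂ

/-- The Wall rational functions of the sequences `α = (α_n)` (with `α 0 = α₀`) and `γ = (γ_n)`. -/
def wall (O : Domain) (α γ : ℕ → ℂ) : ℕ → OnePoint ℂ → WallValues
  | 0, _ => ⟨γ 0, 1, star (γ 0), 1⟩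
  | n + 1, t =>
    let w := wall O α γ n t
    let ζ := zeta O (α (n + 1)) t
    ⟨w.R + γ (n + 1) * ζ * w.Sstar,
     w.S + γ (n + 1) * ζ * w.Rstar,
     ζ * w.Rstar + star (γ (n + 1)) * w.S,
     ζ * w.Sstar + star (γ (n + 1)) * w.R⟩

/-! ### Orthogonal rational functions -/

/-- The Blaschke products `B_n = ζ_1 ⋯ ζ_n`, where `ζ_n = ζ_{α_n}`. -/
def blaschke (O : Domain) (α : ℕ → ℂ) (n : ℕ) (t : OnePoint ℂ) : ℂ :=
  ∏ k ∈ Finset.range n, zeta O (α (k + 1)) t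

/-- The pair `(Φ_n, Φ*_n)` generated by the recurrence of the orthogonal rational functions
`(Φ_n, Φ*_n)ᵗ = e_n (ϖ_{n-1}/ϖ_n) [[1, Λ̄_n], [Λ_n, 1]] (z_n z̄_{n-1} ζ_{n-1} Φ_{n-1}, Φ*_{n-1})ᵗ`,
`Φ_0 = Φ*_0 = 1`, from the parameters `γ_{n-1} = -z_n Λ_n`, i.e. `Λ_n = -z̄_n γ_{n-1}`, where
`e_n² = (ϖ_n(α_n) / ϖ_{n-1}(α_{n-1})) / (1 - |Λ_n|²)`. -/
def orfPair (O : Domain) (α γ : ℕ → ℂ) : ℕ → OnePoint ℂ → ℂ × ℂ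
  | 0, _ => (1, 1)
  | n + 1, t =>
    let p := orfPair O α γ n t
    let Λ : ℂ := -(star (zconst O (α (n + 1))) * γ n)
    let e : ℝ := Real.sqrt (weight O (α (n + 1)) / weight O (α n) * (1 / (1 - ‖Λ‖ ^ 2)))
    let ρ : ℂ := e * (varpi O (α n) t / varpi O (α (n + 1)) t)
    let x : ℂ := zconst O (α (n + 1)) * star (zconst O (α n)) * zeta O (α n) t * p.1
    (ρ * (x + star Λ * p.2), ρ * (Λ * x + p.2))

/-- The function `Φ_n` generated from `α` and `γ`. -/
def orf (O : Domain) (α γ : ℕ → ℂ) (n : ℕ) (t : OnePoint ℂ) : ℂ := (orfPair O α γ n t).1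

/-- `(Φ_n)` is an orthonormalization in `L²(μ)` of the Blaschke products `(B_n)`. -/
structure IsOrthonormalization (O : Domain) (α : ℕ → ℂ) (μ : MeasureTheory.Measure (Bdry O))
    (Φ : ℕ → Bdry O → ℂ) : Prop where
  mem_span : ∀ n, Φ n ∈ Submodule.span ℂ
    ((fun (k : ℕ) (t : Bdry O) => blaschke O α k t.1) '' {k | k ≤ n})
  orthonormal : ∀ m n, ∫ t, Φ m t * star (Φ n t) ∂μ = if m = n then 1 else 0

/-- The set `𝔐_α(γ)` of the probability measures on `∂𝕆` whose `α`-parameters are the infinite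
sequence `γ`: the functions generated from `γ` by the recurrence are the orthogonal rational
functions of the measure. -/
def solutions (O : Domain) (α γ : ℕ → ℂ) : Set (MeasureTheory.Measure (Bdry O)) :=
  {μ | MeasureTheory.IsProbabilityMeasure μ ∧
    IsOrthonormalization O α μ (fun n t => orf O α γ n t.1)}

/-! ### Carathéodory and Schur functions, Weyl disks, N-extremal measures -/

/-- The kernel `D(t, z) = (ζ_0(t) + ζ_0(z)) / (ζ_0(t) - ζ_0(z))`. -/
def kernelD (O : Domain) (t z : OnePoint ℂ) : ℂ :=
  (zeta O (basePoint O) t + zeta O (basePoint O) z) /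
    (zeta O (basePoint O) t - zeta O (basePoint O) z)

/-- The C-function `F(z; μ) = ∫ D(t, z) dμ(t)`, for `z ∈ 𝕆`. -/
def cFun (O : Domain) (μ : MeasureTheory.Measure (Bdry O)) (z : ℂ) : ℂ :=
  ∫ t, kernelD O t.1 (z : OnePoint ℂ) ∂μ

/-- The S-function `f(z; μ) = (1 / ζ_0(z)) (F(z; μ) - 1) / (F(z; μ) + 1)`, for `z ∈ 𝕆` other than
the base point (where it has a removable singularity). -/
def sFun (O : Domain) (μ : MeasureTheory.Measure (Bdry O)) (z : ℂ) : ℂ :=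
  1 / zeta O (basePoint O) (z : OnePoint ℂ) * ((cFun O μ z - 1) / (cFun O μ z + 1))

/-- The set `𝕆₀ = 𝕆 \ {α_k : k ≥ 0}`. -/
def region0 (O : Domain) (α : ℕ → ℂ) : Set ℂ := region O \ Set.range α

/-- The Weyl disk `Δ(z)` of the C-functions. -/
def weylDisk (O : Domain) (α γ : ℕ → ℂ) (z : ℂ) : Set ℂ :=
  (fun μ => cFun O μ z) '' solutions O α γ

/-- The Weyl disk `Δ̃(z)` of the S-functions. -/
def schurWeylDisk (O : Domain) (α γ : ℕ → ℂ) (z : ℂ) : Set ℂ :=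
  (fun μ => sFun O μ z) '' solutions O α γ

/-- The N-extremal measures: those `μ ∈ 𝔐_α(γ)` with `F(z; μ) ∈ ∂Δ(z)` for `z ∈ 𝕆₀`. -/
def IsNExtremal (O : Domain) (α γ : ℕ → ℂ) (μ : MeasureTheory.Measure (Bdry O)) : Prop :=
  μ ∈ solutions O α γ ∧ ∀ z ∈ region0 O α, cFun O μ z ∈ frontier (weylDisk O α γ z)

/-! ### The measures `μ⁽ⁿ⁾` and their limits -/

/-- The parametrization `θ ↦ e^{iθ}` of the circle, or `x ↦ x` of the real line. -/
def param : (O : Domain) → ℝ → Bdry O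
  | .disk, θ => ⟨((Complex.exp (θ * Complex.I) : ℂ) : OnePoint ℂ),
      ⟨_, Complex.norm_exp_ofReal_mul_I θ, rfl⟩⟩
  | .halfPlane, x => ⟨((x : ℂ) : OnePoint ℂ), Or.inr ⟨x, rfl⟩⟩

/-- The density of `m_α` in the variable `θ ∈ (0, 2π]`, or `x ∈ ℝ`. -/
def poissonDensity (O : Domain) (a : ℂ) (x : ℝ) : ℝ :=
  match O with
  | .disk => (1 - ‖a‖ ^ 2) / ‖Complex.exp (x * Complex.I) - a‖ ^ 2 / (2 * Real.pi)
  | .halfPlane => a.im / ‖(x : ℂ) - a‖ ^ 2 / Real.pi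

/-- The range of the real parameter. -/
def paramSet : Domain → Set ℝ
  | .disk => Set.Ioc 0 (2 * Real.pi)
  | .halfPlane => Set.univ

/-- The measure `m_α`: `dm_α(t) = (1 - |α|²) / |t - α|² dt / (2πit)` on the circle, or
`dm_α(t) = Im α / |t - α|² dt / π` on the extended real line. -/
def poissonMeasure (O : Domain) (a : ℂ) : MeasureTheory.Measure (Bdry O) :=
  ((MeasureTheory.volume.restrict (paramSet O)).withDensity
    (fun x => ENNReal.ofReal (poissonDensity O a x))).map (param O)

/-- The measure `dμ⁽ⁿ⁾ = dm_{α_n} / |Φ_n|²`. -/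
def approxMeasure (O : Domain) (α γ : ℕ → ℂ) (n : ℕ) : MeasureTheory.Measure (Bdry O) :=
  (poissonMeasure O (α n)).withDensity (fun t => ENNReal.ofReal (1 / ‖orf O α γ n t.1‖ ^ 2))

/-- `μ` is a limit measure of the sequence `ν`: some subsequence of `ν` converges to `μ` in the
weak-* sense, i.e. against all the continuous functions on `∂𝕆`. -/
def IsLimitMeasure {O : Domain} (ν : ℕ → MeasureTheory.Measure (Bdry O))
    (μ : MeasureTheory.Measure (Bdry O)) : Prop :=
  ∃ φ : ℕ → ℕ, StrictMono φ ∧ ∀ g : C(Bdry O, ℝ),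
    Filter.Tendsto (fun k => ∫ t, g t ∂(ν (φ k))) Filter.atTop (nhds (∫ t, g t ∂μ))

end RatORF

end

open Filter Topology ComplexConjugate MeasureTheory Polynomial

noncomputable section

namespace RatORF

/-! Everything is carried to the unit disk by `toDisk`, with the boundary identified with the circle
by `bdryMap`; `DiskData` keeps exactly the constants that survive the transport, so both settings
share one proof.

Fix a solution `μ` and a point `w` of the disk that is none of the `a_k`. The integrals `Q_n`,
`Q*_n` of `Φ_n`, `Φ̄_n` against the kernel satisfy the recurrence of `(Φ_n, Φ*_n)`
(`OrthoUpTo.Q_succ`, `OrthoUpTo.Qstar_succ`), and Bessel's inequality gives `|Q*_n| ≤ |Q_n|`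
(`OrthoUpTo.norm_Qstar_le`). The Wall matrix inverts the product of the transfer matrices up to a
scalar, so the Schur function of `μ` equals `(R_n + S*_n v) / (S_n + R*_n v)` at `w` for some `|v| ≤
1` (`OrthoUpTo.schur_eq`). Hence the Weyl disk lies in the image of the closed unit disk under this
Möbius map. For `μ⁽ⁿ⁺¹⁾`, which has the first orthogonality relations by Poisson's formula,
`Q*_{n+1} = 0`; therefore `v = 0` and the value is the centre value `R_n / S_n`
(`IsApprox.schur_mul`).

Put `g_n = R*_n / S_n`. The recurrence of `g_n` shows that if `|γ_{n+1}|` is near `1`, then `g_n` or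
`g_{n+1}` is near the unit circle (`one_sub_norm_ratio_sq_le`). So `|g_n(0)| → 1` along a
subsequence, and Schwarz–Pick spreads this to every point of the disk (`tendsto_norm_ratio`). When
`|g_n|` is near `1`, the Möbius map is nearly degenerate: the point `v = 2u`, with `u` unimodular
and `g_n u ≥ 0`, is sent outside the image disk but within `2(1 - |g_n|²)` of `R_n / S_n`
(`exists_near_not_mem`).

Weak-* compactness gives a further subsequence along which `μ⁽ⁿ⁺¹⁾` converges to a solution `μ`, and
then `R_n / S_n` converges to its Schur function. This value belongs to the Weyl disk and is a limit
of points outside it, so it lies on the frontier. The Möbius relation between `f` and `F` carries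
the same exterior points to the disk of the C-functions, so `μ` is N-extremal. -/

/-- The recurrence data transported to the unit disk: points `a n`, the parameters `γ n`, and the
constants `η n`, `r n`, `z n` of the Blaschke factors and of the recurrence. -/
structure DiskData where
  a : ℕ → ℂ
  η : ℕ → ℂ
  r : ℕ → ℂ
  z : ℕ → ℂ
  γ : ℕ → ℂ
  a_zero : a 0 = 0
  η_zero : η 0 = 1
  z_zero : z 0 = 1
  norm_a : ∀ n, ‖a n‖ < 1
  norm_η : ∀ n, ‖η n‖ = 1
  norm_z : ∀ n, ‖z n‖ = 1
  norm_γ : ∀ n, ‖γ n‖ < 1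
  norm_r : ∀ n, ‖r n‖ ^ 2 * ((1 - ‖a n‖ ^ 2) * (1 - ‖γ n‖ ^ 2)) = 1 - ‖a (n + 1)‖ ^ 2
  compat : ∀ n, η (n + 1) * conj (z (n + 1) * conj (z n)) * conj (r n) = η n * r n

/-! ### Elementary identities for disk automorphisms -/

theorem one_sub_conj_mul_ne_zero {a s : ℂ} (ha : ‖a‖ < 1) (hs : ‖s‖ ≤ 1) :
    1 - conj a * s ≠ 0 := by
  intro h
  have h1 : conj a * s = 1 := by linear_combination -h
  have h2 : ‖a‖ * ‖s‖ = 1 := by simpa using congrArg norm h1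
  nlinarith [norm_nonneg a, norm_nonneg s]

theorem one_add_mul_ne_zero {u v : ℂ} (hu : ‖u‖ < 1) (hv : ‖v‖ ≤ 1) : 1 + u * v ≠ 0 := by
  have := one_sub_conj_mul_ne_zero (a := -conj u) (s := v) (by simpa using hu) hv
  simpa using this

/-- `|u + v|² + (1 - |u|²)(1 - |v|²) = |1 + ū v|²`. -/
theorem norm_one_add_conj_mul_sq (u v : ℂ) :
    ‖1 + conj u * v‖ ^ 2 = ‖u + v‖ ^ 2 + (1 - ‖u‖ ^ 2) * (1 - ‖v‖ ^ 2) := by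
  simp only [← Complex.normSq_eq_norm_sq, Complex.normSq_apply]
  simp
  ring

theorem norm_add_le_norm_one_add_conj_mul {u v : ℂ} (hu : ‖u‖ ≤ 1) (hv : ‖v‖ ≤ 1) :
    ‖u + v‖ ≤ ‖1 + conj u * v‖ := by
  have h := norm_one_add_conj_mul_sq u v
  have h1 : 0 ≤ (1 - ‖u‖ ^ 2) * (1 - ‖v‖ ^ 2) :=
    mul_nonneg (by nlinarith [norm_nonneg u]) (by nlinarith [norm_nonneg v])
  exact (sq_le_sq₀ (norm_nonneg _) (norm_nonneg _)).1 (by linarith)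

theorem norm_sub_sq_add (a s : ℂ) :
    ‖s - a‖ ^ 2 + (1 - ‖a‖ ^ 2) * (1 - ‖s‖ ^ 2) = ‖1 - conj a * s‖ ^ 2 := by
  have := norm_one_add_conj_mul_sq (-a) s
  rw [norm_neg] at this
  rw [show 1 - conj a * s = 1 + conj (-a) * s by simp; ring, this]
  ring_nf

theorem conj_eq_inv_of_norm_one {s : ℂ} (hs : ‖s‖ = 1) : conj s = s⁻¹ := by
  have h := Complex.conj_mul' s
  have h0 : s ≠ 0 := by rintro rfl; simp at hs
  rw [hs] at h
  field_simp
  simpa using h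

/-! ### Orthogonal rational functions on the disk -/

namespace DiskData

variable (D : DiskData)

def c (n : ℕ) : ℂ := D.z (n + 1) * conj (D.z n)

def Λ (n : ℕ) : ℂ := -(conj (D.z (n + 1)) * D.γ n)

/-- The Blaschke factors. -/
def zeta (n : ℕ) (s : ℂ) : ℂ := D.η n * ((s - D.a n) / (1 - conj (D.a n) * s))

def rho (n : ℕ) (s : ℂ) : ℂ :=
  D.r n * ((1 - conj (D.a n) * s) / (1 - conj (D.a (n + 1)) * s))

/-- The pair of orthogonal rational functions `(Φ_n, Φ*_n)`. -/
def pair : ℕ → ℂ → ℂ × ℂ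
  | 0, _ => (1, 1)
  | n + 1, s =>
    (D.rho n s * (D.c n * D.zeta n s * (pair n s).1 + conj (D.Λ n) * (pair n s).2),
     D.rho n s * (D.Λ n * (D.c n * D.zeta n s * (pair n s).1) + (pair n s).2))

def phi (n : ℕ) (s : ℂ) : ℂ := (D.pair n s).1

def phiStar (n : ℕ) (s : ℂ) : ℂ := (D.pair n s).2

@[simp] theorem phi_zero (s : ℂ) : D.phi 0 s = 1 := rfl
@[simp] theorem phiStar_zero (s : ℂ) : D.phiStar 0 s = 1 := rfl

theorem phi_succ (n : ℕ) (s : ℂ) : D.phi (n + 1) s =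
    D.rho n s * (D.c n * D.zeta n s * D.phi n s + conj (D.Λ n) * D.phiStar n s) := rfl

theorem phiStar_succ (n : ℕ) (s : ℂ) : D.phiStar (n + 1) s =
    D.rho n s * (D.Λ n * (D.c n * D.zeta n s * D.phi n s) + D.phiStar n s) := rfl

/-- The Blaschke products `ζ_1 ⋯ ζ_n`. -/
def B (n : ℕ) (s : ℂ) : ℂ := ∏ k ∈ Finset.range n, D.zeta (k + 1) s

theorem B_succ (n : ℕ) (s : ℂ) : D.B (n + 1) s = D.B n s * D.zeta (n + 1) s :=
  Finset.prod_range_succ _ _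

@[simp] theorem B_zero (s : ℂ) : D.B 0 s = 1 := rfl

theorem norm_c (n : ℕ) : ‖D.c n‖ = 1 := by simp [c, D.norm_z]

theorem norm_Λ (n : ℕ) : ‖D.Λ n‖ = ‖D.γ n‖ := by simp [Λ, D.norm_z]

theorem norm_Λ_lt (n : ℕ) : ‖D.Λ n‖ < 1 := by rw [norm_Λ]; exact D.norm_γ n

theorem η_ne_zero (n : ℕ) : D.η n ≠ 0 := norm_ne_zero_iff.1 (by rw [D.norm_η]; exact one_ne_zero)

theorem c_ne_zero (n : ℕ) : D.c n ≠ 0 := norm_ne_zero_iff.1 (by rw [D.norm_c]; exact one_ne_zero)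

theorem one_sub_norm_a_sq_pos (n : ℕ) : 0 < 1 - ‖D.a n‖ ^ 2 := by
  nlinarith [D.norm_a n, norm_nonneg (D.a n)]

theorem one_sub_norm_γ_sq_pos (n : ℕ) : 0 < 1 - ‖D.γ n‖ ^ 2 := by
  nlinarith [D.norm_γ n, norm_nonneg (D.γ n)]

theorem r_ne_zero (n : ℕ) : D.r n ≠ 0 := by
  intro h
  have := D.norm_r n
  have := D.one_sub_norm_a_sq_pos (n + 1)
  simp_all

theorem den_ne_zero (n : ℕ) {s : ℂ} (hs : ‖s‖ ≤ 1) : 1 - conj (D.a n) * s ≠ 0 :=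
  one_sub_conj_mul_ne_zero (D.norm_a n) hs

theorem rho_ne_zero (n : ℕ) {s : ℂ} (hs : ‖s‖ ≤ 1) : D.rho n s ≠ 0 :=
  mul_ne_zero (D.r_ne_zero n) (div_ne_zero (D.den_ne_zero n hs) (D.den_ne_zero _ hs))

theorem norm_zeta_sq (n : ℕ) {s : ℂ} (hs : ‖s‖ ≤ 1) :
    ‖1 - conj (D.a n) * s‖ ^ 2 * (1 - ‖D.zeta n s‖ ^ 2) =
      (1 - ‖D.a n‖ ^ 2) * (1 - ‖s‖ ^ 2) := by
  have h := norm_sub_sq_add (D.a n) s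
  have h0 := norm_ne_zero_iff.2 (D.den_ne_zero n hs)
  rw [zeta, norm_mul, D.norm_η, one_mul, norm_div]
  field_simp
  linarith

theorem norm_zeta_le (n : ℕ) {s : ℂ} (hs : ‖s‖ ≤ 1) : ‖D.zeta n s‖ ≤ 1 := by
  have h := D.norm_zeta_sq n hs
  have h0 : 0 < ‖1 - conj (D.a n) * s‖ ^ 2 :=
    pow_pos (norm_pos_iff.2 (D.den_ne_zero n hs)) 2
  have h1 : 0 ≤ (1 - ‖D.a n‖ ^ 2) * (1 - ‖s‖ ^ 2) :=
    mul_nonneg (D.one_sub_norm_a_sq_pos n).le (by nlinarith [norm_nonneg s])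
  have h2 : 0 ≤ 1 - ‖D.zeta n s‖ ^ 2 := by
    by_contra hc
    nlinarith
  nlinarith [norm_nonneg (D.zeta n s)]

theorem norm_zeta_eq (n : ℕ) {s : ℂ} (hs : ‖s‖ = 1) : ‖D.zeta n s‖ = 1 := by
  have h := D.norm_zeta_sq n hs.le
  have h0 : 0 < ‖1 - conj (D.a n) * s‖ ^ 2 :=
    pow_pos (norm_pos_iff.2 (D.den_ne_zero n hs.le)) 2
  have h2 : 1 - ‖D.zeta n s‖ ^ 2 = 0 := by
    rw [hs] at h
    have : ‖1 - conj (D.a n) * s‖ ^ 2 * (1 - ‖D.zeta n s‖ ^ 2) = 0 := by rw [h]; ring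
    exact (mul_eq_zero.1 this).resolve_left h0.ne'
  nlinarith [norm_nonneg (D.zeta n s)]

theorem zeta_zero (s : ℂ) : D.zeta 0 s = s := by simp [zeta, D.a_zero, D.η_zero]

theorem zeta_self (n : ℕ) : D.zeta n (D.a n) = 0 := by simp [zeta]

theorem zeta_ne_zero_of_ne (n : ℕ) {s : ℂ} (hs : ‖s‖ ≤ 1) (h : s ≠ D.a n) : D.zeta n s ≠ 0 :=
  mul_ne_zero (D.η_ne_zero n) (div_ne_zero (sub_ne_zero.2 h) (D.den_ne_zero n hs))

theorem ne_a_of_norm_one (n : ℕ) {s : ℂ} (hs : ‖s‖ = 1) : s ≠ D.a n := by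
  rintro rfl
  exact (D.norm_a n).ne hs

/-- In terms of `y = c_n ζ_n Φ_n / Φ*_n`, one step of the recurrence sends the quotient to `(Λ̄_n +
y) / (1 + Λ_n y)`. This is a disk automorphism applied to a point of the closed disk, so the bound
and the nonvanishing of the denominator propagate together. -/
theorem phi_phiStar_bound (n : ℕ) {s : ℂ} (hs : ‖s‖ ≤ 1) :
    D.phiStar n s ≠ 0 ∧ ‖D.phi n s‖ ≤ ‖D.phiStar n s‖ := by
  induction n with
  | zero => simp
  | succ n ih =>
    obtain ⟨h0, h1⟩ := ih
    set y := D.c n * D.zeta n s * (D.phi n s / D.phiStar n s) with hy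
    have hy1 : ‖y‖ ≤ 1 := by
      rw [hy, norm_mul, norm_mul, norm_c, one_mul, norm_div]
      exact mul_le_one₀ (D.norm_zeta_le n hs) (by positivity)
        (div_le_one_of_le₀ h1 (norm_nonneg _))
    have e1 : D.phi (n + 1) s = D.rho n s * D.phiStar n s * (conj (D.Λ n) + y) := by
      rw [phi_succ, hy]; field_simp; ring
    have e2 : D.phiStar (n + 1) s = D.rho n s * D.phiStar n s * (1 + D.Λ n * y) := by
      rw [phiStar_succ, hy]; field_simp; ring
    refine ⟨?_, ?_⟩
    · rw [e2]
      exact mul_ne_zero (mul_ne_zero (D.rho_ne_zero n hs) h0)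
        (one_add_mul_ne_zero (D.norm_Λ_lt n) hy1)
    · rw [e1, e2, norm_mul, norm_mul (D.rho n s * _)]
      refine mul_le_mul_of_nonneg_left ?_ (norm_nonneg _)
      have := norm_add_le_norm_one_add_conj_mul (u := conj (D.Λ n)) (v := y)
        (by simpa using (D.norm_Λ_lt n).le) hy1
      simpa using this

theorem phiStar_ne_zero (n : ℕ) {s : ℂ} (hs : ‖s‖ ≤ 1) : D.phiStar n s ≠ 0 :=
  (D.phi_phiStar_bound n hs).1

/-- The denominator of `Re ((1 - v) / (1 + v))`, `v = Λ c ζ Φ / Φ*`, does not vanish. -/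
theorem phiStar_add_ne_zero (n : ℕ) {s : ℂ} (hs : ‖s‖ ≤ 1) :
    D.Λ n * (D.c n * D.zeta n s * D.phi n s) + D.phiStar n s ≠ 0 := by
  have h := D.phiStar_ne_zero (n + 1) hs
  rw [phiStar_succ] at h
  exact right_ne_zero_of_mul h

theorem conj_den {a s : ℂ} (hs : ‖s‖ = 1) : conj (1 - conj a * s) = (s - a) / s := by
  have h0 : s ≠ 0 := by rintro rfl; simp at hs
  simp [conj_eq_inv_of_norm_one hs]
  field_simp

/-- The field `compat` exists for this identity: it makes the factor `ρ_n` compatible with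
conjugation on the circle, which is what lets `Φ*_n = B_n Φ̄_n` pass from `n` to `n + 1`. -/
theorem conj_rho (n : ℕ) {s : ℂ} (hs : ‖s‖ = 1) :
    D.zeta (n + 1) s * conj (D.c n) * conj (D.rho n s) = D.rho n s * D.zeta n s := by
  have h0 : s ≠ 0 := by rintro rfl; simp at hs
  have h1 := D.den_ne_zero n hs.le
  have h2 := D.den_ne_zero (n + 1) hs.le
  have h3 := sub_ne_zero.2 (D.ne_a_of_norm_one n hs)
  have h4 := sub_ne_zero.2 (D.ne_a_of_norm_one (n + 1) hs)
  have h5 := D.compat n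
  rw [zeta, rho, zeta, c, map_mul (starRingEnd ℂ) (D.r n), map_div₀, conj_den hs, conj_den hs]
  have : D.η (n + 1) * ((s - D.a (n + 1)) / (1 - conj (D.a (n + 1)) * s)) *
      conj (D.z (n + 1) * conj (D.z n)) *
      (conj (D.r n) * ((s - D.a n) / s / ((s - D.a (n + 1)) / s))) =
      (D.η (n + 1) * conj (D.z (n + 1) * conj (D.z n)) * conj (D.r n)) *
      ((s - D.a n) / (1 - conj (D.a (n + 1)) * s)) := by
    field_simp
  rw [this, h5]
  generalize 1 - conj (D.a n) * s = u at h1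
  generalize 1 - conj (D.a (n + 1)) * s = v at h2
  field_simp

theorem norm_one_mul_conj {x : ℂ} (hx : ‖x‖ = 1) : x * conj x = 1 := by
  rw [Complex.mul_conj', hx]; simp

/-- On the unit circle, `Φ*_n = B_n Φ̄_n`. -/
theorem phiStar_eq (n : ℕ) {s : ℂ} (hs : ‖s‖ = 1) :
    D.phiStar n s = D.B n s * conj (D.phi n s) := by
  induction n with
  | zero => simp
  | succ n ih =>
    have hz := norm_one_mul_conj (D.norm_zeta_eq n hs)
    have hc := norm_one_mul_conj (D.norm_c n)
    have hB : D.B n s * conj (D.B n s) = 1 := by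
      apply norm_one_mul_conj
      rw [B, norm_prod]
      exact Finset.prod_eq_one fun k _ => D.norm_zeta_eq _ hs
    have hr := D.conj_rho n hs
    rw [phiStar_succ, phi_succ, B_succ]
    simp only [map_add, map_mul, Complex.conj_conj, ih]
    have e1 : D.zeta (n + 1) s * conj (D.rho n s) = D.rho n s * D.zeta n s * D.c n := by
      rw [← hr]; linear_combination -D.zeta (n + 1) s * conj (D.rho n s) * hc
    linear_combination (-(D.Λ n) * D.phi n s * D.B n s * conj (D.B n s) -
      D.B n s * conj (D.c n) * conj (D.zeta n s) * conj (D.phi n s)) * e1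
      - D.Λ n * D.phi n s * D.rho n s * D.zeta n s * D.c n * hB
      - D.B n s * D.rho n s * conj (D.phi n s) * (D.zeta n s * conj (D.zeta n s) * hc + hz)

theorem norm_B_eq (n : ℕ) {s : ℂ} (hs : ‖s‖ = 1) : ‖D.B n s‖ = 1 := by
  rw [B, norm_prod]
  exact Finset.prod_eq_one fun k _ => D.norm_zeta_eq _ hs

theorem phi_ne_zero (n : ℕ) {s : ℂ} (hs : ‖s‖ = 1) : D.phi n s ≠ 0 := by
  intro h
  have := D.phiStar_ne_zero n hs.le
  rw [D.phiStar_eq n hs, h] at this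
  simp at this

/-! ### Polynomial form -/

/-- `∏_{k<n} (X - a_k)`. -/
def P (n : ℕ) : ℂ[X] := ∏ k ∈ Finset.range n, (X - C (D.a k))

/-- `∏_{k<n} (1 - ā_k X)`. -/
def E (n : ℕ) : ℂ[X] := ∏ k ∈ Finset.range n, (1 - C (conj (D.a k)) * X)

def H (n : ℕ) : ℂ := ∏ k ∈ Finset.range n, D.η (k + 1)

theorem H_ne_zero (n : ℕ) : D.H n ≠ 0 := Finset.prod_ne_zero_iff.2 fun _ _ => D.η_ne_zero _

theorem P_eval_succ (n : ℕ) (s : ℂ) :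
    (D.P (n + 1)).eval s = (D.P n).eval s * (s - D.a n) := by
  simp [P, Finset.prod_range_succ]

theorem E_eval_succ (n : ℕ) (s : ℂ) :
    (D.E (n + 1)).eval s = (D.E n).eval s * (1 - conj (D.a n) * s) := by
  simp [E, Finset.prod_range_succ]

theorem P_natDegree (n : ℕ) : (D.P n).natDegree ≤ n := by
  refine (natDegree_prod_le _ _).trans ((Finset.sum_le_card_nsmul _ _ 1 fun _ _ => ?_).trans ?_)
  · simp
  · simp

theorem natDegree_one_sub_le (a : ℂ) : (1 - C a * X : ℂ[X]).natDegree ≤ 1 := by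
  compute_degree

theorem E_natDegree (n : ℕ) : (D.E n).natDegree ≤ n := by
  refine (natDegree_prod_le _ _).trans ((Finset.sum_le_card_nsmul _ _ 1 fun _ _ => ?_).trans ?_)
  · exact natDegree_one_sub_le _
  · simp

theorem E_eval_ne_zero (n : ℕ) {s : ℂ} (hs : ‖s‖ ≤ 1) : (D.E n).eval s ≠ 0 := by
  rw [E, eval_prod]
  refine Finset.prod_ne_zero_iff.2 fun k _ => ?_
  simpa using D.den_ne_zero k hs

theorem P_eval_ne_zero (n : ℕ) {s : ℂ} (hs : ∀ k, s ≠ D.a k) : (D.P n).eval s ≠ 0 := by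
  rw [P, eval_prod]
  refine Finset.prod_ne_zero_iff.2 fun k _ => ?_
  simpa using sub_ne_zero.2 (hs k)

/-- `B_n` starts with `ζ_1`, whereas `P_{n+1}` and `E_{n+1}` start at `a_0 = 0`. Their extra factors
are `s` and `1`, whence the factor `s` on the left. -/
theorem mul_B (n : ℕ) {s : ℂ} (hs : ‖s‖ ≤ 1) :
    s * D.B n s = D.H n * ((D.P (n + 1)).eval s / (D.E (n + 1)).eval s) := by
  induction n with
  | zero => simp [H, P, E, D.a_zero]
  | succ n ih =>
    rw [B_succ, ← mul_assoc, ih, P_eval_succ _ (n + 1), E_eval_succ _ (n + 1), zeta, H, H,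
      Finset.prod_range_succ]
    have := D.E_eval_ne_zero (n + 1) hs
    have := D.den_ne_zero (n + 1) hs
    field_simp

/-- `E_{n+1}` has `n + 1` factors, but the one of index `0` is `1`; so degree `n` is the natural
bound for the numerators. Each step multiplies by one linear polynomial above and one below. -/
theorem exists_polynomial (n : ℕ) : ∃ p q : ℂ[X], p.natDegree ≤ n ∧ q.natDegree ≤ n ∧
    ∀ s, ‖s‖ ≤ 1 → D.phi n s = p.eval s / (D.E (n + 1)).eval s ∧
      D.phiStar n s = q.eval s / (D.E (n + 1)).eval s := by
  induction n with
  | zero =>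
    refine ⟨1, 1, by simp, by simp, fun s _ => ?_⟩
    simp [E, D.a_zero]
  | succ n ih =>
    obtain ⟨p, q, hp, hq, h⟩ := ih
    have d1 : ∀ (α β : ℂ) , (C (D.r n) * (C α * (X - C (D.a n)) * p +
        C β * (1 - C (conj (D.a n)) * X) * q)).natDegree ≤ n + 1 := by
      intro α β
      refine (natDegree_C_mul_le _ _).trans (natDegree_add_le_of_degree_le ?_ ?_)
      · rw [mul_assoc]
        refine (natDegree_C_mul_le _ _).trans (natDegree_mul_le.trans ?_)
        have : (X - C (D.a n)).natDegree ≤ 1 := by simp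
        omega
      · rw [mul_assoc]
        refine (natDegree_C_mul_le _ _).trans (natDegree_mul_le.trans ?_)
        have := natDegree_one_sub_le (conj (D.a n))
        omega
    refine ⟨_, _, d1 (D.c n * D.η n) (conj (D.Λ n)), d1 (D.Λ n * D.c n * D.η n) 1,
      fun s hs => ?_⟩
    obtain ⟨h1, h2⟩ := h s hs
    have := D.E_eval_ne_zero (n + 1) hs
    have := D.den_ne_zero (n + 1) hs
    have := D.den_ne_zero n hs
    rw [phi_succ, phiStar_succ, h1, h2, rho, zeta, E_eval_succ _ (n + 1)]
    constructor <;> simp <;> field_simp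

end DiskData

/-! ### Orthogonality and Bessel's inequality for continuous functions -/

/-- A dimension count: the span of `ψ` has dimension `m + 1` and lies in the image under `L` of the
polynomials of degree at most `m`, whose dimension is at most `m + 1`. So the two coincide. -/
theorem mem_span_range_of_polynomial {V : Type*} [AddCommGroup V] [Module ℂ V]
    (L : ℂ[X] →ₗ[ℂ] V) {m : ℕ} {ψ : Fin (m + 1) → V} (hψ : LinearIndependent ℂ ψ)
    (h : ∀ k, ∃ q : ℂ[X], q.natDegree ≤ m ∧ L q = ψ k) {q : ℂ[X]} (hq : q.natDegree ≤ m) :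
    L q ∈ Submodule.span ℂ (Set.range ψ) := by
  have hdeg : ∀ p : ℂ[X], p.natDegree ≤ m → p ∈ degreeLT ℂ (m + 1) := fun p hp => by
    rw [mem_degreeLT]
    exact lt_of_le_of_lt degree_le_natDegree (by exact_mod_cast Nat.lt_succ_of_le hp)
  let W := Submodule.map L (degreeLT ℂ (m + 1))
  have : Module.Finite ℂ (degreeLT ℂ (m + 1)) :=
    Module.Finite.equiv (degreeLTEquiv ℂ (m + 1)).symm
  have hW : Module.finrank ℂ W ≤ m + 1 := by
    refine (Submodule.finrank_map_le L _).trans ?_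
    rw [(degreeLTEquiv ℂ (m + 1)).finrank_eq]
    simp
  have hle : Submodule.span ℂ (Set.range ψ) ≤ W := by
    rw [Submodule.span_le]
    rintro _ ⟨k, rfl⟩
    obtain ⟨p, hp, hk⟩ := h k
    exact ⟨p, hdeg p hp, hk⟩
  have hfin : Module.finrank ℂ (Submodule.span ℂ (Set.range ψ)) = m + 1 := by
    rw [finrank_span_eq_card hψ, Fintype.card_fin]
  rw [Submodule.eq_of_le_of_finrank_le hle (by rw [hfin]; exact hW)]
  exact ⟨q, hdeg q hq, rfl⟩

section Compact

variable {T : Type*} [TopologicalSpace T] [CompactSpace T] [MeasurableSpace T] [BorelSpace T]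
  {μ : Measure T} [IsFiniteMeasure μ]

theorem integrable_of_continuous {f : T → ℂ} (hf : Continuous f) : Integrable f μ :=
  hf.integrable_of_hasCompactSupport (HasCompactSupport.of_compactSpace f)

theorem linearIndependent_of_orthonormal {m : ℕ} {ψ : Fin m → T → ℂ}
    (hc : ∀ k, Continuous (ψ k))
    (horth : ∀ j k, ∫ x, ψ j x * conj (ψ k x) ∂μ = if j = k then 1 else 0) :
    LinearIndependent ℂ ψ := by
  rw [Fintype.linearIndependent_iff]
  intro g hg j
  have h1 : ∫ x, (∑ i, g i • ψ i) x * conj (ψ j x) ∂μ = g j := by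
    simp only [Finset.sum_apply, Pi.smul_apply, smul_eq_mul, Finset.sum_mul, mul_assoc]
    rw [integral_finsetSum]
    · simp [integral_const_mul, horth]
    · intro i _
      have := hc i
      have := hc j
      exact integrable_of_continuous (by fun_prop)
  rw [hg] at h1
  simpa using h1.symm

/-- Orthonormality makes the `m + 1` functions `ψ_k` independent, hence they span all the `q(σ) w`
with `q` of degree at most `m`. A function that annihilates the `ψ_k` then annihilates the whole
space, and no explicit expansion of `q` is needed. -/
theorem integral_mul_polynomial_eq_zero {m : ℕ} {ψ : Fin (m + 1) → T → ℂ}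
    (hc : ∀ k, Continuous (ψ k))
    (horth : ∀ j k, ∫ x, ψ j x * conj (ψ k x) ∂μ = if j = k then 1 else 0)
    {σ w g : T → ℂ} (hg : Continuous g) (hgψ : ∀ k, ∫ x, g x * ψ k x ∂μ = 0)
    (hψ : ∀ k, ∃ q : ℂ[X], q.natDegree ≤ m ∧ ∀ x, q.eval (σ x) * w x = ψ k x)
    {q : ℂ[X]} (hq : q.natDegree ≤ m) :
    ∫ x, g x * (q.eval (σ x) * w x) ∂μ = 0 := by
  let L : ℂ[X] →ₗ[ℂ] T → ℂ :=
    { toFun := fun q x => q.eval (σ x) * w x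
      map_add' := fun p q => by ext x; simp [add_mul]
      map_smul' := fun c q => by ext x; simp [mul_assoc] }
  have hmem : L q ∈ Submodule.span ℂ (Set.range ψ) :=
    mem_span_range_of_polynomial L (linearIndependent_of_orthonormal hc horth)
      (fun k => (hψ k).imp fun q hq => ⟨hq.1, funext hq.2⟩) hq
  suffices ∀ v ∈ Submodule.span ℂ (Set.range ψ), Continuous v ∧ ∫ x, g x * v x ∂μ = 0 from
    (this _ hmem).2
  intro v hv
  induction hv using Submodule.span_induction with
  | mem v h =>
    obtain ⟨k, rfl⟩ := h
    exact ⟨hc k, hgψ k⟩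
  | zero => exact ⟨continuous_const, by simp⟩
  | add u v _ _ hu hv =>
    refine ⟨hu.1.add hv.1, ?_⟩
    simp only [Pi.add_apply, mul_add]
    have h1 : Integrable (fun x => g x * u x) μ := integrable_of_continuous (hg.mul hu.1)
    have h2 : Integrable (fun x => g x * v x) μ := integrable_of_continuous (hg.mul hv.1)
    rw [integral_add h1 h2, hu.2, hv.2, add_zero]
  | smul a v _ hv =>
    refine ⟨hv.1.const_smul a, ?_⟩
    simp only [Pi.smul_apply, smul_eq_mul, mul_left_comm _ a]
    rw [integral_const_mul, hv.2, mul_zero]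

/-- If `ψ` annihilates the functions `q / d` with `q` of degree at most `m`, then integration
against `ψ(t) / (s(t) - w)` treats `n / d`, with `n` and `d` of degree at most `m + 1`, as the
constant `n(w) / d(w)`. -/
theorem integral_kernel_mul {σ ψ : T → ℂ} (hσ : Continuous σ) (hψ : Continuous ψ) {m : ℕ}
    {n d : ℂ[X]} (hn : n.natDegree ≤ m + 1) (hd : d.natDegree ≤ m + 1)
    (hdσ : ∀ x, d.eval (σ x) ≠ 0) {w : ℂ} (hdw : d.eval w ≠ 0) (hw : ∀ x, σ x ≠ w)
    (h : ∀ q : ℂ[X], q.natDegree ≤ m → ∫ x, ψ x * (q.eval (σ x) / d.eval (σ x)) ∂μ = 0) :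
    ∫ x, ψ x / (σ x - w) * (n.eval (σ x) / d.eval (σ x)) ∂μ =
      n.eval w / d.eval w * ∫ x, ψ x / (σ x - w) ∂μ := by
  have hw' : ∀ x, σ x - w ≠ 0 := fun x => sub_ne_zero.2 (hw x)
  -- This combination vanishes at `w`. Dividing by `X - w` cancels the pole of the kernel and lowers
  -- the degree to at most `m`, where `h` applies.
  let p : ℂ[X] := n * C (d.eval w) - C (n.eval w) * d
  have hp : p.natDegree ≤ m + 1 :=
    (natDegree_sub_le_of_le ((natDegree_mul_C_le _ _).trans hn)
      ((natDegree_C_mul_le _ _).trans hd)).trans (max_self _).le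
  have hroot : p.IsRoot w := by simp [p, mul_comm]
  have hpq : (X - C w) * (p /ₘ (X - C w)) = p := mul_divByMonic_eq_iff_isRoot.2 hroot
  have hq : (p /ₘ (X - C w)).natDegree ≤ m := by
    rw [natDegree_divByMonic _ (monic_X_sub_C w), natDegree_X_sub_C]
    omega
  have h1 := h _ hq
  have hcσ : ∀ q : ℂ[X], Continuous fun x => q.eval (σ x) := fun q => q.continuous.comp hσ
  have h2 : ∀ x, ψ x / (σ x - w) * (n.eval (σ x) / d.eval (σ x)) -
      n.eval w / d.eval w * (ψ x / (σ x - w)) =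
      (d.eval w)⁻¹ * (ψ x * ((p /ₘ (X - C w)).eval (σ x) / d.eval (σ x))) := fun x => by
    have e := congrArg (eval (σ x)) hpq
    simp only [eval_mul, eval_sub, eval_X, eval_C, p] at e
    have := hw' x
    have := hdσ x
    have e' : (eval w d * eval (σ x) n - eval w n * eval (σ x) d) =
        (σ x - w) * eval (σ x) (p /ₘ (X - C w)) := by rw [e]; ring
    field_simp
    linear_combination ψ x * e'
  have c1 : Continuous fun x => ψ x / (σ x - w) * (n.eval (σ x) / d.eval (σ x)) :=
    (hψ.div (hσ.sub continuous_const) hw').mul ((hcσ n).div (hcσ d) hdσ)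
  have c2 : Continuous fun x => n.eval w / d.eval w * (ψ x / (σ x - w)) :=
    continuous_const.mul (hψ.div (hσ.sub continuous_const) hw')
  have h3 : ∫ x, (ψ x / (σ x - w) * (n.eval (σ x) / d.eval (σ x)) -
      n.eval w / d.eval w * (ψ x / (σ x - w))) ∂μ = 0 := by
    simp_rw [h2]
    rw [integral_const_mul, h1, mul_zero]
  rw [integral_sub (integrable_of_continuous c1) (integrable_of_continuous c2),
    integral_const_mul, sub_eq_zero] at h3
  exact h3

/-- Bessel's inequality for continuous functions on a compact space. -/
theorem bessel_of_continuous {m : ℕ} {ψ : Fin m → T → ℂ} (hc : ∀ k, Continuous (ψ k))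
    (horth : ∀ j k, ∫ x, ψ j x * conj (ψ k x) ∂μ = if j = k then 1 else 0)
    {g : T → ℂ} (hg : Continuous g) :
    ∑ k, ‖∫ x, g x * ψ k x ∂μ‖ ^ 2 ≤ ∫ x, ‖g x‖ ^ 2 ∂μ := by
  let v : Fin m → Lp ℂ 2 μ := fun k => ContinuousMap.toLp 2 μ ℂ ⟨ψ k, hc k⟩
  let u : Lp ℂ 2 μ := ContinuousMap.toLp 2 μ ℂ ⟨fun x => conj (g x), by fun_prop⟩
  have hv : Orthonormal ℂ v := by
    rw [orthonormal_iff_ite]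
    intro i j
    rw [MeasureTheory.ContinuousMap.inner_toLp]
    simp only [ContinuousMap.coe_mk]
    rw [horth]
    simp [eq_comm]
  have h := hv.sum_inner_products_le (s := Finset.univ) u
  have h1 : ∀ k, ‖inner ℂ (v k) u‖ = ‖∫ x, g x * ψ k x ∂μ‖ := fun k => by
    rw [MeasureTheory.ContinuousMap.inner_toLp]
    simp only [ContinuousMap.coe_mk]
    rw [← Complex.norm_conj (∫ x, g x * ψ k x ∂μ), ← integral_conj]
    simp
  have h2 : ‖u‖ ^ 2 = ∫ x, ‖g x‖ ^ 2 ∂μ := by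
    have : (inner ℂ u u : ℂ) = ((∫ x, ‖g x‖ ^ 2 ∂μ : ℝ) : ℂ) := by
      rw [MeasureTheory.ContinuousMap.inner_toLp, ← integral_complex_ofReal]
      simp [Complex.conj_mul']
    rw [inner_self_eq_norm_sq_to_K] at this
    exact Complex.ofReal_injective (by simpa using this)
  simpa only [h1, h2] using h

end Compact

/-! ### Kernel integrals of the orthogonal functions and their recurrence -/

namespace DiskData

variable (D : DiskData)

theorem differentiableAt_zeta (n : ℕ) {s : ℂ} (hs : ‖s‖ ≤ 1) :
    DifferentiableAt ℂ (D.zeta n) s := by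
  have := D.den_ne_zero n hs
  unfold zeta
  fun_prop (disch := assumption)

theorem differentiableAt_rho (n : ℕ) {s : ℂ} (hs : ‖s‖ ≤ 1) :
    DifferentiableAt ℂ (D.rho n) s := by
  have := D.den_ne_zero (n + 1) hs
  unfold rho
  fun_prop (disch := assumption)

theorem differentiableAt_phi_phiStar (n : ℕ) {s : ℂ} (hs : ‖s‖ ≤ 1) :
    DifferentiableAt ℂ (D.phi n) s ∧ DifferentiableAt ℂ (D.phiStar n) s := by
  induction n with
  | zero => exact ⟨differentiableAt_const _, differentiableAt_const _⟩
  | succ n ih =>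
    obtain ⟨h1, h2⟩ := ih
    have h3 := D.differentiableAt_zeta n hs
    have h4 := D.differentiableAt_rho n hs
    rw [show D.phi (n + 1) = _ from funext (D.phi_succ n),
      show D.phiStar (n + 1) = _ from funext (D.phiStar_succ n)]
    constructor <;> fun_prop

theorem differentiableAt_phi (n : ℕ) {s : ℂ} (hs : ‖s‖ ≤ 1) : DifferentiableAt ℂ (D.phi n) s :=
  (D.differentiableAt_phi_phiStar n hs).1

theorem differentiableAt_phiStar (n : ℕ) {s : ℂ} (hs : ‖s‖ ≤ 1) :
    DifferentiableAt ℂ (D.phiStar n) s :=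
  (D.differentiableAt_phi_phiStar n hs).2

theorem continuous_phi_comp {T : Type*} [TopologicalSpace T] {σ : T → ℂ} (hσ : Continuous σ)
    (hσ1 : ∀ x, ‖σ x‖ = 1) (n : ℕ) : Continuous fun x => D.phi n (σ x) :=
  continuous_iff_continuousAt.2 fun x =>
    ContinuousAt.comp (f := σ) (D.differentiableAt_phi n (hσ1 x).le).continuousAt hσ.continuousAt

theorem ne_zero_of_ne_a {s : ℂ} (h : ∀ k, s ≠ D.a k) : s ≠ 0 := by
  have := h 0
  rwa [D.a_zero] at this

theorem exists_P_eq (k m : ℕ) (h : k ≤ m) : ∃ p : ℂ[X], p.natDegree ≤ m - k ∧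
    D.P m = D.P k * p := by
  refine ⟨∏ i ∈ Finset.Ico k m, (X - C (D.a i)), ?_, ?_⟩
  · refine (natDegree_prod_le _ _).trans ((Finset.sum_le_card_nsmul _ _ 1 fun _ _ => ?_).trans ?_)
    · simp
    · simp
  · rw [P, P, Finset.prod_range_mul_prod_Ico _ h]

theorem exists_E_eq (k m : ℕ) (h : k ≤ m) : ∃ p : ℂ[X], p.natDegree ≤ m - k ∧
    D.E m = D.E k * p := by
  refine ⟨∏ i ∈ Finset.Ico k m, (1 - C (conj (D.a i)) * X), ?_, ?_⟩
  · refine (natDegree_prod_le _ _).trans ((Finset.sum_le_card_nsmul _ _ 1 fun _ _ => ?_).trans ?_)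
    · exact natDegree_one_sub_le _
    · simp
  · rw [E, E, Finset.prod_range_mul_prod_Ico _ h]

/-- On the circle, `Φ_k` for `k ≤ m` is a polynomial of degree at most `m` over `E_{m+1}`. -/
theorem exists_phi_eq_div_E {k m : ℕ} (h : k ≤ m) : ∃ q : ℂ[X], q.natDegree ≤ m ∧
    ∀ s, ‖s‖ = 1 → q.eval s * (1 / (D.E (m + 1)).eval s) = D.phi k s := by
  obtain ⟨p, _, hp, _, hpq⟩ := D.exists_polynomial k
  obtain ⟨u, hu, hE⟩ := D.exists_E_eq (k + 1) (m + 1) (by omega)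
  refine ⟨p * u, natDegree_mul_le.trans (by omega), fun s hs => ?_⟩
  have h1 := D.E_eval_ne_zero (m + 1) hs.le
  rw [hE, eval_mul] at h1
  have h2 := left_ne_zero_of_mul h1
  have h3 := right_ne_zero_of_mul h1
  rw [(hpq s hs.le).1, hE, eval_mul, eval_mul]
  field_simp

/-- On the circle, `Φ̄_k` for `k ≤ m` is a polynomial of degree at most `m` over
`P_{m+1} / X`. -/
theorem exists_conj_phi_eq_div_P {k m : ℕ} (h : k ≤ m) : ∃ q : ℂ[X], q.natDegree ≤ m ∧
    ∀ s, ‖s‖ = 1 → q.eval s * (s / (D.P (m + 1)).eval s) = conj (D.phi k s) := by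
  obtain ⟨_, q, _, hq, hpq⟩ := D.exists_polynomial k
  obtain ⟨u, hu, hP⟩ := D.exists_P_eq (k + 1) (m + 1) (by omega)
  refine ⟨C (D.H k)⁻¹ * (q * u), (natDegree_C_mul_le _ _).trans
    (natDegree_mul_le.trans (by omega)), fun s hs => ?_⟩
  have h1 := D.P_eval_ne_zero (m + 1) (fun k => D.ne_a_of_norm_one k hs)
  rw [hP, eval_mul] at h1
  have h2 := left_ne_zero_of_mul h1
  have h3 := right_ne_zero_of_mul h1
  have h4 := D.E_eval_ne_zero (k + 1) hs.le
  have h5 := D.H_ne_zero k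
  have h6 := D.mul_B k hs.le
  have h7 := (hpq s hs.le).2
  rw [D.phiStar_eq k hs] at h7
  rw [hP]
  simp only [eval_mul, eval_C]
  have h8 : s * D.B k s * conj (D.phi k s) = s * (eval s q / eval s (D.E (k + 1))) := by
    rw [← h7]; ring
  rw [h6] at h8
  field_simp at h8 ⊢
  linear_combination -h8

theorem ne_of_norm_lt {T : Type*} {σ : T → ℂ} (hσ1 : ∀ x, ‖σ x‖ = 1) {w : ℂ} (hw : ‖w‖ < 1)
    (x : T) : σ x ≠ w := by
  rintro rfl
  exact hw.ne (hσ1 x)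

section Measure

variable {T : Type*} [MeasurableSpace T] (μ : Measure T) (σ : T → ℂ)

/-- `Φ_0, …, Φ_N` are orthonormal with respect to `μ`, as functions of `σ`. -/
def OrthoUpTo (N : ℕ) : Prop :=
  ∀ j ≤ N, ∀ k ≤ N, ∫ x, D.phi j (σ x) * conj (D.phi k (σ x)) ∂μ = if j = k then 1 else 0

/-- `∫ (D(t, w) + 1) Φ_n(t) dμ(t)`. -/
def Q (w : ℂ) (n : ℕ) : ℂ := ∫ x, 2 * σ x * D.phi n (σ x) / (σ x - w) ∂μ

/-- `B_n(w) ∫ (D(t, w) - 1) Φ̄_n(t) dμ(t)`. -/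
def Qstar (w : ℂ) (n : ℕ) : ℂ :=
  D.B n w * ∫ x, 2 * w * conj (D.phi n (σ x)) / (σ x - w) ∂μ

variable {D μ σ}

theorem OrthoUpTo.mono {N M : ℕ} (h : D.OrthoUpTo μ σ N) (hM : M ≤ N) : D.OrthoUpTo μ σ M :=
  fun j hj k hk => h j (hj.trans hM) k (hk.trans hM)

variable [TopologicalSpace T] [CompactSpace T] [BorelSpace T] [IsFiniteMeasure μ]

theorem OrthoUpTo.integral_phi_mul {m : ℕ} (h : D.OrthoUpTo μ σ (m + 1))
    (hσ : Continuous σ) (hσ1 : ∀ x, ‖σ x‖ = 1) {q : ℂ[X]} (hq : q.natDegree ≤ m) :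
    ∫ x, 2 * σ x * D.phi (m + 1) (σ x) * (q.eval (σ x) / (D.P (m + 1)).eval (σ x)) ∂μ = 0 := by
  have hc := D.continuous_phi_comp hσ hσ1
  have h1 := integral_mul_polynomial_eq_zero (μ := μ) (m := m)
    (ψ := fun (k : Fin (m + 1)) x => conj (D.phi k (σ x))) (σ := σ)
    (w := fun x => σ x / (D.P (m + 1)).eval (σ x)) (g := fun x => D.phi (m + 1) (σ x))
    (fun k => Complex.continuous_conj.comp (hc k))
    (fun j k => by
      have := h k (by omega) j (by omega)
      simp only [Complex.conj_conj]
      simp only [mul_comm (conj _)]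
      rw [this]
      simp [Fin.ext_iff, eq_comm])
    (hc _)
    (fun k => by rw [h _ le_rfl _ (by omega)]; simp; omega)
    (fun k => by
      obtain ⟨q, hq, hqs⟩ := D.exists_conj_phi_eq_div_P (k := k) (m := m) (by omega)
      exact ⟨q, hq, fun x => hqs _ (hσ1 x)⟩) hq
  rw [show (fun x => 2 * σ x * D.phi (m + 1) (σ x) *
      (q.eval (σ x) / (D.P (m + 1)).eval (σ x))) = fun x => 2 * (D.phi (m + 1) (σ x) *
      (q.eval (σ x) * (σ x / (D.P (m + 1)).eval (σ x)))) by ext x; ring,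
    integral_const_mul, h1, mul_zero]

theorem OrthoUpTo.integral_conj_phi_mul {m : ℕ} (h : D.OrthoUpTo μ σ (m + 1))
    (hσ : Continuous σ) (hσ1 : ∀ x, ‖σ x‖ = 1) {q : ℂ[X]} (hq : q.natDegree ≤ m) (w : ℂ) :
    ∫ x, 2 * w * conj (D.phi (m + 1) (σ x)) * (q.eval (σ x) / (D.E (m + 1)).eval (σ x)) ∂μ
      = 0 := by
  have hc := D.continuous_phi_comp hσ hσ1
  have h1 := integral_mul_polynomial_eq_zero (μ := μ) (m := m)
    (ψ := fun (k : Fin (m + 1)) x => D.phi k (σ x)) (σ := σ)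
    (w := fun x => 1 / (D.E (m + 1)).eval (σ x)) (g := fun x => conj (D.phi (m + 1) (σ x)))
    (fun k => hc k)
    (fun j k => by
      rw [h _ (by omega) _ (by omega)]
      simp [Fin.ext_iff])
    (Complex.continuous_conj.comp (hc _))
    (fun k => by
      simp only [mul_comm (conj _)]
      rw [h _ (by omega) _ le_rfl]; simp; omega)
    (fun k => by
      obtain ⟨q, hq, hqs⟩ := D.exists_phi_eq_div_E (k := k) (m := m) (by omega)
      exact ⟨q, hq, fun x => hqs _ (hσ1 x)⟩) hq
  rw [show (fun x => 2 * w * conj (D.phi (m + 1) (σ x)) *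
      (q.eval (σ x) / (D.E (m + 1)).eval (σ x))) = fun x => 2 * w * (conj (D.phi (m + 1) (σ x)) *
      (q.eval (σ x) * (1 / (D.E (m + 1)).eval (σ x)))) by ext x; ring,
    integral_const_mul, h1, mul_zero]

/-- Orthogonality lets a rational factor with denominator `P_n` be taken out of the integral at its
value at `w`. For `n = 0` the factor is a constant and orthogonality plays no role. -/
theorem OrthoUpTo.Q_mul {n : ℕ} (h : D.OrthoUpTo μ σ n) (hσ : Continuous σ)
    (hσ1 : ∀ x, ‖σ x‖ = 1) {w : ℂ} (hw : ‖w‖ < 1) (hwa : ∀ k, w ≠ D.a k)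
    {N : ℂ[X]} (hN : N.natDegree ≤ n) :
    ∫ x, 2 * σ x * D.phi n (σ x) / (σ x - w) * (N.eval (σ x) / (D.P n).eval (σ x)) ∂μ =
      N.eval w / (D.P n).eval w * D.Q μ σ w n := by
  cases n with
  | zero =>
    rw [eq_C_of_natDegree_le_zero hN]
    simp only [eval_C, P, Finset.range_zero, Finset.prod_empty, eval_one, div_one, Q]
    rw [integral_mul_const, mul_comm]
  | succ m =>
    have hc := D.continuous_phi_comp hσ hσ1
    exact integral_kernel_mul hσ (by have := hc (m + 1); fun_prop) hN (D.P_natDegree _)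
      (fun x => D.P_eval_ne_zero _ fun k => D.ne_a_of_norm_one k (hσ1 x))
      (D.P_eval_ne_zero _ hwa) (ne_of_norm_lt hσ1 hw)
      fun q hq => h.integral_phi_mul hσ hσ1 hq

theorem OrthoUpTo.Qstar_mul {n : ℕ} (h : D.OrthoUpTo μ σ n) (hσ : Continuous σ)
    (hσ1 : ∀ x, ‖σ x‖ = 1) {w : ℂ} (hw : ‖w‖ < 1)
    {N : ℂ[X]} (hN : N.natDegree ≤ n) :
    ∫ x, 2 * w * conj (D.phi n (σ x)) / (σ x - w) * (N.eval (σ x) / (D.E n).eval (σ x)) ∂μ =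
      N.eval w / (D.E n).eval w * ∫ x, 2 * w * conj (D.phi n (σ x)) / (σ x - w) ∂μ := by
  cases n with
  | zero =>
    rw [eq_C_of_natDegree_le_zero hN]
    simp only [eval_C, E, Finset.range_zero, Finset.prod_empty, eval_one, div_one]
    rw [integral_mul_const, mul_comm]
  | succ m =>
    have hc := D.continuous_phi_comp hσ hσ1
    exact integral_kernel_mul hσ (by have := hc (m + 1); fun_prop) hN (D.E_natDegree _)
      (fun x => D.E_eval_ne_zero _ (hσ1 x).le)
      (D.E_eval_ne_zero _ hw.le) (ne_of_norm_lt hσ1 hw)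
      fun q hq => h.integral_conj_phi_mul hσ hσ1 hq w

/-- The integrand of `Q_{n+1}` is multiplied by `N / P_{n+1}`, where `N` cancels the denominator of
`ρ_n`. Since `Φ*_n = B_n Φ̄_n` on the circle, the result is the integrand of `Q_n` times `E_n / P_n`
plus a constant multiple of the integrand of `Q*_n`. Both rational factors can be replaced by their
values at `w`, and what remains is the recurrence at `w`. -/
theorem OrthoUpTo.Q_succ {n : ℕ} (h : D.OrthoUpTo μ σ (n + 1)) (hσ : Continuous σ)
    (hσ1 : ∀ x, ‖σ x‖ = 1) {w : ℂ} (hw : ‖w‖ < 1) (hwa : ∀ k, w ≠ D.a k) :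
    D.Q μ σ w (n + 1) =
      D.rho n w * (D.c n * D.zeta n w * D.Q μ σ w n + conj (D.Λ n) * D.Qstar μ σ w n) := by
  have hc := D.continuous_phi_comp hσ hσ1
  have hne := ne_of_norm_lt hσ1 hw
  have hσw : ∀ x, σ x - w ≠ 0 := fun x => sub_ne_zero.2 (hne x)
  let N : ℂ[X] := D.E n * (1 - C (conj (D.a (n + 1))) * X)
  have hN : N.natDegree ≤ n + 1 := natDegree_mul_le.trans
    (add_le_add (D.E_natDegree n) (natDegree_one_sub_le _))
  have h1 := h.Q_mul hσ hσ1 hw hwa hN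
  have h2 := (h.mono n.le_succ).Q_mul hσ hσ1 hw hwa (D.E_natDegree n)
  have key : ∀ x, 2 * σ x * D.phi (n + 1) (σ x) / (σ x - w) *
      (N.eval (σ x) / (D.P (n + 1)).eval (σ x)) =
      D.r n * D.c n * D.η n * (2 * σ x * D.phi n (σ x) / (σ x - w) *
        ((D.E n).eval (σ x) / (D.P n).eval (σ x))) +
      D.r n * conj (D.Λ n) * D.H n / w * (2 * w * conj (D.phi n (σ x)) / (σ x - w)) := by
    intro x
    have hs := hσ1 x
    have e1 := D.mul_B n hs.le
    have e2 := D.phiStar_eq n hs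
    have hs0 : σ x ≠ 0 := by intro h0; simp [h0] at hs
    have hw0 := D.ne_zero_of_ne_a hwa
    have n1 := D.den_ne_zero n hs.le
    have n2 := D.den_ne_zero (n + 1) hs.le
    have n3 := D.P_eval_ne_zero n (fun k => D.ne_a_of_norm_one k hs)
    have n4 := D.E_eval_ne_zero n hs.le
    have n5 := sub_ne_zero.2 (D.ne_a_of_norm_one n hs)
    have n6 := hσw x
    rw [P_eval_succ, E_eval_succ] at e1
    have e3 : σ x * D.phiStar n (σ x) = D.H n * ((D.P n).eval (σ x) * (σ x - D.a n) /
        ((D.E n).eval (σ x) * (1 - conj (D.a n) * σ x))) * conj (D.phi n (σ x)) := by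
      rw [e2, ← e1]; ring
    rw [phi_succ, P_eval_succ, rho, zeta]
    simp only [N, eval_mul, eval_sub, eval_one, eval_C, eval_X]
    generalize 1 - conj (D.a n) * σ x = u at *
    generalize 1 - conj (D.a (n + 1)) * σ x = v at *
    field_simp at e3 ⊢
    linear_combination D.r n * conj (D.Λ n) * e3
  have c1 : Continuous fun x => 2 * σ x * D.phi n (σ x) / (σ x - w) *
        ((D.E n).eval (σ x) / (D.P n).eval (σ x)) :=
    (((continuous_const.mul hσ).mul (hc n)).div (hσ.sub continuous_const) hσw).mul
      (((D.E n).continuous.comp hσ).div ((D.P n).continuous.comp hσ)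
        fun x => D.P_eval_ne_zero n (fun k => D.ne_a_of_norm_one k (hσ1 x)))
  have c2 : Continuous fun x => 2 * w * conj (D.phi n (σ x)) / (σ x - w) :=
    (continuous_const.mul (Complex.continuous_conj.comp (hc n))).div
      (hσ.sub continuous_const) hσw
  simp_rw [key] at h1
  rw [integral_add ((integrable_of_continuous c1).const_mul _)
    ((integrable_of_continuous c2).const_mul _), integral_const_mul, integral_const_mul, h2] at h1
  have hw0 := D.ne_zero_of_ne_a hwa
  have n1 := D.den_ne_zero n hw.le
  have n2 := D.den_ne_zero (n + 1) hw.le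
  have n3 := D.P_eval_ne_zero n hwa
  have n4 := D.E_eval_ne_zero n hw.le
  have n5 := sub_ne_zero.2 (hwa n)
  have e1 := D.mul_B n hw.le
  rw [P_eval_succ] at h1
  rw [P_eval_succ, E_eval_succ] at e1
  rw [Qstar, zeta, rho]
  simp only [N, eval_mul, eval_sub, eval_one, eval_C, eval_X] at h1
  have e3 : D.B n w = D.H n * ((D.P n).eval w * (w - D.a n) /
        ((D.E n).eval w * (1 - conj (D.a n) * w))) / w := by
    rw [← e1]; field_simp
  rw [e3]
  generalize (∫ x, 2 * w * conj (D.phi n (σ x)) / (σ x - w) ∂μ) = I at *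
  generalize 1 - conj (D.a n) * w = u at *
  generalize 1 - conj (D.a (n + 1)) * w = v at *
  field_simp at h1 ⊢
  linear_combination -h1

theorem OrthoUpTo.Qstar_succ {n : ℕ} (h : D.OrthoUpTo μ σ (n + 1)) (hσ : Continuous σ)
    (hσ1 : ∀ x, ‖σ x‖ = 1) {w : ℂ} (hw : ‖w‖ < 1) (hwa : ∀ k, w ≠ D.a k) :
    D.Qstar μ σ w (n + 1) =
      D.rho n w * (D.Λ n * (D.c n * D.zeta n w * D.Q μ σ w n) + D.Qstar μ σ w n) := by
  have hc := D.continuous_phi_comp hσ hσ1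
  have hne := ne_of_norm_lt hσ1 hw
  have hσw : ∀ x, σ x - w ≠ 0 := fun x => sub_ne_zero.2 (hne x)
  -- The mirror choice: with denominator `E_{n+1}` it turns the `Φ_n` part into a constant multiple
  -- of the integrand of `Q_n`, and leaves `P_n / E_n` on the `Φ̄_n` part.
  let N : ℂ[X] := D.P n * (X - C (D.a (n + 1)))
  have hN : N.natDegree ≤ n + 1 := natDegree_mul_le.trans
    (add_le_add (D.P_natDegree n) (by simp))
  have h1 := h.Qstar_mul hσ hσ1 hw hN
  have h2 := (h.mono n.le_succ).Qstar_mul hσ hσ1 hw (D.P_natDegree n)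
  have key : ∀ x, 2 * w * conj (D.phi (n + 1) (σ x)) / (σ x - w) *
      (N.eval (σ x) / (D.E (n + 1)).eval (σ x)) =
      D.r n * D.Λ n * D.c n * D.η n * w / D.H (n + 1) *
        (2 * σ x * D.phi n (σ x) / (σ x - w)) +
      D.r n * D.H n / D.H (n + 1) * (2 * w * conj (D.phi n (σ x)) / (σ x - w) *
        ((D.P n).eval (σ x) / (D.E n).eval (σ x))) := by
    intro x
    have hs := hσ1 x
    have e1 := D.mul_B n hs.le
    have e1' := D.mul_B (n + 1) hs.le
    have e2 := D.phiStar_eq n hs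
    have e2' := D.phiStar_eq (n + 1) hs
    have hs0 : σ x ≠ 0 := by intro h0; simp [h0] at hs
    have n1 := D.den_ne_zero n hs.le
    have n2 := D.den_ne_zero (n + 1) hs.le
    have n3 := D.P_eval_ne_zero n (fun k => D.ne_a_of_norm_one k hs)
    have n4 := D.E_eval_ne_zero n hs.le
    have n5 := sub_ne_zero.2 (D.ne_a_of_norm_one n hs)
    have n5' := sub_ne_zero.2 (D.ne_a_of_norm_one (n + 1) hs)
    have n6 := hσw x
    have n7 := D.H_ne_zero (n + 1)
    rw [P_eval_succ, E_eval_succ] at e1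
    rw [P_eval_succ, E_eval_succ, P_eval_succ, E_eval_succ] at e1'
    have e3 : σ x * D.phiStar n (σ x) = D.H n * ((D.P n).eval (σ x) * (σ x - D.a n) /
        ((D.E n).eval (σ x) * (1 - conj (D.a n) * σ x))) * conj (D.phi n (σ x)) := by
      rw [e2, ← e1]; ring
    have e3' : σ x * D.phiStar (n + 1) (σ x) = D.H (n + 1) * ((D.P n).eval (σ x) *
        (σ x - D.a n) * (σ x - D.a (n + 1)) / ((D.E n).eval (σ x) *
        (1 - conj (D.a n) * σ x) * (1 - conj (D.a (n + 1)) * σ x))) *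
        conj (D.phi (n + 1) (σ x)) := by
      rw [e2', ← e1']; ring
    rw [phiStar_succ, rho, zeta] at e3'
    rw [E_eval_succ]
    simp only [N, eval_mul, eval_sub, eval_C, eval_X]
    generalize 1 - conj (D.a n) * σ x = u at *
    generalize 1 - conj (D.a (n + 1)) * σ x = v at *
    have e4 : D.H (n + 1) * ((D.P n).eval (σ x) * (σ x - D.a (n + 1))) *
        conj (D.phi (n + 1) (σ x)) = (D.r n * D.Λ n * D.c n * D.η n * σ x * D.phi n (σ x) +
        D.r n * D.H n * ((D.P n).eval (σ x) / (D.E n).eval (σ x)) * conj (D.phi n (σ x))) *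
        ((D.E n).eval (σ x) * u) := by
      field_simp at e3 e3' ⊢
      apply mul_right_cancel₀ n5
      linear_combination -e3' + D.r n * u * e3
    field_simp at e4 ⊢
    linear_combination w * e4
  have c1 : Continuous fun x => 2 * w * conj (D.phi n (σ x)) / (σ x - w) *
        ((D.P n).eval (σ x) / (D.E n).eval (σ x)) :=
    ((continuous_const.mul (Complex.continuous_conj.comp (hc n))).div
      (hσ.sub continuous_const) hσw).mul
      (((D.P n).continuous.comp hσ).div ((D.E n).continuous.comp hσ)
        fun x => D.E_eval_ne_zero n (hσ1 x).le)
  have c2 : Continuous fun x => 2 * σ x * D.phi n (σ x) / (σ x - w) :=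
    ((continuous_const.mul hσ).mul (hc n)).div (hσ.sub continuous_const) hσw
  simp_rw [key] at h1
  rw [integral_add ((integrable_of_continuous c2).const_mul _)
    ((integrable_of_continuous c1).const_mul _), integral_const_mul, integral_const_mul, h2] at h1
  have hw0 := D.ne_zero_of_ne_a hwa
  have n1 := D.den_ne_zero n hw.le
  have n2 := D.den_ne_zero (n + 1) hw.le
  have n3 := D.P_eval_ne_zero n hwa
  have n4 := D.E_eval_ne_zero n hw.le
  have n5 := sub_ne_zero.2 (hwa n)
  have n7 := D.H_ne_zero (n + 1)
  have e1 := D.mul_B n hw.le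
  have e1' := D.mul_B (n + 1) hw.le
  rw [E_eval_succ] at h1
  rw [P_eval_succ, E_eval_succ] at e1
  rw [P_eval_succ, E_eval_succ, P_eval_succ, E_eval_succ] at e1'
  rw [Qstar, Qstar, zeta, rho]
  simp only [N, eval_mul, eval_sub, eval_C, eval_X] at h1
  have e3 : D.B n w = D.H n * ((D.P n).eval w * (w - D.a n) /
        ((D.E n).eval w * (1 - conj (D.a n) * w))) / w := by
    rw [← e1]; field_simp
  have e3' : D.B (n + 1) w = D.H (n + 1) * ((D.P n).eval w * (w - D.a n) * (w - D.a (n + 1)) /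
        ((D.E n).eval w * (1 - conj (D.a n) * w) * (1 - conj (D.a (n + 1)) * w))) / w := by
    rw [← e1']; field_simp
  rw [e3, e3']
  change D.r n * D.Λ n * D.c n * D.η n * w / D.H (n + 1) * D.Q μ σ w n + _ = _ at h1
  generalize (∫ x, 2 * w * conj (D.phi n (σ x)) / (σ x - w) ∂μ) = I at *
  generalize (∫ x, 2 * w * conj (D.phi (n + 1) (σ x)) / (σ x - w) ∂μ) = J at *
  generalize 1 - conj (D.a n) * w = u at *
  generalize 1 - conj (D.a (n + 1)) * w = v at *
  field_simp at h1 ⊢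
  linear_combination -h1

end Measure

end DiskData

/-! ### Wall functions and the Schur functions of the solutions -/

/-- The Wall recurrence for the values `ζ_n` at a point. -/
def wallSeq (ζ γ : ℕ → ℂ) : ℕ → WallValues
  | 0 => ⟨γ 0, 1, star (γ 0), 1⟩
  | n + 1 =>
    let w := wallSeq ζ γ n
    ⟨w.R + γ (n + 1) * ζ (n + 1) * w.Sstar,
     w.S + γ (n + 1) * ζ (n + 1) * w.Rstar,
     ζ (n + 1) * w.Rstar + star (γ (n + 1)) * w.S,
     ζ (n + 1) * w.Sstar + star (γ (n + 1)) * w.R⟩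

theorem wall_eq_wallSeq (O : Domain) (α γ : ℕ → ℂ) (n : ℕ) (t : OnePoint ℂ) :
    wall O α γ n t = wallSeq (fun k => zeta O (α k) t) γ n := by
  induction n with
  | zero => rfl
  | succ n ih => simp only [wall, wallSeq, ih]

/-- The matrix of the recurrence scales the indefinite form `|x|² - |y|²` by its determinant. This
gives the balance for `|Q_n|² - |Q*_n|²` and also the inequality `|R*_n| < |S_n|`. -/
theorem norm_sq_add_conj_mul_sub (l x y : ℂ) :
    ‖x + conj l * y‖ ^ 2 - ‖l * x + y‖ ^ 2 = (1 - ‖l‖ ^ 2) * (‖x‖ ^ 2 - ‖y‖ ^ 2) := by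
  simp only [← Complex.normSq_eq_norm_sq, Complex.normSq_apply]
  simp
  ring

namespace DiskData

variable {D : DiskData}

/-- The Wall values at the point `s` of the disk. -/
def wall (D : DiskData) (n : ℕ) (s : ℂ) : WallValues := wallSeq (fun k => D.zeta k s) D.γ n

/-- The weights `|1 - ā_n w|² / (1 - |a_n|²)` absorb the factor `|ρ_n|²(1 - |Λ_n|²)` of each step,
so that the weighted form telescopes. -/
theorem norm_rho_sq (n : ℕ) {w : ℂ} (hw : ‖w‖ ≤ 1) :
    ‖1 - conj (D.a (n + 1)) * w‖ ^ 2 / (1 - ‖D.a (n + 1)‖ ^ 2) *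
      (‖D.rho n w‖ ^ 2 * (1 - ‖D.Λ n‖ ^ 2)) =
    ‖1 - conj (D.a n) * w‖ ^ 2 / (1 - ‖D.a n‖ ^ 2) := by
  have h1 := (D.one_sub_norm_a_sq_pos n).ne'
  have h2 := (D.one_sub_norm_a_sq_pos (n + 1)).ne'
  have h3 := norm_ne_zero_iff.2 (D.den_ne_zero (n + 1) hw)
  have h4 := D.norm_r n
  rw [rho, norm_mul, norm_div, D.norm_Λ]
  generalize ‖1 - conj (D.a n) * w‖ = u at *
  generalize ‖1 - conj (D.a (n + 1)) * w‖ = v at *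
  field_simp
  linear_combination u ^ 2 * h4

section Measure

variable {T : Type*} [MeasurableSpace T] {μ : Measure T} {σ : T → ℂ}
variable [TopologicalSpace T] [CompactSpace T] [BorelSpace T] [IsProbabilityMeasure μ]

/-- Here `2s / (s - w)` is `D(s, w) + 1`, and the identity is `Re D = (1 - |w|²) / |s - w|²`, the
Poisson kernel. It converts a real part, linear in the kernel, into the square needed for Bessel's
inequality. -/
theorem kernel_re_identity {s w : ℂ} (hs : ‖s‖ = 1) (hsw : s ≠ w) :
    4 * (2 * s / (s - w)).re - 4 = (1 - ‖w‖ ^ 2) * ‖2 * s / (s - w)‖ ^ 2 := by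
  have h0 : s - w ≠ 0 := sub_ne_zero.2 hsw
  have h1 : ‖s - w‖ ^ 2 ≠ 0 := pow_ne_zero _ (norm_ne_zero_iff.2 h0)
  have hs2 : s.re * s.re + s.im * s.im = 1 := by
    rw [← Complex.normSq_apply, Complex.normSq_eq_norm_sq, hs]; norm_num
  have h2 : (2 * s / (s - w)).re = (2 * s * conj (s - w)).re / ‖s - w‖ ^ 2 := by
    rw [div_eq_mul_inv, Complex.inv_def, ← mul_assoc, Complex.normSq_eq_norm_sq,
      Complex.re_mul_ofReal, div_eq_mul_inv]
  rw [h2, norm_div, div_pow, norm_mul, hs]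
  have h3 : ‖s - w‖ ^ 2 = 1 + ‖w‖ ^ 2 - 2 * (s.re * w.re + s.im * w.im) := by
    simp only [← Complex.normSq_eq_norm_sq, Complex.normSq_apply]
    simp only [Complex.sub_re, Complex.sub_im]
    linear_combination hs2
  have h4 : (2 * s * conj (s - w)).re = 2 * (1 - (s.re * w.re + s.im * w.im)) := by
    simp
    linear_combination 2 * hs2
  rw [h4]
  field_simp
  rw [h3]
  norm_num
  ring

theorem Q_zero_sub (hσ : Continuous σ) (hσ1 : ∀ x, ‖σ x‖ = 1) {w : ℂ} (hw : ‖w‖ < 1) :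
    D.Q μ σ w 0 - D.Qstar μ σ w 0 = 2 := by
  have hσw : ∀ x, σ x - w ≠ 0 := fun x => sub_ne_zero.2 (ne_of_norm_lt hσ1 hw x)
  simp only [Q, Qstar, phi_zero, B_zero, mul_one, map_one, one_mul]
  rw [← integral_sub (integrable_of_continuous (by fun_prop (disch := exact hσw)))
    (integrable_of_continuous (by fun_prop (disch := exact hσw)))]
  have : ∀ x, 2 * σ x / (σ x - w) - 2 * w / (σ x - w) = 2 := fun x => by
    have := hσw x
    field_simp
  simp [this]

theorem Q_zero_norm_sq (hσ : Continuous σ) (hσ1 : ∀ x, ‖σ x‖ = 1) {w : ℂ} (hw : ‖w‖ < 1) :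
    ‖D.Q μ σ w 0‖ ^ 2 - ‖D.Qstar μ σ w 0‖ ^ 2 =
      (1 - ‖w‖ ^ 2) * ∫ x, ‖2 * σ x / (σ x - w)‖ ^ 2 ∂μ := by
  have hσw : ∀ x, σ x - w ≠ 0 := fun x => sub_ne_zero.2 (ne_of_norm_lt hσ1 hw x)
  have h0 := D.Q_zero_sub (μ := μ) hσ hσ1 hw
  have h1 : D.Qstar μ σ w 0 = D.Q μ σ w 0 - 2 := by linear_combination -h0
  have h2 : ‖D.Q μ σ w 0‖ ^ 2 - ‖D.Qstar μ σ w 0‖ ^ 2 = 4 * (D.Q μ σ w 0).re - 4 := by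
    rw [h1]
    simp only [← Complex.normSq_eq_norm_sq, Complex.normSq_apply]
    simp
    ring
  have hc : Continuous fun x => 2 * σ x / (σ x - w) := by fun_prop (disch := exact hσw)
  have hi : Integrable (fun x => 2 * σ x / (σ x - w)) μ := integrable_of_continuous hc
  have h3 : (D.Q μ σ w 0).re = ∫ x, (2 * σ x / (σ x - w)).re ∂μ := by
    simp only [Q, phi_zero, mul_one]
    exact (integral_re hi).symm
  rw [h2, h3, ← integral_const_mul, ← integral_const_mul]
  have h4 : ∫ x, (4 * (2 * σ x / (σ x - w)).re - 4) ∂μ =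
      (∫ x, 4 * (2 * σ x / (σ x - w)).re ∂μ) - 4 := by
    have hre : Integrable (fun x => (2 * σ x / (σ x - w)).re) μ := hi.re
    rw [integral_sub (hre.const_mul 4) (integrable_const _)]
    simp
  rw [← h4]
  exact integral_congr_ae (ae_of_all _ fun x => kernel_re_identity (hσ1 x)
    (ne_of_norm_lt hσ1 hw x))

/-- After weighting, the matrix step preserves the form; the only loss comes from `ζ_n` multiplying
`Q_n`, and it equals `(1 - |w|²)|Q_n|²` at each index. -/
theorem OrthoUpTo.Q_norm_sq {N : ℕ} (h : D.OrthoUpTo μ σ N) (hσ : Continuous σ)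
    (hσ1 : ∀ x, ‖σ x‖ = 1) {w : ℂ} (hw : ‖w‖ < 1) (hwa : ∀ k, w ≠ D.a k) {n : ℕ} (hn : n ≤ N) :
    ‖1 - conj (D.a n) * w‖ ^ 2 / (1 - ‖D.a n‖ ^ 2) *
      (‖D.Q μ σ w n‖ ^ 2 - ‖D.Qstar μ σ w n‖ ^ 2) =
    ‖D.Q μ σ w 0‖ ^ 2 - ‖D.Qstar μ σ w 0‖ ^ 2 -
      (1 - ‖w‖ ^ 2) * ∑ k ∈ Finset.range n, ‖D.Q μ σ w k‖ ^ 2 := by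
  induction n with
  | zero => simp [D.a_zero]
  | succ n ih =>
    specialize ih (by omega)
    rw [(h.mono hn).Q_succ hσ hσ1 hw hwa, (h.mono hn).Qstar_succ hσ hσ1 hw hwa, norm_mul, norm_mul,
      mul_pow, mul_pow, ← mul_sub, norm_sq_add_conj_mul_sub, ← mul_assoc (‖D.rho n w‖ ^ 2),
      ← mul_assoc, D.norm_rho_sq n hw.le, norm_mul, norm_mul, norm_c, Finset.sum_range_succ]
    have h1 := D.norm_zeta_sq n hw.le
    have h2 := (D.one_sub_norm_a_sq_pos n).ne'
    have h3 : ‖1 - conj (D.a n) * w‖ ^ 2 / (1 - ‖D.a n‖ ^ 2) * (1 - ‖D.zeta n w‖ ^ 2) =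
        1 - ‖w‖ ^ 2 := by
      field_simp
      linarith
    linear_combination ih - ‖D.Q μ σ w n‖ ^ 2 * h3

/-- The `Q_k` are the Fourier coefficients of `2σ / (σ - w)` with respect to the orthonormal system
`Φ̄_k`. The balance of `Q_norm_sq` is then `1 - |w|²` times a Bessel defect, which is nonnegative.
-/
theorem OrthoUpTo.norm_Qstar_le {N : ℕ} (h : D.OrthoUpTo μ σ N) (hσ : Continuous σ)
    (hσ1 : ∀ x, ‖σ x‖ = 1) {w : ℂ} (hw : ‖w‖ < 1) (hwa : ∀ k, w ≠ D.a k) {n : ℕ} (hn : n ≤ N) :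
    ‖D.Qstar μ σ w n‖ ≤ ‖D.Q μ σ w n‖ := by
  have hσw : ∀ x, σ x - w ≠ 0 := fun x => sub_ne_zero.2 (ne_of_norm_lt hσ1 hw x)
  have h1 := h.Q_norm_sq hσ hσ1 hw hwa hn
  rw [Q_zero_norm_sq hσ hσ1 hw, ← mul_sub] at h1
  have hb := bessel_of_continuous (μ := μ) (m := n) (ψ := fun k x => D.phi k (σ x))
    (fun k => D.continuous_phi_comp hσ hσ1 k)
    (fun j k => by rw [h _ (by omega) _ (by omega)]; simp [Fin.ext_iff])
    (g := fun x => 2 * σ x / (σ x - w)) (by fun_prop (disch := exact hσw))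
  rw [Fin.sum_univ_eq_sum_range
    (fun k => ‖∫ x, 2 * σ x / (σ x - w) * D.phi k (σ x) ∂μ‖ ^ 2)] at hb
  have hb' : ∑ k ∈ Finset.range n, ‖D.Q μ σ w k‖ ^ 2 ≤ ∫ x, ‖2 * σ x / (σ x - w)‖ ^ 2 ∂μ := by
    refine le_trans (le_of_eq ?_) hb
    refine Finset.sum_congr rfl fun k _ => ?_
    simp only [Q, div_mul_eq_mul_div]
  have h2 : 0 < ‖1 - conj (D.a n) * w‖ ^ 2 / (1 - ‖D.a n‖ ^ 2) :=
    div_pos (pow_pos (norm_pos_iff.2 (D.den_ne_zero n hw.le)) 2) (D.one_sub_norm_a_sq_pos n)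
  have h3 : 0 ≤ (1 - ‖w‖ ^ 2) * ((∫ x, ‖2 * σ x / (σ x - w)‖ ^ 2 ∂μ) -
      ∑ k ∈ Finset.range n, ‖D.Q μ σ w k‖ ^ 2) :=
    mul_nonneg (by nlinarith [norm_nonneg w]) (by linarith)
  rw [← h1] at h3
  have h4 := nonneg_of_mul_nonneg_right h3 h2
  exact (sq_le_sq₀ (norm_nonneg _) (norm_nonneg _)).1 (by linarith)

/-- One step of the Wall recurrence is, up to a nonzero scalar, the inverse of one step of the
recurrence for `(Q_n, z_n Q*_n)`. The product collapses to the initial pair, and `ξ` collects the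
scalars. -/
theorem OrthoUpTo.exists_wall_relation {N : ℕ} (h : D.OrthoUpTo μ σ N) (hσ : Continuous σ)
    (hσ1 : ∀ x, ‖σ x‖ = 1) {w : ℂ} (hw : ‖w‖ < 1) (hwa : ∀ k, w ≠ D.a k) {n : ℕ}
    (hn : n + 1 ≤ N) : ∃ ξ : ℂ, ξ ≠ 0 ∧
      (D.wall n w).R * D.Q μ σ w (n + 1) +
        (D.wall n w).Sstar * (D.z (n + 1) * D.Qstar μ σ w (n + 1)) = ξ * D.Qstar μ σ w 0 ∧
      (D.wall n w).S * D.Q μ σ w (n + 1) +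
        (D.wall n w).Rstar * (D.z (n + 1) * D.Qstar μ σ w (n + 1)) =
          ξ * (w * D.Q μ σ w 0) := by
  have hγ : ∀ k, (1 : ℂ) - D.γ k * conj (D.γ k) ≠ 0 := fun k => by
    rw [Complex.mul_conj']
    exact_mod_cast (D.one_sub_norm_γ_sq_pos k).ne'
  have hzz : ∀ k, D.z k * conj (D.z k) = 1 := fun k => norm_one_mul_conj (D.norm_z k)
  have q1 : ∀ k, k + 1 ≤ N → D.Q μ σ w (k + 1) = D.rho k w * D.c k *
      (D.zeta k w * D.Q μ σ w k - conj (D.γ k) * (D.z k * D.Qstar μ σ w k)) := fun k hk => by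
    rw [(h.mono hk).Q_succ hσ hσ1 hw hwa]
    simp only [c, Λ, map_neg, map_mul, Complex.conj_conj]
    linear_combination D.rho k w * D.z (k + 1) * conj (D.γ k) * D.Qstar μ σ w k * hzz k
  have q2 : ∀ k, k + 1 ≤ N → D.z (k + 1) * D.Qstar μ σ w (k + 1) = D.rho k w * D.c k *
      (-D.γ k * (D.zeta k w * D.Q μ σ w k) + D.z k * D.Qstar μ σ w k) := fun k hk => by
    rw [(h.mono hk).Qstar_succ hσ hσ1 hw hwa]
    simp only [c, Λ]
    linear_combination -D.z (k + 1) * D.rho k w * D.Qstar μ σ w k * hzz k -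
      D.rho k w * D.z (k + 1) * conj (D.z k) * D.γ k * D.zeta k w * D.Q μ σ w k * hzz (k + 1)
  induction n with
  | zero =>
    refine ⟨D.rho 0 w * D.c 0 * (1 - D.γ 0 * conj (D.γ 0)),
      mul_ne_zero (mul_ne_zero (D.rho_ne_zero 0 hw.le) (D.c_ne_zero 0)) (hγ 0), ?_, ?_⟩
    all_goals
      rw [q2 0 hn, q1 0 hn, D.z_zero, D.zeta_zero]
      simp only [wall, wallSeq, Complex.star_def]
      ring
  | succ n ih =>
    obtain ⟨ξ, hξ, h1, h2⟩ := ih (by omega)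
    refine ⟨D.rho (n + 1) w * D.c (n + 1) * D.zeta (n + 1) w *
      (1 - D.γ (n + 1) * conj (D.γ (n + 1))) * ξ, ?_, ?_, ?_⟩
    · exact mul_ne_zero (mul_ne_zero (mul_ne_zero (mul_ne_zero (D.rho_ne_zero _ hw.le)
        (D.c_ne_zero _)) (D.zeta_ne_zero_of_ne _ hw.le (hwa _))) (hγ _)) hξ
    all_goals
      rw [q2 _ hn, q1 _ hn]
      simp only [wall, wallSeq, Complex.star_def] at h1 h2 ⊢
    · linear_combination D.rho (n + 1) w * D.c (n + 1) * D.zeta (n + 1) w *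
        (1 - D.γ (n + 1) * conj (D.γ (n + 1))) * h1
    · linear_combination D.rho (n + 1) w * D.c (n + 1) * D.zeta (n + 1) w *
        (1 - D.γ (n + 1) * conj (D.γ (n + 1))) * h2

/-- The value at `w` of the Schur function of `μ`. -/
def schur (μ : Measure T) (σ : T → ℂ) (w : ℂ) : ℂ :=
  1 / w * (((∫ x, (σ x + w) / (σ x - w) ∂μ) - 1) / ((∫ x, (σ x + w) / (σ x - w) ∂μ) + 1))

theorem integral_kernel_add_one (hσ : Continuous σ) (hσ1 : ∀ x, ‖σ x‖ = 1) {w : ℂ}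
    (hw : ‖w‖ < 1) : (∫ x, (σ x + w) / (σ x - w) ∂μ) + 1 = D.Q μ σ w 0 := by
  have hσw : ∀ x, σ x - w ≠ 0 := fun x => sub_ne_zero.2 (ne_of_norm_lt hσ1 hw x)
  have h1 : (∫ x, (σ x + w) / (σ x - w) ∂μ) + 1 = ∫ x, ((σ x + w) / (σ x - w) + 1) ∂μ := by
    rw [integral_add (integrable_of_continuous (by fun_prop (disch := exact hσw)))
      (integrable_const _)]
    simp
  rw [h1, Q]
  refine integral_congr_ae (ae_of_all _ fun x => ?_)
  have := hσw x
  simp only [phi_zero]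
  field_simp
  ring

theorem OrthoUpTo.Q_zero_ne_zero {N : ℕ} (h : D.OrthoUpTo μ σ N) (hσ : Continuous σ)
    (hσ1 : ∀ x, ‖σ x‖ = 1) {w : ℂ} (hw : ‖w‖ < 1) (hwa : ∀ k, w ≠ D.a k) :
    D.Q μ σ w 0 ≠ 0 := by
  intro h0
  have h1 := h.norm_Qstar_le hσ hσ1 hw hwa N.zero_le
  have h2 := D.Q_zero_sub (μ := μ) hσ hσ1 hw
  rw [h0, norm_zero] at h1
  rw [h0, norm_le_zero_iff.1 h1] at h2
  norm_num at h2

/-- The Schur function at `w` is `Q*_0 / (w Q_0)`, so eliminating `ξ` between the two Wall relations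
gives the Möbius formula. -/
theorem OrthoUpTo.schur_eq {N : ℕ} (h : D.OrthoUpTo μ σ N) (hσ : Continuous σ)
    (hσ1 : ∀ x, ‖σ x‖ = 1) {w : ℂ} (hw : ‖w‖ < 1) (hwa : ∀ k, w ≠ D.a k) {n : ℕ}
    (hn : n + 1 ≤ N) :
    D.Q μ σ w (n + 1) ≠ 0 ∧ ∃ v : ℂ,
      v = D.z (n + 1) * (D.Qstar μ σ w (n + 1) / D.Q μ σ w (n + 1)) ∧ ‖v‖ ≤ 1 ∧
      schur μ σ w * ((D.wall n w).S + (D.wall n w).Rstar * v) =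
        (D.wall n w).R + (D.wall n w).Sstar * v := by
  obtain ⟨ξ, hξ, h1, h2⟩ := h.exists_wall_relation hσ hσ1 hw hwa hn
  have hle := h.norm_Qstar_le hσ hσ1 hw hwa hn
  have hw0 := D.ne_zero_of_ne_a hwa
  have hQ0 := h.Q_zero_ne_zero hσ hσ1 hw hwa
  -- If `Q_{n+1}` vanished, so would `Q*_{n+1}`, and the second Wall relation would read `0 = ξ w
  -- Q_0`.
  have hQ : D.Q μ σ w (n + 1) ≠ 0 := by
    intro h0
    rw [h0, norm_zero] at hle
    rw [h0, norm_le_zero_iff.1 hle] at h2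
    simp [hξ, hw0, hQ0] at h2
  refine ⟨hQ, _, rfl, ?_, ?_⟩
  · rw [norm_mul, D.norm_z, one_mul, norm_div]
    exact div_le_one_of_le₀ hle (norm_nonneg _)
  · have hF := integral_kernel_add_one (D := D) (μ := μ) hσ hσ1 hw
    have hsub := D.Q_zero_sub (μ := μ) hσ hσ1 hw
    have hF' : (∫ x, (σ x + w) / (σ x - w) ∂μ) - 1 = D.Qstar μ σ w 0 := by
      linear_combination hF + hsub
    rw [schur, hF, hF']
    field_simp
    linear_combination D.Qstar μ σ w 0 * h2 - w * D.Q μ σ w 0 * h1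

end Measure

end DiskData

/-! ### Orthonormality with respect to the approximating measures -/

/-- The Poisson formula on the unit disk. -/
theorem circleAverage_poisson {H G : ℂ → ℂ} (hH : ∀ s, ‖s‖ ≤ 1 → DifferentiableAt ℂ H s)
    {a : ℂ} (ha : ‖a‖ < 1)
    (hG : ∀ s, ‖s‖ = 1 → G s = ((1 - ‖a‖ ^ 2) / ‖s - a‖ ^ 2 : ℝ) * H s) :
    Real.circleAverage G 0 1 = H a := by
  have hd : DiffContOnCl ℂ H (Metric.ball 0 1) := by
    apply DifferentiableOn.diffContOnCl
    intro s hs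
    rw [closure_ball _ one_ne_zero] at hs
    exact (hH s (by simpa using hs)).differentiableWithinAt
  rw [← hd.circleAverage_poissonKernel_smul' (w := a) (by simpa using ha)]
  apply Real.circleAverage_congr_sphere
  intro s hs
  have hs1 : ‖s‖ = 1 := by simpa using hs
  simp [hG s hs1, hs1]

theorem circleAverage_conj {G : ℂ → ℂ} (hG : CircleIntegrable G 0 1) :
    Real.circleAverage (fun s => conj (G s)) 0 1 = conj (Real.circleAverage G 0 1) :=
  (Complex.conjCLE : ℂ →L[ℝ] ℂ).circleAverage_comp_comm hG

theorem circleAverage_poisson_conj {H G : ℂ → ℂ}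
    (hH : ∀ s, ‖s‖ ≤ 1 → DifferentiableAt ℂ H s) {a : ℂ} (ha : ‖a‖ < 1)
    (hG : ∀ s, ‖s‖ = 1 → G s = ((1 - ‖a‖ ^ 2) / ‖s - a‖ ^ 2 : ℝ) * conj (H s)) :
    Real.circleAverage G 0 1 = conj (H a) := by
  have hne : ∀ s : ℂ, ‖s‖ = 1 → s - a ≠ 0 := fun s hs h => by
    rw [sub_eq_zero.1 h] at hs
    exact ha.ne hs
  let G' : ℂ → ℂ := fun s => ((1 - ‖a‖ ^ 2) / ‖s - a‖ ^ 2 : ℝ) * H s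
  have hc : CircleIntegrable G' 0 1 := by
    apply ContinuousOn.circleIntegrable zero_le_one
    intro s hs
    have hs1 : ‖s‖ = 1 := by simpa using hs
    have h1 := (hH s hs1.le).continuousAt
    have h2 : ‖s - a‖ ^ 2 ≠ 0 := pow_ne_zero _ (norm_ne_zero_iff.2 (hne s hs1))
    apply ContinuousAt.continuousWithinAt
    refine ContinuousAt.mul ?_ h1
    exact Complex.continuous_ofReal.continuousAt.comp
      (continuousAt_const.div (by fun_prop) h2)
  rw [← circleAverage_poisson hH ha (G := G') fun s _ => rfl, ← circleAverage_conj hc]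
  apply Real.circleAverage_congr_sphere
  intro s hs
  have hs1 : ‖s‖ = 1 := by simpa using hs
  simp only [hG s hs1, G', map_mul, Complex.conj_ofReal]

namespace DiskData

variable (D : DiskData)

/-- The density with respect to the normalized arc length of `dm_{a_n} / |Φ_n|²`. -/
def approxDensity (n : ℕ) (s : ℂ) : ℝ := (1 - ‖D.a n‖ ^ 2) / ‖s - D.a n‖ ^ 2 / ‖D.phi n s‖ ^ 2

/-- The partial Blaschke products `ζ_{m+1} ⋯ ζ_n`. -/
def partB (m n : ℕ) (s : ℂ) : ℂ := ∏ k ∈ Finset.Ico m n, D.zeta (k + 1) s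

theorem B_mul_partB {m n : ℕ} (h : m ≤ n) (s : ℂ) : D.B m s * D.partB m n s = D.B n s :=
  Finset.prod_range_mul_prod_Ico _ h

theorem partB_zero (n : ℕ) : D.partB 0 n = D.B n := by
  ext s
  rw [partB, B, Finset.range_eq_Ico]

theorem partB_self (m : ℕ) (s : ℂ) : D.partB m m s = 1 := by simp [partB]

theorem partB_eval {m n : ℕ} (h : m < n) : D.partB m n (D.a n) = 0 := by
  refine Finset.prod_eq_zero (i := n - 1) (by simp; omega) ?_
  rw [Nat.sub_add_cancel (by omega), zeta_self]

theorem differentiableAt_partB (m n : ℕ) {s : ℂ} (hs : ‖s‖ ≤ 1) :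
    DifferentiableAt ℂ (D.partB m n) s := by
  have : ∀ k ∈ Finset.Ico m n, DifferentiableAt ℂ (D.zeta (k + 1)) s :=
    fun k _ => D.differentiableAt_zeta _ hs
  unfold partB
  fun_prop (disch := assumption)

/-- On the circle this turns an antianalytic quotient into boundary values of a function analytic on
the closed disk, where `Φ*_n` has no zeros, so that Poisson's formula becomes available. -/
theorem conj_phi_div {m n : ℕ} (h : m ≤ n) {s : ℂ} (hs : ‖s‖ = 1) :
    conj (D.phi m s) / conj (D.phi n s) = D.partB m n s * D.phiStar m s / D.phiStar n s := by
  have h1 := D.phiStar_eq m hs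
  have h2 := D.phiStar_eq n hs
  have h3 := D.B_mul_partB h s
  have h4 : conj (D.phi n s) ≠ 0 := by simpa using D.phi_ne_zero n hs
  have h5 := D.phiStar_ne_zero n hs.le
  rw [div_eq_div_iff h4 h5, h1, h2, ← h3]
  ring

theorem continuousAt_approxDensity (n : ℕ) {s : ℂ} (hs : ‖s‖ = 1) :
    ContinuousAt (D.approxDensity n) s := by
  have h1 : ‖s - D.a n‖ ^ 2 ≠ 0 :=
    pow_ne_zero _ (norm_ne_zero_iff.2 (sub_ne_zero.2 (D.ne_a_of_norm_one n hs)))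
  have h2 : ‖D.phi n s‖ ^ 2 ≠ 0 := pow_ne_zero _ (norm_ne_zero_iff.2 (D.phi_ne_zero n hs))
  have h3 := (D.differentiableAt_phi n hs.le).continuousAt
  unfold approxDensity
  fun_prop (disch := assumption)

/-- The density cancels `Φ̄_n`, leaving the Poisson integral of `Φ_m / Φ_n`. Its conjugate is the
boundary value of an analytic function that carries `ζ_{m+1} ⋯ ζ_n`; for `m < n` this product
vanishes at `a_n`, where Poisson's formula evaluates it. -/
theorem circleAverage_phi_mul_conj_phi_self {m n : ℕ} (h : m ≤ n) :
    Real.circleAverage (fun s => D.approxDensity n s * (D.phi m s * conj (D.phi n s))) 0 1 =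
      if m = n then 1 else 0 := by
  have hH : ∀ s, ‖s‖ ≤ 1 →
      DifferentiableAt ℂ (fun s => D.partB m n s * D.phiStar m s / D.phiStar n s) s :=
    fun s hs => by
      have h1 := D.differentiableAt_partB m n hs
      have h2 := D.differentiableAt_phiStar m hs
      have h3 := D.differentiableAt_phiStar n hs
      have h4 := D.phiStar_ne_zero n hs
      fun_prop (disch := assumption)
  rw [circleAverage_poisson_conj hH (D.norm_a n) fun s hs => ?_]
  · split_ifs with hmn
    · subst hmn
      have := D.phiStar_ne_zero m (D.norm_a m).le
      simp [partB_self, this]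
    · simp [D.partB_eval (lt_of_le_of_ne h hmn)]
  · rw [← D.conj_phi_div h hs]
    have h1 := D.phi_ne_zero n hs
    have h2 : conj (D.phi n s) ≠ 0 := by simpa using h1
    simp only [approxDensity, map_div₀, Complex.conj_conj]
    push_cast
    rw [← Complex.mul_conj' (D.phi n s)]
    field_simp

/-- The function `Φ_j Φ̄_k u / |Φ_n|²` with `u = v / (1 + v)`, `v = Λ c ζ Φ_n / Φ*_n`, in its
analytic form. -/
def stepFun (n j k : ℕ) (s : ℂ) : ℂ :=
  D.phi j s * D.phiStar k s * D.partB k n s * (D.Λ n * D.c n * D.zeta n s) /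
    (D.phiStar n s * (D.Λ n * (D.c n * D.zeta n s * D.phi n s) + D.phiStar n s))

theorem differentiableAt_stepFun (n j k : ℕ) {s : ℂ} (hs : ‖s‖ ≤ 1) :
    DifferentiableAt ℂ (D.stepFun n j k) s := by
  have h1 := D.differentiableAt_partB k n hs
  have h2 := D.differentiableAt_phiStar k hs
  have h3 := D.differentiableAt_phiStar n hs
  have h4 := D.differentiableAt_phi j hs
  have h5 := D.differentiableAt_phi n hs
  have h6 := D.differentiableAt_zeta n hs
  have h7 := mul_ne_zero (D.phiStar_ne_zero n hs) (D.phiStar_add_ne_zero n hs)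
  unfold stepFun
  fun_prop (disch := assumption)

theorem norm_phi_eq (n : ℕ) {s : ℂ} (hs : ‖s‖ = 1) : ‖D.phi n s‖ = ‖D.phiStar n s‖ := by
  rw [D.phiStar_eq n hs, norm_mul, D.norm_B_eq n hs, one_mul, Complex.norm_conj]

/-- With `x = Λ_n c_n ζ_n Φ_n / Φ*_n`, the density is multiplied by `(1 - |x|²) / |1 + x|²`, the
real part of `(1 - x) / (1 + x)`. Here `|x| = |Λ_n|` on the circle because `|Φ_n| = |Φ*_n|` there.
-/
theorem approxDensity_succ (n : ℕ) {s : ℂ} (hs : ‖s‖ = 1) :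
    D.approxDensity (n + 1) s = D.approxDensity n s *
      ((1 - ‖D.Λ n * (D.c n * D.zeta n s * D.phi n s)‖ ^ 2 / ‖D.phiStar n s‖ ^ 2) *
      (‖D.phiStar n s‖ ^ 2 /
        ‖D.Λ n * (D.c n * D.zeta n s * D.phi n s) + D.phiStar n s‖ ^ 2)) := by
  have hn : ∀ k, ‖s - D.a k‖ = ‖1 - conj (D.a k) * s‖ := fun k => by
    have := congrArg norm (conj_den (a := D.a k) hs)
    rw [Complex.norm_conj, norm_div, hs, div_one] at this
    exact this.symm
  have h1 := D.norm_rho_sq n hs.le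
  have h2 := norm_ne_zero_iff.2 (D.phiStar_ne_zero n hs.le)
  have h3 := norm_ne_zero_iff.2 (D.phiStar_add_ne_zero n hs.le)
  have h4 := norm_ne_zero_iff.2 (D.den_ne_zero n hs.le)
  have h5 := norm_ne_zero_iff.2 (D.den_ne_zero (n + 1) hs.le)
  have h6 := norm_ne_zero_iff.2 (D.rho_ne_zero n hs.le)
  have h7 := (D.one_sub_norm_a_sq_pos n).ne'
  have h8 := (D.one_sub_norm_a_sq_pos (n + 1)).ne'
  have e : ‖D.Λ n * (D.c n * D.zeta n s * D.phi n s)‖ = ‖D.Λ n‖ * ‖D.phiStar n s‖ := by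
    simp only [norm_mul, D.norm_c, D.norm_zeta_eq n hs, D.norm_phi_eq n hs, one_mul]
  rw [approxDensity, approxDensity, D.norm_phi_eq n hs, D.norm_phi_eq (n + 1) hs, hn, hn,
    phiStar_succ, norm_mul, e]
  generalize ‖1 - conj (D.a n) * s‖ = u at *
  generalize ‖1 - conj (D.a (n + 1)) * s‖ = v at *
  generalize ‖D.Λ n * (D.c n * D.zeta n s * D.phi n s) + D.phiStar n s‖ = q at *
  field_simp at h1 ⊢
  linear_combination -h1

/-- With `x = v / p` this is `Re ((1 - x) / (1 + x)) = 1 - 2 Re (x / (1 + x))`. It separates the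
change of the density into an analytic part and its conjugate. -/
theorem one_sub_norm_sq_div {v p : ℂ} (hp : p ≠ 0) (h : v + p ≠ 0) :
    (((1 - ‖v‖ ^ 2 / ‖p‖ ^ 2) * (‖p‖ ^ 2 / ‖v + p‖ ^ 2) : ℝ) : ℂ) =
      1 - v / (v + p) - conj (v / (v + p)) := by
  have h' : conj (v + p) ≠ 0 := (_root_.map_ne_zero _).2 h
  have hp' : conj p ≠ 0 := by simpa using hp
  push_cast
  rw [← Complex.mul_conj', ← Complex.mul_conj', ← Complex.mul_conj', map_div₀]
  rw [map_add] at *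
  field_simp
  ring

theorem approxDensity_succ_mul (n j k : ℕ) (hj : j ≤ n) (hk : k ≤ n) {s : ℂ} (hs : ‖s‖ = 1) :
    D.approxDensity (n + 1) s * (D.phi j s * conj (D.phi k s)) =
      D.approxDensity n s * (D.phi j s * conj (D.phi k s)) -
      (((1 - ‖D.a n‖ ^ 2) / ‖s - D.a n‖ ^ 2 : ℝ) * D.stepFun n j k s +
        ((1 - ‖D.a n‖ ^ 2) / ‖s - D.a n‖ ^ 2 : ℝ) * conj (D.stepFun n k j s)) := by
  have h0 := D.phiStar_add_ne_zero n hs.le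
  have h1 := D.phiStar_ne_zero n hs.le
  have h2 := D.phi_ne_zero n hs
  have h2' : conj (D.phi n s) ≠ 0 := by simpa using h2
  have hstep : ∀ j k, k ≤ n → ((1 - ‖D.a n‖ ^ 2) / ‖s - D.a n‖ ^ 2 : ℝ) * D.stepFun n j k s =
      D.approxDensity n s * (D.phi j s * conj (D.phi k s)) *
        (D.Λ n * (D.c n * D.zeta n s * D.phi n s) /
        (D.Λ n * (D.c n * D.zeta n s * D.phi n s) + D.phiStar n s)) := by
    intro j k hk
    have e := D.conj_phi_div hk hs
    have e' : conj (D.phi k s) =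
        D.partB k n s * D.phiStar k s / D.phiStar n s * conj (D.phi n s) := by
      rw [← e]; field_simp
    rw [stepFun, approxDensity, e']
    generalize (1 - ‖D.a n‖ ^ 2) / ‖s - D.a n‖ ^ 2 = κ
    push_cast
    rw [← Complex.mul_conj' (D.phi n s)]
    field_simp
  have e2 : ((1 - ‖D.a n‖ ^ 2) / ‖s - D.a n‖ ^ 2 : ℝ) * conj (D.stepFun n k j s) =
      conj ((((1 - ‖D.a n‖ ^ 2) / ‖s - D.a n‖ ^ 2 : ℝ) : ℂ) * D.stepFun n k j s) := by
    rw [map_mul, Complex.conj_ofReal]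
  rw [e2, hstep j k hk, hstep k j hj, D.approxDensity_succ n hs, Complex.ofReal_mul,
    one_sub_norm_sq_div h1 h0, map_mul, map_mul, map_mul, Complex.conj_conj, Complex.conj_ofReal]
  ring

/-- The two corrections are the Poisson integrals at `a_n` of `stepFun` and of the conjugate of a
`stepFun`. Both vanish, since `stepFun` contains the factor `ζ_n`; so the inner products already
fixed at stage `n` persist. -/
theorem circleAverage_approxDensity_succ {n j k : ℕ} (hj : j ≤ n) (hk : k ≤ n) :
    Real.circleAverage (fun s => D.approxDensity (n + 1) s * (D.phi j s * conj (D.phi k s))) 0 1 =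
    Real.circleAverage (fun s => D.approxDensity n s * (D.phi j s * conj (D.phi k s))) 0 1 := by
  have hci : ∀ F : ℂ → ℂ, (∀ s, ‖s‖ = 1 → ContinuousAt F s) → CircleIntegrable F 0 1 :=
    fun F hF => ContinuousOn.circleIntegrable zero_le_one fun s hs =>
      (hF s (by simpa using hs)).continuousWithinAt
  have hP : ∀ s : ℂ, ‖s‖ = 1 →
      ContinuousAt (fun s => (((1 - ‖D.a n‖ ^ 2) / ‖s - D.a n‖ ^ 2 : ℝ) : ℂ)) s := fun s hs => by
    have h1 : ‖s - D.a n‖ ^ 2 ≠ 0 :=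
      pow_ne_zero _ (norm_ne_zero_iff.2 (sub_ne_zero.2 (D.ne_a_of_norm_one n hs)))
    exact Complex.continuous_ofReal.continuousAt.comp
      (continuousAt_const.div (by fun_prop) h1)
  have hS : ∀ j k s, ‖s‖ = 1 → ContinuousAt (D.stepFun n j k) s := fun j k s hs =>
    (D.differentiableAt_stepFun n j k hs.le).continuousAt
  have i1 : CircleIntegrable
      (fun s => D.approxDensity n s * (D.phi j s * conj (D.phi k s))) 0 1 :=
    hci _ fun s hs => by
      have h1 := D.continuousAt_approxDensity n hs
      have h2 := (D.differentiableAt_phi j hs.le).continuousAt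
      have h3 := (D.differentiableAt_phi k hs.le).continuousAt
      fun_prop
  have i2 : CircleIntegrable
      (fun s => ((1 - ‖D.a n‖ ^ 2) / ‖s - D.a n‖ ^ 2 : ℝ) * D.stepFun n j k s) 0 1 :=
    hci _ fun s hs => (hP s hs).mul (hS j k s hs)
  have i3 : CircleIntegrable
      (fun s => ((1 - ‖D.a n‖ ^ 2) / ‖s - D.a n‖ ^ 2 : ℝ) * conj (D.stepFun n k j s)) 0 1 :=
    hci _ fun s hs => (hP s hs).mul (Complex.continuous_conj.continuousAt.comp (hS k j s hs))
  have i4 : CircleIntegrable (fun s =>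
      ((1 - ‖D.a n‖ ^ 2) / ‖s - D.a n‖ ^ 2 : ℝ) * D.stepFun n j k s +
        ((1 - ‖D.a n‖ ^ 2) / ‖s - D.a n‖ ^ 2 : ℝ) * conj (D.stepFun n k j s)) 0 1 := i2.add i3
  rw [Real.circleAverage_congr_sphere (f₂ := fun s =>
      D.approxDensity n s * (D.phi j s * conj (D.phi k s)) -
      (((1 - ‖D.a n‖ ^ 2) / ‖s - D.a n‖ ^ 2 : ℝ) * D.stepFun n j k s +
        ((1 - ‖D.a n‖ ^ 2) / ‖s - D.a n‖ ^ 2 : ℝ) * conj (D.stepFun n k j s)))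
      fun s hs => D.approxDensity_succ_mul n j k hj hk (by simpa using hs),
    Real.circleAverage_fun_sub i1 i4]
  have e1 := Real.circleAverage_fun_add i2 i3
  rw [circleAverage_poisson (fun s hs => D.differentiableAt_stepFun n j k hs) (D.norm_a n)
      fun s _ => rfl,
    circleAverage_poisson_conj (fun s hs => D.differentiableAt_stepFun n k j hs) (D.norm_a n)
      fun s _ => rfl] at e1
  rw [e1]
  simp [stepFun, zeta_self]

theorem circleAverage_phi_mul_conj_phi {n j k : ℕ} (hj : j ≤ n) (hk : k ≤ n) :
    Real.circleAverage (fun s => D.approxDensity n s * (D.phi j s * conj (D.phi k s))) 0 1 =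
      if j = k then 1 else 0 := by
  induction n generalizing j k with
  | zero =>
    obtain rfl : j = 0 := by omega
    obtain rfl : k = 0 := by omega
    exact D.circleAverage_phi_mul_conj_phi_self le_rfl
  | succ n ih =>
    rcases Nat.lt_or_ge n k with hk' | hk'
    · obtain rfl : k = n + 1 := by omega
      exact D.circleAverage_phi_mul_conj_phi_self hj
    · rcases Nat.lt_or_ge n j with hj' | hj'
      · obtain rfl : j = n + 1 := by omega
        have h := D.circleAverage_phi_mul_conj_phi_self hk
        have hc : CircleIntegrable (fun s => D.approxDensity (n + 1) s *
            (D.phi k s * conj (D.phi (n + 1) s))) 0 1 := by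
          apply ContinuousOn.circleIntegrable zero_le_one
          intro s hs
          have hs1 : ‖s‖ = 1 := by simpa using hs
          apply ContinuousAt.continuousWithinAt
          have h1 := D.continuousAt_approxDensity (n + 1) hs1
          have h2 := (D.differentiableAt_phi (n + 1) hs1.le).continuousAt
          have h3 := (D.differentiableAt_phi k hs1.le).continuousAt
          fun_prop
        have h2 := circleAverage_conj hc
        rw [h] at h2
        simp only [map_mul, Complex.conj_ofReal, Complex.conj_conj] at h2
        simp only [mul_comm (conj _)] at h2
        rw [h2]
        rw [if_neg (by omega), if_neg (by omega), map_zero]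
      · rw [D.circleAverage_approxDensity_succ hj' hk', ih hj' hk']

section Measure

variable {T : Type*} [MeasurableSpace T] {μ : Measure T} {σ : T → ℂ}

/-- `μ` corresponds under `σ` to the measure `dm_{a_n} / |Φ_n|²`. -/
def IsApprox (μ : Measure T) (σ : T → ℂ) (n : ℕ) : Prop :=
  ∀ G : ℂ → ℂ, (∀ s, ‖s‖ = 1 → ContinuousAt G s) →
    ∫ x, G (σ x) ∂μ = Real.circleAverage (fun s => D.approxDensity n s * G s) 0 1

variable {D}

theorem IsApprox.orthoUpTo {n : ℕ} (h : D.IsApprox μ σ n) : D.OrthoUpTo μ σ n := by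
  intro j hj k hk
  rw [h (fun s => D.phi j s * conj (D.phi k s)), D.circleAverage_phi_mul_conj_phi hj hk]
  intro s hs
  have h2 := (D.differentiableAt_phi j hs.le).continuousAt
  have h3 := (D.differentiableAt_phi k hs.le).continuousAt
  fun_prop

theorem IsApprox.isProbabilityMeasure {n : ℕ} (h : D.IsApprox μ σ n) :
    IsProbabilityMeasure μ := by
  have h1 := h.orthoUpTo 0 n.zero_le 0 n.zero_le
  simp only [phi_zero, map_one, mul_one, if_true] at h1
  rw [integral_const, Complex.real_smul, mul_one] at h1
  have h2 : μ.real Set.univ = 1 := by exact_mod_cast h1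
  refine ⟨?_⟩
  rw [measureReal_def] at h2
  exact (ENNReal.toReal_eq_one_iff _).1 h2

/-- After cancelling with the density, the conjugate of the integrand is the Poisson kernel times a
function analytic on the closed disk with the factor `B_{n+1}`, which vanishes at `a_{n+1}`. -/
theorem IsApprox.Qstar_eq_zero {n : ℕ} (h : D.IsApprox μ σ (n + 1)) {w : ℂ} (hw : ‖w‖ < 1) :
    D.Qstar μ σ w (n + 1) = 0 := by
  have hne : ∀ s : ℂ, ‖s‖ = 1 → s - w ≠ 0 := fun s hs h => by
    rw [sub_eq_zero.1 h] at hs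
    exact hw.ne hs
  have hH : ∀ s, ‖s‖ ≤ 1 → DifferentiableAt ℂ (fun s => 2 * conj w * s / (1 - conj w * s) *
      (D.B (n + 1) s / D.phiStar (n + 1) s)) s := fun s hs => by
    have h1 := D.phiStar_ne_zero (n + 1) hs
    have h2 := one_sub_conj_mul_ne_zero hw hs
    have h3 := D.differentiableAt_phiStar (n + 1) hs
    have h4 : DifferentiableAt ℂ (D.B (n + 1)) s := by
      rw [← D.partB_zero]
      exact D.differentiableAt_partB 0 (n + 1) hs
    fun_prop (disch := assumption)
  have h1 : ∫ x, 2 * w * conj (D.phi (n + 1) (σ x)) / (σ x - w) ∂μ = 0 := by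
    rw [h (fun s => 2 * w * conj (D.phi (n + 1) s) / (s - w)),
      circleAverage_poisson_conj hH (D.norm_a (n + 1)) fun s hs => ?_]
    · rw [B_succ, zeta_self]
      simp
    · have h2 := D.phi_ne_zero (n + 1) hs
      have h2' : conj (D.phi (n + 1) s) ≠ 0 := by simpa using h2
      have h3 := hne s hs
      have h0 : s ≠ 0 := by rintro rfl; simp at hs
      have h4 := D.phiStar_eq (n + 1) hs
      have h5 : D.B (n + 1) s ≠ 0 := norm_ne_zero_iff.1 (by rw [D.norm_B_eq _ hs]; simp)
      have h6 : conj (1 - conj w * s) = (s - w) / s := conj_den hs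
      rw [h4, approxDensity, map_mul, map_div₀, h6]
      simp only [map_mul, map_div₀, Complex.conj_conj, map_ofNat]
      rw [conj_eq_inv_of_norm_one hs]
      have h5' : conj (D.B (n + 1) s) ≠ 0 := by simpa using h5
      generalize (1 - ‖D.a (n + 1)‖ ^ 2) / ‖s - D.a (n + 1)‖ ^ 2 = κ
      push_cast
      rw [← Complex.mul_conj' (D.phi (n + 1) s)]
      field_simp
    · intro s hs
      have h2 := hne s hs
      have h3 := (D.differentiableAt_phi (n + 1) hs.le).continuousAt
      fun_prop (disch := assumption)
  rw [Qstar, h1, mul_zero]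

variable [TopologicalSpace T] [CompactSpace T] [BorelSpace T]

/-- The Schur function of `μ⁽ⁿ⁺¹⁾` is `R_n / S_n`. -/
theorem IsApprox.schur_mul {n : ℕ} (h : D.IsApprox μ σ (n + 1)) (hσ : Continuous σ)
    (hσ1 : ∀ x, ‖σ x‖ = 1) {w : ℂ} (hw : ‖w‖ < 1) (hwa : ∀ k, w ≠ D.a k) :
    schur μ σ w * (D.wall n w).S = (D.wall n w).R := by
  have := h.isProbabilityMeasure
  obtain ⟨-, v, hv, -, h1⟩ := h.orthoUpTo.schur_eq hσ hσ1 hw hwa le_rfl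
  rw [h.Qstar_eq_zero hw] at hv
  simpa [hv] using h1

end Measure

end DiskData

/-! ### The Möbius maps of the Wall recurrence -/

section WallSeq

variable {ζ γ : ℕ → ℂ}

theorem norm_wallSeq_Rstar_lt (hζ : ∀ k, ‖ζ k‖ ≤ 1) (hγ : ∀ k, ‖γ k‖ < 1) (n : ℕ) :
    ‖(wallSeq ζ γ n).Rstar‖ < ‖(wallSeq ζ γ n).S‖ := by
  induction n with
  | zero => simpa [wallSeq] using hγ 0
  | succ n ih =>
    have h := norm_sq_add_conj_mul_sub (conj (γ (n + 1))) (wallSeq ζ γ n).S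
      (ζ (n + 1) * (wallSeq ζ γ n).Rstar)
    have h1 : ‖ζ (n + 1) * (wallSeq ζ γ n).Rstar‖ < ‖(wallSeq ζ γ n).S‖ := by
      rw [norm_mul]
      exact lt_of_le_of_lt (mul_le_of_le_one_left (norm_nonneg _) (hζ _)) ih
    have h2 : 0 < 1 - ‖γ (n + 1)‖ ^ 2 := by nlinarith [hγ (n + 1), norm_nonneg (γ (n + 1))]
    have h3 : 0 < ‖(wallSeq ζ γ n).S‖ ^ 2 - ‖ζ (n + 1) * (wallSeq ζ γ n).Rstar‖ ^ 2 := by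
      nlinarith [norm_nonneg (ζ (n + 1) * (wallSeq ζ γ n).Rstar)]
    rw [Complex.norm_conj, Complex.conj_conj] at h
    have h4 := mul_pos h2 h3
    rw [← h] at h4
    have e1 : (wallSeq ζ γ (n + 1)).S =
        (wallSeq ζ γ n).S + γ (n + 1) * (ζ (n + 1) * (wallSeq ζ γ n).Rstar) := by
      simp only [wallSeq]; ring
    have e2 : (wallSeq ζ γ (n + 1)).Rstar =
        conj (γ (n + 1)) * (wallSeq ζ γ n).S + ζ (n + 1) * (wallSeq ζ γ n).Rstar := by
      simp only [wallSeq, Complex.star_def]; ring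
    rw [e1, e2]
    exact (sq_lt_sq₀ (norm_nonneg _) (norm_nonneg _)).1 (by linarith)

theorem wallSeq_S_ne_zero (hζ : ∀ k, ‖ζ k‖ ≤ 1) (hγ : ∀ k, ‖γ k‖ < 1) (n : ℕ) :
    (wallSeq ζ γ n).S ≠ 0 :=
  norm_pos_iff.1 ((norm_nonneg _).trans_lt (norm_wallSeq_Rstar_lt hζ hγ n))

/-- The map of index `n + 1` is the map of index `n` composed with `v ↦ ζ_{n+1} (γ_{n+1} + v) / (1 +
γ̄_{n+1} v)`, which preserves the closed disk. Numerator and denominator are treated separately,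
with the common factor `1 + γ̄_{n+1} v`. -/
theorem norm_wallSeq_le (hζ : ∀ k, ‖ζ k‖ ≤ 1) (hγ : ∀ k, ‖γ k‖ < 1) (n : ℕ) {v : ℂ}
    (hv : ‖v‖ ≤ 1) :
    ‖(wallSeq ζ γ n).R + (wallSeq ζ γ n).Sstar * v‖ ≤
      ‖(wallSeq ζ γ n).S + (wallSeq ζ γ n).Rstar * v‖ := by
  induction n generalizing v with
  | zero =>
    simpa [wallSeq] using norm_add_le_norm_one_add_conj_mul (hγ 0).le hv
  | succ n ih =>
    have h0 : 1 + conj (γ (n + 1)) * v ≠ 0 :=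
      one_add_mul_ne_zero (by simpa using hγ (n + 1)) hv
    set v' := ζ (n + 1) * ((γ (n + 1) + v) / (1 + conj (γ (n + 1)) * v)) with hv'
    have h1 : ‖v'‖ ≤ 1 := by
      rw [hv', norm_mul, norm_div]
      exact mul_le_one₀ (hζ _) (by positivity)
        (div_le_one_of_le₀ (norm_add_le_norm_one_add_conj_mul (hγ _).le hv) (norm_nonneg _))
    have e1 : (wallSeq ζ γ (n + 1)).R + (wallSeq ζ γ (n + 1)).Sstar * v =
        (1 + conj (γ (n + 1)) * v) * ((wallSeq ζ γ n).R + (wallSeq ζ γ n).Sstar * v') := by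
      simp only [wallSeq, Complex.star_def, hv']
      field_simp
      ring
    have e2 : (wallSeq ζ γ (n + 1)).S + (wallSeq ζ γ (n + 1)).Rstar * v =
        (1 + conj (γ (n + 1)) * v) * ((wallSeq ζ γ n).S + (wallSeq ζ γ n).Rstar * v') := by
      simp only [wallSeq, Complex.star_def, hv']
      field_simp
      ring
    rw [e1, e2, norm_mul, norm_mul]
    exact mul_le_mul_of_nonneg_left (ih h1) (norm_nonneg _)

/-- This is the determinant of the Möbius map in `v`; its nonvanishing makes the map injective, so
that the image of a point outside the closed disk is not attained inside it. -/
theorem wallSeq_det_ne_zero (hζ : ∀ k, ζ k ≠ 0) (hγ : ∀ k, ‖γ k‖ < 1) (n : ℕ) :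
    (wallSeq ζ γ n).S * (wallSeq ζ γ n).Sstar - (wallSeq ζ γ n).R * (wallSeq ζ γ n).Rstar ≠ 0 := by
  have h : ∀ k, 1 - γ k * conj (γ k) ≠ 0 := fun k => by
    have := one_sub_conj_mul_ne_zero (hγ k) (hγ k).le
    rwa [mul_comm] at this
  induction n with
  | zero => simpa [wallSeq] using h 0
  | succ n ih =>
    have e : (wallSeq ζ γ (n + 1)).S * (wallSeq ζ γ (n + 1)).Sstar -
        (wallSeq ζ γ (n + 1)).R * (wallSeq ζ γ (n + 1)).Rstar =
        (1 - γ (n + 1) * conj (γ (n + 1))) * ζ (n + 1) * ((wallSeq ζ γ n).S *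
          (wallSeq ζ γ n).Sstar - (wallSeq ζ γ n).R * (wallSeq ζ γ n).Rstar) := by
      simp only [wallSeq, Complex.star_def]
      ring
    rw [e]
    exact mul_ne_zero (mul_ne_zero (h _) (hζ _)) ih

/-- If `R*/S` is close to the unit circle, there is a point close to `R/S` outside the image of
the closed unit disk under `v ↦ (R + S* v) / (S + R* v)`. -/
theorem exists_near_not_mem {W : WallValues} (h1 : ‖W.Rstar‖ < ‖W.S‖)
    (h2 : ∀ v : ℂ, ‖v‖ ≤ 1 → ‖W.R + W.Sstar * v‖ ≤ ‖W.S + W.Rstar * v‖)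
    (h3 : W.S * W.Sstar - W.R * W.Rstar ≠ 0) :
    ∃ y : ℂ, ‖y - W.R / W.S‖ ≤ 2 * (1 - ‖W.Rstar / W.S‖ ^ 2) ∧
      ∀ v : ℂ, ‖v‖ ≤ 1 → y * (W.S + W.Rstar * v) ≠ W.R + W.Sstar * v := by
  have hS : W.S ≠ 0 := norm_pos_iff.1 ((norm_nonneg _).trans_lt h1)
  set g := W.Rstar / W.S with hg
  have hR : W.Rstar = g * W.S := by rw [hg]; field_simp
  have hg1 : ‖g‖ < 1 := by
    rw [hg, norm_div]
    exact (div_lt_one (norm_pos_iff.2 hS)).2 h1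
  obtain ⟨u, hu, hgu⟩ : ∃ u : ℂ, ‖u‖ = 1 ∧ g * u = (‖g‖ : ℂ) := by
    by_cases h0 : g = 0
    · exact ⟨1, by simp, by simp [h0]⟩
    · have h0' : (‖g‖ : ℂ) ≠ 0 := by exact_mod_cast norm_ne_zero_iff.2 h0
      refine ⟨conj g / ‖g‖, ?_, ?_⟩
      · simp [h0]
      · rw [mul_div_assoc', Complex.mul_conj', div_eq_iff h0']
        ring
  have hgn := norm_nonneg g
  have n1 : (1 : ℂ) + 2 * ‖g‖ ≠ 0 := by
    have : (1 : ℝ) + 2 * ‖g‖ ≠ 0 := by positivity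
    exact_mod_cast this
  have n2 : (1 : ℂ) + ‖g‖ ≠ 0 := by
    have : (1 : ℝ) + ‖g‖ ≠ 0 := by positivity
    exact_mod_cast this
  have n3 : (1 : ℂ) - ‖g‖ ≠ 0 := by
    have : (1 : ℝ) - ‖g‖ ≠ 0 := by linarith
    exact_mod_cast this
  have d1 : ∀ x : ℂ, W.S + W.Rstar * (x * u) = W.S * (1 + x * ‖g‖) := fun x => by
    rw [hR, ← hgu]; ring
  set Δ := W.S * W.Sstar - W.R * W.Rstar with hΔ
  have hΔ' : W.S * W.Sstar - W.R * (g * W.S) = Δ := by rw [hΔ, hR]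
  -- The images of `u` and `-u` are at most `2` apart by `h2`, and their difference is exactly `2u
  -- (Δ / S²) / (1 - |g|²)`.
  have hbound : ‖Δ / W.S ^ 2‖ ≤ 1 - ‖g‖ ^ 2 := by
    have e : (W.R + W.Sstar * u) / (W.S + W.Rstar * u) -
        (W.R + W.Sstar * -u) / (W.S + W.Rstar * -u) =
        2 * u * (Δ / W.S ^ 2) / ((1 + ‖g‖) * (1 - ‖g‖)) := by
      have e1 : W.S + W.Rstar * u = W.S * (1 + ‖g‖) := by simpa using d1 1
      have e2 : W.S + W.Rstar * -u = W.S * (1 - ‖g‖) := by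
        have := d1 (-1)
        simpa [sub_eq_add_neg] using this
      rw [e1, e2, div_sub_div _ _ (mul_ne_zero hS n2) (mul_ne_zero hS n3), ← hΔ']
      field_simp
      rw [← hgu]
      ring
    have hle : ∀ v : ℂ, ‖v‖ ≤ 1 → ‖(W.R + W.Sstar * v) / (W.S + W.Rstar * v)‖ ≤ 1 := fun v hv => by
      rw [norm_div]
      exact div_le_one_of_le₀ (h2 v hv) (norm_nonneg _)
    have h4 := (norm_sub_le _ _).trans (add_le_add (hle u hu.le) (hle (-u) (by simp [hu])))
    rw [e] at h4
    have e3 : ‖((1 : ℂ) + ‖g‖) * (1 - ‖g‖)‖ = 1 - ‖g‖ ^ 2 := by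
      have : ((1 : ℂ) + ‖g‖) * (1 - ‖g‖) = ((1 - ‖g‖ ^ 2 : ℝ) : ℂ) := by push_cast; ring
      rw [this, Complex.norm_real, Real.norm_of_nonneg (by nlinarith)]
    have hpos : 0 < 1 - ‖g‖ ^ 2 := by nlinarith
    rw [norm_div, e3, norm_mul, norm_mul, hu, div_le_iff₀ hpos] at h4
    norm_num at h4
    have e4 : ‖Δ / W.S ^ 2‖ = ‖Δ‖ / ‖W.S‖ ^ 2 := by rw [norm_div, norm_pow]
    rw [e4]
    linarith
  -- The point `2u` lies outside the closed disk on the side away from the pole, so its image is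
  -- finite and differs from `R / S` by `2u (Δ / S²) / (1 + 2|g|)`.
  refine ⟨(W.R + W.Sstar * (2 * u)) / (W.S + W.Rstar * (2 * u)), ?_, ?_⟩
  · have e : (W.R + W.Sstar * (2 * u)) / (W.S + W.Rstar * (2 * u)) - W.R / W.S =
        2 * u * (Δ / W.S ^ 2) / (1 + 2 * ‖g‖) := by
      rw [d1 2, div_sub_div _ _ (mul_ne_zero hS n1) hS, ← hΔ']
      field_simp
      rw [← hgu]
      ring
    have e3 : ‖(1 : ℂ) + 2 * ‖g‖‖ = 1 + 2 * ‖g‖ := by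
      have : (1 : ℂ) + 2 * ‖g‖ = ((1 + 2 * ‖g‖ : ℝ) : ℂ) := by push_cast; ring
      rw [this, Complex.norm_real, Real.norm_of_nonneg (by positivity)]
    rw [e, norm_div, e3, norm_mul, norm_mul, hu, mul_one]
    refine (div_le_self (by positivity) (by linarith)).trans ?_
    rw [Complex.norm_ofNat]
    linarith
  · intro v hv hy
    have h4 : W.S + W.Rstar * (2 * u) ≠ 0 := by rw [d1 2]; exact mul_ne_zero hS n1
    rw [div_mul_eq_mul_div, div_eq_iff h4] at hy
    have h5 : Δ * (2 * u - v) = 0 := by rw [hΔ]; linear_combination hy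
    have h6 : v = 2 * u := by
      have := (mul_eq_zero.1 h5).resolve_left h3
      linear_combination -this
    rw [h6, norm_mul, hu] at hv
    norm_num at hv

end WallSeq

/-! ### Locally uniform convergence -/

/-- A sequence of holomorphic functions on the unit disk bounded by `1` that converges pointwise on
a dense subset converges locally uniformly. -/
theorem exists_tendstoLocallyUniformlyOn {f : ℕ → ℂ → ℂ}
    (hd : ∀ n, DifferentiableOn ℂ (f n) (Metric.ball 0 1))
    (hb : ∀ n, ∀ s ∈ Metric.ball (0 : ℂ) 1, ‖f n s‖ ≤ 1) {A : Set ℂ}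
    (hA : Metric.ball (0 : ℂ) 1 ⊆ closure (A ∩ Metric.ball 0 1))
    (hlim : ∀ s ∈ A ∩ Metric.ball (0 : ℂ) 1, ∃ l, Tendsto (fun n => f n s) atTop (𝓝 l)) :
    ∃ F : ℂ → ℂ, TendstoLocallyUniformlyOn f F atTop (Metric.ball 0 1) := by
  -- The ball about `c` of radius `1 - |c|` stays in the unit disk, and there the values oscillate
  -- by at most `2`; the Schwarz lemma gives a Lipschitz constant that does not depend on `n`.
  have hlip : ∀ c ∈ Metric.ball (0 : ℂ) 1, ∀ n, ∀ s ∈ Metric.ball c (1 - ‖c‖),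
      dist (f n s) (f n c) ≤ 2 / (1 - ‖c‖) * dist s c := by
    intro c hc n s hs
    have hsub : Metric.ball c (1 - ‖c‖) ⊆ Metric.ball 0 1 :=
      Metric.ball_subset_ball' (by simp)
    refine Complex.dist_le_div_mul_dist_of_mapsTo_ball ((hd n).mono hsub) (fun x hx => ?_) hs
    rw [Metric.mem_closedBall, dist_eq_norm]
    exact (norm_sub_le _ _).trans (by linarith [hb n x (hsub hx), hb n c hc])
  have hequi : ∀ c ∈ Metric.ball (0 : ℂ) 1, ∀ ε > 0, ∃ δ > 0, Metric.ball c δ ⊆ Metric.ball 0 1 ∧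
      ∀ s ∈ Metric.ball c δ, ∀ n, dist (f n s) (f n c) ≤ ε := by
    intro c hc ε hε
    have hc' : 0 < 1 - ‖c‖ := by simpa using hc
    refine ⟨min (1 - ‖c‖) (ε * (1 - ‖c‖) / 2), by positivity,
      Metric.ball_subset_ball' ?_, fun s hs n => ?_⟩
    · rw [dist_zero_right]
      linarith [min_le_left (1 - ‖c‖) (ε * (1 - ‖c‖) / 2)]
    have h1 : dist s c < 1 - ‖c‖ := lt_of_lt_of_le hs (min_le_left _ _)
    have h2 : dist s c < ε * (1 - ‖c‖) / 2 := lt_of_lt_of_le hs (min_le_right _ _)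
    refine (hlip c hc n s h1).trans ?_
    rw [div_mul_eq_mul_div, div_le_iff₀ hc']
    linarith
  have hcau : ∀ c ∈ Metric.ball (0 : ℂ) 1, ∃ l, Tendsto (fun n => f n c) atTop (𝓝 l) := by
    intro c hc
    apply cauchySeq_tendsto_of_complete
    rw [Metric.cauchySeq_iff]
    intro ε hε
    obtain ⟨δ, hδ, -, hδf⟩ := hequi c hc (ε / 4) (by positivity)
    obtain ⟨s, hsA, hs⟩ := Metric.mem_closure_iff.1 (hA hc) δ hδ
    rw [dist_comm] at hs
    obtain ⟨l, hl⟩ := hlim s hsA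
    obtain ⟨N, hN⟩ := Metric.cauchySeq_iff.1 hl.cauchySeq (ε / 4) (by positivity)
    refine ⟨N, fun m hm n hn => ?_⟩
    have h1 := hδf s hs m
    have h2 := hδf s hs n
    have h3 := hN m hm n hn
    have h4 := dist_triangle4 (f m c) (f m s) (f n s) (f n c)
    rw [dist_comm (f m c) (f m s)] at h4
    linarith
  choose! F hF using hcau
  refine ⟨F, Metric.tendstoLocallyUniformlyOn_iff.2 fun ε hε c hc => ?_⟩
  obtain ⟨δ, hδ, hsub, hδf⟩ := hequi c hc (ε / 4) (by positivity)
  refine ⟨Metric.ball c δ, mem_nhdsWithin_of_mem_nhds (Metric.ball_mem_nhds c hδ), ?_⟩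
  filter_upwards [(Metric.tendsto_nhds.1 (hF c hc)) (ε / 4) (by positivity)] with n hn s hs
  have h1 : dist (F s) (F c) ≤ ε / 4 :=
    le_of_tendsto ((hF s (hsub hs)).dist (hF c hc)) (Eventually.of_forall fun n => hδf s hs n)
  have h2 := hδf s hs n
  have h3 := dist_triangle4 (F s) (F c) (f n c) (f n s)
  rw [dist_comm (f n c) (f n s), dist_comm (F c)] at h3
  linarith

/-! ### The ratios `R*_n / S_n` and the unit circle -/

namespace DiskData

variable (D : DiskData)

theorem norm_Rstar_lt (n : ℕ) {s : ℂ} (hs : ‖s‖ ≤ 1) : ‖(D.wall n s).Rstar‖ < ‖(D.wall n s).S‖ :=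
  norm_wallSeq_Rstar_lt (fun k => D.norm_zeta_le k hs) D.norm_γ n

theorem S_ne_zero (n : ℕ) {s : ℂ} (hs : ‖s‖ ≤ 1) : (D.wall n s).S ≠ 0 :=
  wallSeq_S_ne_zero (fun k => D.norm_zeta_le k hs) D.norm_γ n

theorem norm_wall_le (n : ℕ) {s : ℂ} (hs : ‖s‖ ≤ 1) {v : ℂ} (hv : ‖v‖ ≤ 1) :
    ‖(D.wall n s).R + (D.wall n s).Sstar * v‖ ≤ ‖(D.wall n s).S + (D.wall n s).Rstar * v‖ :=
  norm_wallSeq_le (fun k => D.norm_zeta_le k hs) D.norm_γ n hv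

theorem norm_R_div_S_le (n : ℕ) {s : ℂ} (hs : ‖s‖ ≤ 1) :
    ‖(D.wall n s).R / (D.wall n s).S‖ ≤ 1 := by
  rw [norm_div]
  refine div_le_one_of_le₀ ?_ (norm_nonneg _)
  simpa using D.norm_wall_le n hs (v := 0) (by simp)

theorem differentiableAt_wall (n : ℕ) {s : ℂ} (hs : ‖s‖ ≤ 1) :
    DifferentiableAt ℂ (fun s => (D.wall n s).R) s ∧
    DifferentiableAt ℂ (fun s => (D.wall n s).S) s ∧
    DifferentiableAt ℂ (fun s => (D.wall n s).Rstar) s ∧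
    DifferentiableAt ℂ (fun s => (D.wall n s).Sstar) s := by
  induction n with
  | zero => simp [wall, wallSeq]
  | succ n ih =>
    obtain ⟨h1, h2, h3, h4⟩ := ih
    have h5 := D.differentiableAt_zeta (n + 1) hs
    simp only [wall, wallSeq] at h1 h2 h3 h4 ⊢
    refine ⟨?_, ?_, ?_, ?_⟩ <;> fun_prop

/-- The Schur functions `R*_n / S_n`. -/
def ratio (n : ℕ) (s : ℂ) : ℂ := (D.wall n s).Rstar / (D.wall n s).S

theorem norm_ratio_lt (n : ℕ) {s : ℂ} (hs : ‖s‖ ≤ 1) : ‖D.ratio n s‖ < 1 := by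
  rw [ratio, norm_div]
  exact (div_lt_one (norm_pos_iff.2 (D.S_ne_zero n hs))).2 (D.norm_Rstar_lt n hs)

theorem differentiableAt_ratio (n : ℕ) {s : ℂ} (hs : ‖s‖ ≤ 1) :
    DifferentiableAt ℂ (D.ratio n) s := by
  obtain ⟨-, h2, h3, -⟩ := D.differentiableAt_wall n hs
  exact h3.div h2 (D.S_ne_zero n hs)

theorem differentiableAt_R_div_S (n : ℕ) {s : ℂ} (hs : ‖s‖ ≤ 1) :
    DifferentiableAt ℂ (fun s => (D.wall n s).R / (D.wall n s).S) s := by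
  obtain ⟨h1, h2, -, -⟩ := D.differentiableAt_wall n hs
  exact h1.div h2 (D.S_ne_zero n hs)

/-- With `u = ζ_{n+1} g_n`, the ratio satisfies `g_{n+1} = (γ̄_{n+1} + u) / (1 + γ_{n+1} u)`, hence
`1 - |g_{n+1}|² = (1 - |γ_{n+1}|²)(1 - |u|²) / |1 + γ_{n+1} u|²`. The bounds `|1 + γ_{n+1} u| ≥ 1 -
|u|` and `|u| ≤ |g_n|` finish. It says that a parameter near the circle forces one of two
consecutive ratios near the circle. -/
theorem one_sub_norm_ratio_sq_le (n : ℕ) {s : ℂ} (hs : ‖s‖ ≤ 1) :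
    (1 - ‖D.ratio (n + 1) s‖ ^ 2) * (1 - ‖D.ratio n s‖) ≤ 2 * (1 - ‖D.γ (n + 1)‖ ^ 2) := by
  set u := D.zeta (n + 1) s * D.ratio n s with hu
  have hx := D.norm_ratio_lt n hs
  have hu1 : ‖u‖ ≤ ‖D.ratio n s‖ := by
    rw [hu, norm_mul]
    exact mul_le_of_le_one_left (norm_nonneg _) (D.norm_zeta_le _ hs)
  have hS := D.S_ne_zero n hs
  have h0 : 1 + D.γ (n + 1) * u ≠ 0 := one_add_mul_ne_zero (D.norm_γ _) (hu1.trans hx.le)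
  have e : D.ratio (n + 1) s = (conj (D.γ (n + 1)) + u) / (1 + D.γ (n + 1) * u) := by
    have h1 : (D.wall (n + 1) s).S = (D.wall n s).S * (1 + D.γ (n + 1) * u) := by
      simp only [hu, ratio, wall, wallSeq] at hS ⊢
      field_simp
    have h2 : (D.wall (n + 1) s).Rstar = (D.wall n s).S * (conj (D.γ (n + 1)) + u) := by
      simp only [hu, ratio, wall, wallSeq, Complex.star_def] at hS ⊢
      field_simp
      ring
    rw [ratio, h1, h2, mul_div_mul_left _ _ hS]
  have h2 := norm_one_add_conj_mul_sq (conj (D.γ (n + 1))) u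
  rw [Complex.conj_conj, Complex.norm_conj] at h2
  have h3 : 0 < ‖1 + D.γ (n + 1) * u‖ := norm_pos_iff.2 h0
  have h4 : 1 - ‖u‖ ≤ ‖1 + D.γ (n + 1) * u‖ := by
    have h5 : ‖D.γ (n + 1) * u‖ ≤ ‖u‖ := by
      rw [norm_mul]
      exact mul_le_of_le_one_left (norm_nonneg _) (D.norm_γ _).le
    have h6 := norm_sub_norm_le (1 : ℂ) (-(D.γ (n + 1) * u))
    rw [norm_neg, sub_neg_eq_add, norm_one] at h6
    linarith
  have h5 : (1 - ‖D.ratio (n + 1) s‖ ^ 2) * ‖1 + D.γ (n + 1) * u‖ ^ 2 =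
      (1 - ‖D.γ (n + 1)‖ ^ 2) * (1 - ‖u‖ ^ 2) := by
    rw [e, norm_div, div_pow, sub_mul, div_mul_cancel₀ _ (pow_ne_zero _ h3.ne')]
    linarith
  have h6 := D.norm_ratio_lt (n + 1) hs
  have h7 : 0 ≤ 1 - ‖D.ratio (n + 1) s‖ ^ 2 := by nlinarith [norm_nonneg (D.ratio (n + 1) s)]
  have h8 := D.one_sub_norm_γ_sq_pos (n + 1)
  have hu0 := norm_nonneg u
  have h9 : (1 - ‖D.ratio (n + 1) s‖ ^ 2) * (1 - ‖u‖) ^ 2 ≤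
      (1 - ‖D.γ (n + 1)‖ ^ 2) * (1 - ‖u‖ ^ 2) := by
    rw [← h5]
    exact mul_le_mul_of_nonneg_left (pow_le_pow_left₀ (by linarith) h4 2) h7
  have h10 : (1 - ‖D.ratio (n + 1) s‖ ^ 2) * (1 - ‖u‖) ≤ (1 - ‖D.γ (n + 1)‖ ^ 2) * (1 + ‖u‖) := by
    refine le_of_mul_le_mul_right ?_ (show 0 < 1 - ‖u‖ by linarith)
    linarith
  calc (1 - ‖D.ratio (n + 1) s‖ ^ 2) * (1 - ‖D.ratio n s‖)
      ≤ (1 - ‖D.ratio (n + 1) s‖ ^ 2) * (1 - ‖u‖) := by gcongr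
    _ ≤ (1 - ‖D.γ (n + 1)‖ ^ 2) * (1 + ‖u‖) := h10
    _ ≤ 2 * (1 - ‖D.γ (n + 1)‖ ^ 2) := by nlinarith

theorem frequently_ratio {s : ℂ} (hs : ‖s‖ ≤ 1)
    (hlim : limsup (fun n => ‖D.γ n‖) atTop = 1) {ε : ℝ} (hε : 0 < ε) :
    ∃ᶠ n in atTop, 1 - ε < ‖D.ratio n s‖ := by
  wlog hε1 : ε ≤ 1 generalizing ε
  · exact (this one_pos le_rfl).mono fun n hn => by linarith
  by_contra hcon
  rw [not_frequently] at hcon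
  -- The threshold makes `2 (1 - |γ|²)` at most `ε² / 4`, while two consecutive ratios of modulus at
  -- most `1 - ε` would make the left side of `one_sub_norm_ratio_sq_le` at least `ε²`.
  have hf : ∃ᶠ n in atTop, 1 - ε ^ 2 / 16 < ‖D.γ n‖ :=
    frequently_lt_of_lt_limsup (f := atTop) (u := fun n => ‖D.γ n‖)
      (isCobounded_le_of_bdd D) (by rw [hlim]; linarith [sq_pos_of_pos hε])
  obtain ⟨N, hN⟩ := eventually_atTop.1 hcon
  obtain ⟨m, hm, hγm⟩ := frequently_atTop.1 hf (N + 1)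
  obtain ⟨n, rfl⟩ : ∃ n, m = n + 1 := ⟨m - 1, by omega⟩
  have h1 := D.one_sub_norm_ratio_sq_le n hs
  have h2 := not_lt.1 (hN n (by omega))
  have h3 := not_lt.1 (hN (n + 1) (by omega))
  have h4 := D.norm_γ (n + 1)
  have h5 : ε ≤ 1 - ‖D.ratio (n + 1) s‖ ^ 2 := by nlinarith [norm_nonneg (D.ratio (n + 1) s)]
  have h6 : 1 - ‖D.γ (n + 1)‖ ^ 2 ≤ ε ^ 2 / 8 := by nlinarith [norm_nonneg (D.γ (n + 1))]
  have h7 : ε * ε ≤ (1 - ‖D.ratio (n + 1) s‖ ^ 2) * (1 - ‖D.ratio n s‖) :=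
    mul_le_mul h5 (by linarith) hε.le (by linarith)
  nlinarith [sq_pos_of_pos hε]
where
  isCobounded_le_of_bdd (D : DiskData) :
      IsCoboundedUnder (· ≤ ·) atTop fun n => ‖D.γ n‖ :=
    IsBoundedUnder.isCoboundedUnder_le
      ⟨0, eventually_map.2 (Eventually.of_forall fun n => norm_nonneg _)⟩

theorem exists_subseq_ratio {s : ℂ} (hs : ‖s‖ ≤ 1)
    (hlim : limsup (fun n => ‖D.γ n‖) atTop = 1) :
    ∃ φ : ℕ → ℕ, StrictMono φ ∧ Tendsto (fun k => ‖D.ratio (φ k) s‖) atTop (𝓝 1) := by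
  obtain ⟨φ, hφ, h⟩ := extraction_forall_of_frequently
    fun k : ℕ => D.frequently_ratio hs hlim (Nat.one_div_pos_of_nat (n := k) (α := ℝ))
  refine ⟨φ, hφ, tendsto_of_tendsto_of_tendsto_of_le_of_le ?_ tendsto_const_nhds
    (fun k => (h k).le) fun k => (D.norm_ratio_lt _ hs).le⟩
  simpa using (tendsto_const_nhds (x := (1 : ℝ))).sub
    (tendsto_one_div_add_atTop_nhds_zero_nat (𝕜 := ℝ))

/-- Schwarz–Pick: the oscillation of `R*_n / S_n` is controlled by its value at `0`. -/
theorem norm_ratio_sub_le (n : ℕ) {s : ℂ} (hs : ‖s‖ < 1) :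
    ‖D.ratio n s - D.ratio n 0‖ * (1 - ‖s‖) ≤ 1 - ‖D.ratio n 0‖ ^ 2 := by
  set p := D.ratio n 0 with hp
  have hp1 : ‖p‖ < 1 := D.norm_ratio_lt n (by simp)
  have hden : ∀ x : ℂ, ‖x‖ < 1 → 1 - conj p * D.ratio n x ≠ 0 := fun x hx =>
    one_sub_conj_mul_ne_zero hp1 (D.norm_ratio_lt n hx.le).le
  -- The Schwarz lemma is applied after the disk automorphism that moves `p = g_n(0)` to the origin.
  have h1 := Complex.norm_le_norm_of_mapsTo_ball (R := 1) (z := s)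
    (f := fun x => (D.ratio n x - p) / (1 - conj p * D.ratio n x))
    (fun x hx => by
      have hx1 : ‖x‖ < 1 := by simpa using hx
      have h1 := D.differentiableAt_ratio n hx1.le
      have h2 := hden x hx1
      exact DifferentiableAt.differentiableWithinAt (by fun_prop (disch := assumption)))
    (fun x hx => by
      have hx1 : ‖x‖ < 1 := by simpa using hx
      have h1 := norm_add_le_norm_one_add_conj_mul (u := -p) (v := D.ratio n x)
        (by simpa using hp1.le) (D.norm_ratio_lt n hx1.le).le
      rw [mem_closedBall_zero_iff, norm_div]
      refine div_le_one_of_le₀ ?_ (norm_nonneg _)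
      simpa [sub_eq_add_neg, add_comm] using h1)
    (by simp [hp]) hs
  have h2 : 0 < ‖1 - conj p * D.ratio n s‖ := norm_pos_iff.2 (hden s hs)
  rw [norm_div, div_le_iff₀ h2] at h1
  -- Expanding the denominator about `p` brings back the unknown difference `g_n(s) - p` with
  -- coefficient at most `1`; multiplied by `|s| < 1`, it is absorbed on the left.
  have h3 : ‖1 - conj p * D.ratio n s‖ ≤ (1 - ‖p‖ ^ 2) + ‖D.ratio n s - p‖ := by
    have e : 1 - conj p * D.ratio n s = ((1 - ‖p‖ ^ 2 : ℝ) : ℂ) - conj p * (D.ratio n s - p) := by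
      push_cast
      rw [← Complex.conj_mul']
      ring
    rw [e]
    refine (norm_sub_le _ _).trans (add_le_add ?_ ?_)
    · rw [Complex.norm_real, Real.norm_of_nonneg (by nlinarith [norm_nonneg p])]
    · rw [norm_mul, Complex.norm_conj]
      exact mul_le_of_le_one_left (norm_nonneg _) hp1.le
  have h4 : 0 ≤ 1 - ‖p‖ ^ 2 := by nlinarith [norm_nonneg p]
  nlinarith [norm_nonneg s, mul_le_mul_of_nonneg_left h3 (norm_nonneg s)]

/-- A subsequence chosen at the single point `0` thus serves every point of the disk, which is why
one limit function works for all `z`. -/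
theorem tendsto_norm_ratio {φ : ℕ → ℕ} (h : Tendsto (fun k => ‖D.ratio (φ k) 0‖) atTop (𝓝 1))
    {s : ℂ} (hs : ‖s‖ < 1) : Tendsto (fun k => ‖D.ratio (φ k) s‖) atTop (𝓝 1) := by
  have h1 : Tendsto (fun k => ‖D.ratio (φ k) 0‖ - (1 - ‖D.ratio (φ k) 0‖ ^ 2) / (1 - ‖s‖))
      atTop (𝓝 1) := by
    have := h.sub (((h.pow 2).const_sub 1).div_const (1 - ‖s‖))
    simpa using this
  refine tendsto_of_tendsto_of_tendsto_of_le_of_le h1 tendsto_const_nhds (fun k => ?_)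
    fun k => (D.norm_ratio_lt _ hs.le).le
  have h2 := D.norm_ratio_sub_le (φ k) hs
  have h3 : 0 < 1 - ‖s‖ := by linarith
  rw [← le_div_iff₀ h3] at h2
  have h4 := norm_sub_norm_le (D.ratio (φ k) 0) (D.ratio (φ k) s)
  rw [norm_sub_rev] at h4
  simp only
  linarith

end DiskData

/-! ### Transport from the region to the disk -/

/-- The conformal map of the region onto the unit disk that maps the base point to `0`. -/
def toDisk : Domain → ℂ → ℂ
  | .disk, z => z
  | .halfPlane, z => (z - Complex.I) / (z + Complex.I)

/-- The factor that relates `ϖ_a` to the corresponding function of the unit disk. -/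
def kappa : Domain → ℂ → ℂ
  | .disk, _ => 1
  | .halfPlane, a => Complex.I - conj a

/-- The unimodular constant of the Blaschke factor `ζ_a`, as a function of the disk variable. -/
def eta : Domain → ℂ → ℂ
  | .disk, a => zconst .disk a
  | .halfPlane, a => zconst .halfPlane a * ((Complex.I + a) / (Complex.I - conj a))

/-- The points of the closure of the region in the Riemann sphere. -/
def closedRegion : Domain → Set (OnePoint ℂ)
  | .disk => {t | ∃ z : ℂ, ‖z‖ ≤ 1 ∧ t = (z : OnePoint ℂ)}
  | .halfPlane => {t | t = OnePoint.infty ∨ ∃ z : ℂ, 0 ≤ z.im ∧ t = (z : OnePoint ℂ)}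

@[simp] theorem hnum_coe (z : ℂ) : hnum (z : OnePoint ℂ) = z := rfl
@[simp] theorem hden_coe (z : ℂ) : hden (z : OnePoint ℂ) = 1 := rfl
@[simp] theorem hnum_infty : hnum OnePoint.infty = 1 := rfl
@[simp] theorem hden_infty : hden OnePoint.infty = 0 := rfl

theorem coe_mem_closedRegion {O : Domain} {z : ℂ} (hz : z ∈ region O) :
    (z : OnePoint ℂ) ∈ closedRegion O := by
  cases O
  · exact ⟨z, le_of_lt hz, rfl⟩
  · exact Or.inr ⟨z, le_of_lt hz, rfl⟩

theorem boundarySet_subset (O : Domain) : boundarySet O ⊆ closedRegion O := by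
  cases O
  · rintro t ⟨z, hz, rfl⟩
    exact ⟨z, hz.le, rfl⟩
  · rintro t (h | ⟨x, rfl⟩)
    · exact Or.inl h
    · exact Or.inr ⟨x, by simp, rfl⟩

theorem ne_zero_of_im_pos {z : ℂ} (h : 0 < z.im) : z ≠ 0 := by
  rintro rfl
  simp at h

theorem add_I_ne_zero {z : ℂ} (h : 0 ≤ z.im) : z + Complex.I ≠ 0 :=
  ne_zero_of_im_pos (by simp; linarith)

theorem I_sub_conj_ne_zero {z : ℂ} (h : 0 ≤ z.im) : Complex.I - conj z ≠ 0 :=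
  ne_zero_of_im_pos (by simp; linarith)

theorem conj_I_sub_conj (z : ℂ) : conj (Complex.I - conj z) = -(Complex.I + z) := by
  simp
  ring

theorem hnum_add_ne_zero {t : OnePoint ℂ} (ht : t ∈ closedRegion .halfPlane) :
    hnum t + Complex.I * hden t ≠ 0 := by
  rcases ht with rfl | ⟨z, hz, rfl⟩
  · simp
  · simpa using add_I_ne_zero hz

theorem zconst_basePoint (O : Domain) : zconst O (basePoint O) = 1 := by simp [zconst]

theorem norm_zconst {O : Domain} {a : ℂ} (ha : a ∈ region O) : ‖zconst O a‖ = 1 := by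
  unfold zconst
  split_ifs with h
  · simp
  · cases O
    · have : a ≠ 0 := h
      simp [this]
    · have h1 : (a - Complex.I) * (a + Complex.I) ≠ 0 :=
        mul_ne_zero (sub_ne_zero.2 h) (add_I_ne_zero (le_of_lt ha))
      have h2 : (1 + a ^ 2 : ℂ) ≠ 0 := by
        intro h0
        apply h1
        linear_combination h0 - Complex.I_mul_I
      simp [h2]

theorem kappa_ne_zero {O : Domain} {a : ℂ} (ha : a ∈ region O) : kappa O a ≠ 0 := by
  cases O
  · exact one_ne_zero
  · exact I_sub_conj_ne_zero (le_of_lt ha)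

theorem norm_add_I_eq (a : ℂ) : ‖a + Complex.I‖ = ‖Complex.I - conj a‖ := by
  rw [← Complex.norm_conj (Complex.I - conj a), conj_I_sub_conj, norm_neg, add_comm]

theorem norm_eta {O : Domain} {a : ℂ} (ha : a ∈ region O) : ‖eta O a‖ = 1 := by
  cases O
  · exact norm_zconst ha
  · have h := norm_ne_zero_iff.2 (kappa_ne_zero ha)
    simp only [kappa] at h
    rw [eta, norm_mul, norm_zconst ha, one_mul, norm_div, add_comm, norm_add_I_eq, div_self h]

theorem weight_pos {O : Domain} {a : ℂ} (ha : a ∈ region O) : 0 < weight O a := by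
  cases O
  · have : ‖a‖ < 1 := ha
    simp only [weight]
    nlinarith [norm_nonneg a]
  · exact ha

/-- `1 - |a'|² = C ϖ_a(a) / |κ_a|²`, with a constant `C` that does not depend on `a`. -/
theorem one_sub_norm_toDisk_sq (O : Domain) : ∃ C : ℝ, 0 < C ∧ ∀ a ∈ region O,
    1 - ‖toDisk O a‖ ^ 2 = C * weight O a / ‖kappa O a‖ ^ 2 := by
  cases O
  · exact ⟨1, one_pos, fun a _ => by simp [toDisk, weight, kappa]⟩
  · refine ⟨4, by norm_num, fun a ha => ?_⟩
    have h := norm_ne_zero_iff.2 (add_I_ne_zero (z := a) (le_of_lt ha))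
    simp only [toDisk, weight, kappa]
    rw [← norm_add_I_eq, norm_div]
    field_simp
    simp only [← Complex.normSq_eq_norm_sq, Complex.normSq_apply]
    simp
    ring

theorem norm_toDisk_lt {O : Domain} {a : ℂ} (ha : a ∈ region O) : ‖toDisk O a‖ < 1 := by
  obtain ⟨C, hC, h⟩ := one_sub_norm_toDisk_sq O
  have h1 := h a ha
  have h2 : 0 < C * weight O a / ‖kappa O a‖ ^ 2 :=
    div_pos (mul_pos hC (weight_pos ha)) (pow_pos (norm_pos_iff.2 (kappa_ne_zero ha)) 2)
  rw [← h1] at h2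
  nlinarith [norm_nonneg (toDisk O a)]

theorem toDisk_basePoint (O : Domain) : toDisk O (basePoint O) = 0 := by
  cases O <;> simp [toDisk, basePoint]

theorem toDisk_injOn (O : Domain) : Set.InjOn (toDisk O) (region O) := by
  cases O
  · exact fun a _ b _ h => h
  · intro a ha b hb h
    have h1 := add_I_ne_zero (z := a) (le_of_lt ha)
    have h2 := add_I_ne_zero (z := b) (le_of_lt hb)
    simp only [toDisk] at h
    rw [div_eq_div_iff h1 h2] at h
    have h3 : 2 * Complex.I * (a - b) = 0 := by linear_combination h
    have h4 := (mul_eq_zero.1 h3).resolve_left (by simp)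
    exact sub_eq_zero.1 h4

theorem continuousOn_toDisk (O : Domain) : ContinuousOn (toDisk O) (region O) := by
  cases O
  · exact continuousOn_id
  · exact ContinuousOn.div (by fun_prop) (by fun_prop) fun z hz => add_I_ne_zero (le_of_lt hz)

theorem zeta_basePoint_coe (O : Domain) (z : ℂ) :
    zeta O (basePoint O) (z : OnePoint ℂ) = toDisk O z := by
  rw [zeta, zconst_basePoint]
  cases O <;> simp [varpi, varpiStar, toDisk, basePoint]

theorem zeta_basePoint_halfPlane (t : OnePoint ℂ) :
    zeta .halfPlane (basePoint .halfPlane) t =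
      (hnum t - Complex.I * hden t) / (hnum t + Complex.I * hden t) := by
  rw [zeta, zconst_basePoint]
  simp [varpi, varpiStar, basePoint]

theorem zeta_eq {O : Domain} {a : ℂ} (ha : a ∈ region O) {t : OnePoint ℂ}
    (ht : t ∈ closedRegion O) : zeta O a t = eta O a *
      ((zeta O (basePoint O) t - toDisk O a) /
        (1 - conj (toDisk O a) * zeta O (basePoint O) t)) := by
  cases O
  · obtain ⟨z, -, rfl⟩ := ht
    rw [zeta_basePoint_coe]
    simp [zeta, varpi, varpiStar, eta, toDisk]
  · have h1 := hnum_add_ne_zero ht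
    have h2 := add_I_ne_zero (z := a) (le_of_lt ha)
    have h3 := I_sub_conj_ne_zero (z := a) (le_of_lt ha)
    have h4 : conj a - Complex.I ≠ 0 := fun h => h3 (by linear_combination -h)
    rw [zeta_basePoint_halfPlane]
    simp only [zeta, varpi, varpiStar, eta, toDisk, map_div₀, map_sub, map_add, Complex.conj_I,
      Complex.star_def]
    have e1 : (hnum t - Complex.I * hden t) / (hnum t + Complex.I * hden t) -
        (a - Complex.I) / (a + Complex.I) = 2 * Complex.I * (hnum t - a * hden t) /
        ((hnum t + Complex.I * hden t) * (a + Complex.I)) := by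
      field_simp
      ring
    have e2 : 1 - (conj a - -Complex.I) / (conj a + -Complex.I) *
        ((hnum t - Complex.I * hden t) / (hnum t + Complex.I * hden t)) =
        2 * Complex.I * (hnum t - conj a * hden t) /
        ((hnum t + Complex.I * hden t) * (Complex.I - conj a)) := by
      rw [← sub_eq_add_neg, sub_neg_eq_add]
      field_simp
      ring
    rw [e1, e2, div_div_div_eq]
    -- If the denominator of `ζ_a` were zero, both sides would be zero by the convention for
    -- division, so its nonvanishing need not be proved.
    by_cases h5 : hnum t - conj a * hden t = 0
    · simp [h5]
    · have := Complex.I_ne_zero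
      generalize hnum t + Complex.I * hden t = p at h1
      generalize hnum t - conj a * hden t = q at h5
      rw [add_comm Complex.I a]
      field_simp

/-- The factor `m` depends on `t` but not on `a`, so it cancels in the quotient `ϖ_n / ϖ_{n+1}` of
the recurrence. Homogeneous coordinates cover the point `∞` by the same computation. -/
theorem varpi_eq (O : Domain) {t : OnePoint ℂ} (ht : t ∈ closedRegion O) : ∃ m : ℂ, m ≠ 0 ∧
    ∀ a ∈ region O, varpi O a t =
      m * (kappa O a * (1 - conj (toDisk O a) * zeta O (basePoint O) t)) := by
  cases O
  · obtain ⟨z, -, rfl⟩ := ht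
    refine ⟨1, one_ne_zero, fun a _ => ?_⟩
    rw [zeta_basePoint_coe]
    simp [varpi, kappa, toDisk]
  · have h1 := hnum_add_ne_zero ht
    have h1' : hnum t + hden t * Complex.I ≠ 0 := by rwa [mul_comm]
    refine ⟨(hnum t + Complex.I * hden t) / (2 * Complex.I), div_ne_zero h1 (by simp),
      fun a ha => ?_⟩
    have h3 := I_sub_conj_ne_zero (z := a) (le_of_lt ha)
    have h4 : conj a - Complex.I ≠ 0 := fun h => h3 (by linear_combination -h)
    have := Complex.I_ne_zero
    rw [zeta_basePoint_halfPlane]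
    simp only [varpi, kappa, toDisk, map_div₀, map_sub, map_add, Complex.conj_I, Complex.star_def]
    rw [← sub_eq_add_neg, sub_neg_eq_add]
    field_simp
    ring

/-- The disk data of the sequences `α` and `γ`. -/
def diskData (O : Domain) (α γ : ℕ → ℂ) (hα0 : α 0 = basePoint O) (hα : ∀ n, α n ∈ region O)
    (hγ : ∀ n, ‖γ n‖ < 1) : DiskData where
  a n := toDisk O (α n)
  η n := eta O (α n)
  -- The square root is the constant `e_{n+1}` of the recurrence; the quotient of the `κ` is what
  -- `ϖ_n / ϖ_{n+1}` contributes when rewritten in the disk variable.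
  r n := (Real.sqrt (weight O (α (n + 1)) / weight O (α n) *
    (1 / (1 - ‖-(star (zconst O (α (n + 1))) * γ n)‖ ^ 2))) : ℝ) *
      (kappa O (α n) / kappa O (α (n + 1)))
  z n := zconst O (α n)
  γ := γ
  a_zero := by rw [hα0, toDisk_basePoint]
  η_zero := by
    rw [hα0]
    cases O
    · exact zconst_basePoint _
    · rw [eta, zconst_basePoint]
      simp [basePoint]
  z_zero := by rw [hα0, zconst_basePoint]
  norm_a n := norm_toDisk_lt (hα n)
  norm_η n := norm_eta (hα n)
  norm_z n := norm_zconst (hα n)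
  norm_γ := hγ
  norm_r n := by
    obtain ⟨C, hC, h⟩ := one_sub_norm_toDisk_sq O
    have h1 := weight_pos (hα n)
    have h2 := weight_pos (hα (n + 1))
    have h3 : 0 < 1 - ‖γ n‖ ^ 2 := by nlinarith [hγ n, norm_nonneg (γ n)]
    have h4 := norm_ne_zero_iff.2 (kappa_ne_zero (hα n))
    have h5 := norm_ne_zero_iff.2 (kappa_ne_zero (hα (n + 1)))
    have h6 : ‖-(star (zconst O (α (n + 1))) * γ n)‖ = ‖γ n‖ := by
      simp [norm_zconst (hα (n + 1))]
    rw [h _ (hα n), h _ (hα (n + 1)), h6, norm_mul, Complex.norm_real, mul_pow, Real.norm_of_nonneg (Real.sqrt_nonneg _),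
      Real.sq_sqrt (by positivity), norm_div]
    field_simp
  compat n := by
    have hz : ∀ k, zconst O (α k) * conj (zconst O (α k)) = 1 := fun k =>
      DiskData.norm_one_mul_conj (norm_zconst (hα k))
    simp only [map_mul, Complex.conj_conj, Complex.conj_ofReal, map_div₀]
    cases O
    · simp only [kappa, eta, map_one]
      linear_combination zconst .disk (α n) * (Real.sqrt (weight .disk (α (n + 1)) /
        weight .disk (α n) * (1 / (1 - ‖-(star (zconst .disk (α (n + 1))) * γ n)‖ ^ 2))) : ℝ) *
        hz (n + 1)
    · have h1 := I_sub_conj_ne_zero (z := α n) (le_of_lt (hα n))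
      have h2 := I_sub_conj_ne_zero (z := α (n + 1)) (le_of_lt (hα (n + 1)))
      have h3 : Complex.I + α (n + 1) ≠ 0 := by
        rw [add_comm]
        exact add_I_ne_zero (le_of_lt (hα (n + 1)))
      simp only [kappa, eta, conj_I_sub_conj]
      generalize (Real.sqrt (weight .halfPlane (α (n + 1)) / weight .halfPlane (α n) *
        (1 / (1 - ‖-(star (zconst .halfPlane (α (n + 1))) * γ n)‖ ^ 2))) : ℝ) = e
      have h := hz (n + 1)
      field_simp
      linear_combination zconst .halfPlane (α n) * e * (Complex.I + α n) * h

section Bridge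

variable {O : Domain} {α γ : ℕ → ℂ} (hα0 : α 0 = basePoint O) (hα : ∀ n, α n ∈ region O)
  (hγ : ∀ n, ‖γ n‖ < 1)

theorem zeta_eq_diskData {t : OnePoint ℂ} (ht : t ∈ closedRegion O) (n : ℕ) :
    zeta O (α n) t = (diskData O α γ hα0 hα hγ).zeta n (zeta O (basePoint O) t) :=
  zeta_eq (hα n) ht

theorem orfPair_eq_diskData {t : OnePoint ℂ} (ht : t ∈ closedRegion O) (n : ℕ) :
    orfPair O α γ n t = (diskData O α γ hα0 hα hγ).pair n (zeta O (basePoint O) t) := by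
  induction n with
  | zero => rfl
  | succ n ih =>
    have hρ : ((Real.sqrt (weight O (α (n + 1)) / weight O (α n) *
        (1 / (1 - ‖-(star (zconst O (α (n + 1))) * γ n)‖ ^ 2))) : ℝ) : ℂ) *
        (varpi O (α n) t / varpi O (α (n + 1)) t) =
        (diskData O α γ hα0 hα hγ).rho n (zeta O (basePoint O) t) := by
      obtain ⟨m, hm, h⟩ := varpi_eq O ht
      rw [h _ (hα n), h _ (hα (n + 1)), mul_div_mul_left _ _ hm, DiskData.rho, mul_div_mul_comm,
        ← mul_assoc]
      rfl
    simp only [orfPair, DiskData.pair, hρ, ih, zeta_eq_diskData hα0 hα hγ ht n]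
    rfl

theorem orf_eq_diskData {t : OnePoint ℂ} (ht : t ∈ closedRegion O) (n : ℕ) :
    orf O α γ n t = (diskData O α γ hα0 hα hγ).phi n (zeta O (basePoint O) t) := by
  rw [orf, orfPair_eq_diskData hα0 hα hγ ht, DiskData.phi]

theorem wall_eq_diskData {t : OnePoint ℂ} (ht : t ∈ closedRegion O) (n : ℕ) :
    wall O α γ n t = (diskData O α γ hα0 hα hγ).wall n (zeta O (basePoint O) t) := by
  rw [wall_eq_wallSeq, DiskData.wall]
  congr 1
  funext k
  exact zeta_eq_diskData hα0 hα hγ ht k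

end Bridge

/-! ### The boundary as a compact metrizable space -/

/-- The identification of the boundary with the unit circle. -/
def bdryMap (O : Domain) (t : Bdry O) : ℂ := zeta O (basePoint O) t.1

theorem norm_zeta_basePoint {O : Domain} {t : OnePoint ℂ} (ht : t ∈ boundarySet O) :
    ‖zeta O (basePoint O) t‖ = 1 := by
  cases O
  · obtain ⟨z, hz, rfl⟩ := ht
    rw [zeta_basePoint_coe]
    exact hz
  · rw [zeta_basePoint_halfPlane]
    rcases ht with rfl | ⟨x, rfl⟩
    · simp
    · have h := add_I_ne_zero (z := (x : ℂ)) (by simp)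
      have h2 : conj ((x : ℂ) + Complex.I) = x - Complex.I := by simp [sub_eq_add_neg]
      rw [hnum_coe, hden_coe, mul_one, ← h2, norm_div, Complex.norm_conj,
        div_self (norm_ne_zero_iff.2 h)]

theorem norm_bdryMap {O : Domain} (t : Bdry O) : ‖bdryMap O t‖ = 1 := norm_zeta_basePoint t.2

theorem continuousAt_zeta_basePoint {O : Domain} {t : OnePoint ℂ} (ht : t ∈ boundarySet O) :
    ContinuousAt (zeta O (basePoint O)) t := by
  have h : ∀ O, zeta O (basePoint O) ∘ OnePoint.some = toDisk O := fun O =>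
    funext fun z => zeta_basePoint_coe O z
  cases O
  · obtain ⟨z, hz, rfl⟩ := ht
    rw [OnePoint.continuousAt_coe, h]
    exact continuousAt_id
  · rcases ht with rfl | ⟨x, rfl⟩
    · rw [OnePoint.continuousAt_infty', h, coclosedCompact_eq_cocompact,
        ← Metric.cobounded_eq_cocompact]
      -- The Cayley transform is `1 - 2i / (z + i)`, a form in which the limit at infinity is
      -- immediate.
      have h1 : Tendsto (fun z : ℂ => 1 - 2 * Complex.I * (z + Complex.I)⁻¹) (Bornology.cobounded ℂ)
          (𝓝 (1 - 2 * Complex.I * 0)) :=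
        tendsto_const_nhds.sub (tendsto_const_nhds.mul
          (tendsto_inv₀_cobounded.comp (tendsto_add_const_cobounded Complex.I)))
      have h2 : zeta .halfPlane (basePoint .halfPlane) OnePoint.infty = 1 - 2 * Complex.I * 0 := by
        rw [zeta_basePoint_halfPlane]
        simp
      rw [h2]
      refine h1.congr' ?_
      have h3 : ∀ᶠ z : ℂ in Bornology.cobounded ℂ, z ∉ ({-Complex.I} : Set ℂ) :=
        Bornology.isBounded_singleton
      filter_upwards [h3] with z hz
      have h4 : z + Complex.I ≠ 0 := fun h => hz (eq_neg_of_add_eq_zero_left h)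
      rw [toDisk]
      field_simp
      ring
    · rw [OnePoint.continuousAt_coe, h]
      have h := add_I_ne_zero (z := (x : ℂ)) (by simp)
      exact ContinuousAt.div (by fun_prop) (by fun_prop) h

theorem continuous_bdryMap (O : Domain) : Continuous (bdryMap O) :=
  continuous_iff_continuousAt.2 fun t =>
    (continuousAt_zeta_basePoint t.2).comp continuous_subtype_val.continuousAt

theorem injective_bdryMap (O : Domain) : Function.Injective (bdryMap O) := by
  cases O
  · rintro ⟨_, z, hz, rfl⟩ ⟨_, w, hw, rfl⟩ h
    simp only [bdryMap, zeta_basePoint_coe, toDisk] at h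
    subst h
    rfl
  · have h1 : ∀ x : ℝ, (x - Complex.I : ℂ) / (x + Complex.I) ≠ 1 := fun x hx => by
      rw [div_eq_one_iff_eq (add_I_ne_zero (by simp))] at hx
      have := congrArg Complex.im hx
      simp at this
      linarith
    rintro ⟨_, rfl | ⟨x, rfl⟩⟩ ⟨_, rfl | ⟨y, rfl⟩⟩ h
    · rfl
    · simp only [bdryMap, zeta_basePoint_halfPlane] at h
      simp at h
      exact absurd h.symm (h1 y)
    · simp only [bdryMap, zeta_basePoint_halfPlane] at h
      simp at h
      exact absurd h (h1 x)
    · simp only [bdryMap, zeta_basePoint_coe, toDisk] at h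
      rw [div_eq_div_iff (add_I_ne_zero (by simp)) (add_I_ne_zero (by simp))] at h
      have h3 : 2 * Complex.I * ((x : ℂ) - y) = 0 := by linear_combination h
      have h4 := sub_eq_zero.1 ((mul_eq_zero.1 h3).resolve_left (by simp))
      exact Subtype.ext (congrArg OnePoint.some h4)

theorem isClosed_boundarySet (O : Domain) : IsClosed (boundarySet O) := by
  cases O
  · have h : boundarySet .disk = OnePoint.some '' Metric.sphere (0 : ℂ) 1 := by
      ext t
      constructor
      · rintro ⟨z, hz, rfl⟩
        exact ⟨z, by simpa using hz, rfl⟩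
      · rintro ⟨z, hz, rfl⟩
        exact ⟨z, by simpa using hz, rfl⟩
    rw [h]
    exact ((isCompact_sphere _ _).image OnePoint.continuous_coe).isClosed
  · rw [OnePoint.isClosed_iff_of_mem (Or.inl rfl)]
    have h : OnePoint.some ⁻¹' boundarySet .halfPlane = {z : ℂ | z.im = 0} := by
      ext z
      constructor
      · rintro (h | ⟨x, h⟩)
        · exact absurd h (OnePoint.coe_ne_infty z)
        · rw [OnePoint.coe_injective h]
          simp
      · intro h
        exact Or.inr ⟨z.re, congrArg _ (Complex.ext (by simp) (by simpa using h))⟩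
    rw [h]
    exact isClosed_eq Complex.continuous_im continuous_const

instance (O : Domain) : CompactSpace (Bdry O) :=
  isCompact_iff_compactSpace.1 (isClosed_boundarySet O).isCompact

theorem isClosedEmbedding_bdryMap (O : Domain) : IsClosedEmbedding (bdryMap O) :=
  (continuous_bdryMap O).isClosedEmbedding (injective_bdryMap O)

/-- Metrizability is what allows subsequences, not only subnets, to be extracted from the
probability measures on the boundary. -/
instance (O : Domain) : TopologicalSpace.MetrizableSpace (Bdry O) :=
  (isClosedEmbedding_bdryMap O).isEmbedding.metrizableSpace

/-! ### The approximating measures -/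

theorem continuous_param (O : Domain) : Continuous (param O) := by
  cases O
  · exact Continuous.subtype_mk (OnePoint.continuous_coe.comp (by fun_prop)) _
  · exact Continuous.subtype_mk (OnePoint.continuous_coe.comp Complex.continuous_ofReal) _

theorem bdryMap_param (O : Domain) (x : ℝ) :
    bdryMap O (param O x) = match O with
      | .disk => Complex.exp (x * Complex.I)
      | .halfPlane => (x - Complex.I) / (x + Complex.I) := by
  cases O
  · exact zeta_basePoint_coe _ _
  · exact zeta_basePoint_coe _ _

theorem continuous_poissonDensity {O : Domain} {a : ℂ} (ha : a ∈ region O) :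
    Continuous (poissonDensity O a) := by
  cases O
  · refine Continuous.div_const (Continuous.div continuous_const (by fun_prop) fun x => ?_) _
    refine pow_ne_zero 2 (norm_ne_zero_iff.2 (sub_ne_zero.2 fun h => ?_))
    have h1 : ‖a‖ < 1 := ha
    rw [← h, Complex.norm_exp_ofReal_mul_I] at h1
    exact lt_irrefl _ h1
  · refine Continuous.div_const (Continuous.div continuous_const (by fun_prop) fun x => ?_) _
    refine pow_ne_zero 2 (norm_ne_zero_iff.2 (sub_ne_zero.2 fun h => ?_))
    have h1 : 0 < a.im := ha
    rw [← h] at h1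
    simp at h1

theorem poissonDensity_nonneg {O : Domain} {a : ℂ} (ha : a ∈ region O) (x : ℝ) :
    0 ≤ poissonDensity O a x := by
  have h := (weight_pos ha).le
  cases O
  · simp only [weight] at h
    simp only [poissonDensity]
    positivity
  · simp only [weight] at h
    simp only [poissonDensity]
    positivity

/-- `e^{2i arctan x} = (1 + ix)² / (1 + x²) = (1 + ix) / (1 - ix)`, and the added `π` supplies the
sign that turns this into the Cayley transform. -/
theorem circleMap_arctan (x : ℝ) : circleMap 0 1 (2 * Real.arctan x + Real.pi) =
    (x - Complex.I) / (x + Complex.I) := by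
  have h0 : (0 : ℝ) < 1 + x ^ 2 := by positivity
  have h1 : Complex.exp (Real.arctan x * Complex.I) =
      (1 + x * Complex.I) / (Real.sqrt (1 + x ^ 2) : ℝ) := by
    rw [Complex.exp_mul_I, ← Complex.ofReal_cos, ← Complex.ofReal_sin, Real.cos_arctan,
      Real.sin_arctan]
    push_cast
    ring
  have h2 : ((Real.sqrt (1 + x ^ 2) : ℝ) : ℂ) ^ 2 = 1 + x ^ 2 := by
    rw [← Complex.ofReal_pow, Real.sq_sqrt h0.le]
    push_cast
    ring
  have h3 : (1 + x ^ 2 : ℂ) ≠ 0 := by exact_mod_cast h0.ne'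
  have h4 := add_I_ne_zero (z := (x : ℂ)) (by simp)
  have h5 : ((2 * Real.arctan x + Real.pi : ℝ) : ℂ) * Complex.I =
      (Real.arctan x * Complex.I + Real.arctan x * Complex.I) + Real.pi * Complex.I := by
    push_cast
    ring
  rw [circleMap, h5, Complex.exp_add, Complex.exp_add, Complex.exp_pi_mul_I, h1, zero_add,
    Complex.ofReal_one, one_mul, div_mul_div_comm, ← sq, ← sq, h2, mul_neg_one, neg_eq_iff_eq_neg,
    div_eq_iff h3, ← neg_div, div_mul_eq_mul_div, eq_div_iff h4]
  linear_combination (2 * x + x ^ 3 + x ^ 2 * Complex.I) * Complex.I_mul_I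

theorem image_arctan : (fun x => 2 * Real.arctan x + Real.pi) '' Set.univ =
    Set.Ioo 0 (2 * Real.pi) := by
  ext θ
  constructor
  · rintro ⟨x, -, rfl⟩
    have h1 := Real.neg_pi_div_two_lt_arctan x
    have h2 := Real.arctan_lt_pi_div_two x
    constructor <;> simp only <;> linarith
  · rintro ⟨h1, h2⟩
    refine ⟨Real.tan ((θ - Real.pi) / 2), trivial, ?_⟩
    simp only
    rw [Real.arctan_tan (by linarith) (by linarith)]
    ring

/-- The integral over the circle in the variable of the real line. -/
theorem circleAverage_eq_integral_real (g : ℂ → ℂ) : Real.circleAverage g 0 1 =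
    ∫ x : ℝ, (1 / (1 + x ^ 2) / Real.pi) • g ((x - Complex.I) / (x + Complex.I)) := by
  rw [Real.circleAverage_def, intervalIntegral.integral_of_le Real.two_pi_pos.le,
    integral_Ioc_eq_integral_Ioo, ← image_arctan,
    integral_image_eq_integral_abs_deriv_smul MeasurableSet.univ
      (fun x _ => (((Real.hasDerivAt_arctan x).const_mul 2).add_const _).hasDerivWithinAt)
      (fun x _ y _ h => Real.arctan_injective (by linarith)),
    Measure.restrict_univ, ← integral_smul]
  congr 1
  funext x
  have h0 : (0 : ℝ) < 1 + x ^ 2 := by positivity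
  rw [circleMap_arctan, smul_smul, abs_of_pos (by positivity)]
  congr 1
  have := Real.pi_ne_zero
  field_simp

/-- Conformal invariance of harmonic measure: `m_a` on either boundary becomes the Poisson kernel of
the disk at the image of `a`. -/
theorem integral_poissonDensity {O : Domain} {a : ℂ} (ha : a ∈ region O) (g : ℂ → ℂ) :
    ∫ x in paramSet O, poissonDensity O a x • g (bdryMap O (param O x)) =
      Real.circleAverage
        (fun s => ((1 - ‖toDisk O a‖ ^ 2) / ‖s - toDisk O a‖ ^ 2 : ℝ) * g s) 0 1 := by
  cases O
  · rw [Real.circleAverage_def, intervalIntegral.integral_of_le Real.two_pi_pos.le, paramSet,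
      ← integral_smul]
    congr 1
    funext θ
    have h : circleMap 0 1 θ = Complex.exp (θ * Complex.I) := by simp [circleMap]
    simp only [bdryMap_param, poissonDensity, toDisk, h]
    simp only [Complex.real_smul]
    push_cast
    ring
  · rw [circleAverage_eq_integral_real, paramSet, Measure.restrict_univ]
    congr 1
    funext x
    have h0 : (0 : ℝ) < 1 + x ^ 2 := by positivity
    have h1 := add_I_ne_zero (z := (x : ℂ)) (by simp)
    have h2 := add_I_ne_zero (z := a) (le_of_lt ha)
    have h3 : (x : ℂ) - a ≠ 0 := fun h => by
      have h1 : 0 < a.im := ha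
      rw [← sub_eq_zero.1 h] at h1
      simp at h1
    simp only [bdryMap_param, poissonDensity, toDisk]
    rw [← Complex.real_smul, smul_smul]
    congr 1
    have e1 : (x - Complex.I) / (x + Complex.I) - (a - Complex.I) / (a + Complex.I) =
        2 * Complex.I * (x - a) / ((x + Complex.I) * (a + Complex.I)) := by
      field_simp
      ring
    have e2 : ‖(x : ℂ) + Complex.I‖ ^ 2 = 1 + x ^ 2 := by
      rw [← Complex.normSq_eq_norm_sq, Complex.normSq_apply]
      simp
      ring
    have e3 : ‖a + Complex.I‖ ^ 2 - ‖a - Complex.I‖ ^ 2 = 4 * a.im := by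
      simp only [← Complex.normSq_eq_norm_sq, Complex.normSq_apply]
      simp
      ring
    have h4 := norm_ne_zero_iff.2 h3
    have h5 := norm_ne_zero_iff.2 h2
    have := Real.pi_ne_zero
    have e5 : ‖2 * Complex.I * (x - a) / ((x + Complex.I) * (a + Complex.I))‖ ^ 2 =
        4 * ‖(x : ℂ) - a‖ ^ 2 / ((1 + x ^ 2) * ‖a + Complex.I‖ ^ 2) := by
      rw [norm_div, norm_mul, norm_mul, norm_mul, Complex.norm_I, Complex.norm_ofNat, div_pow,
        mul_pow, mul_pow, mul_pow, e2]
      norm_num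
    rw [e1, e5, norm_div, div_pow]
    have e4 : 1 - ‖a - Complex.I‖ ^ 2 / ‖a + Complex.I‖ ^ 2 = 4 * a.im / ‖a + Complex.I‖ ^ 2 := by
      rw [← e3]
      field_simp
    rw [e4]
    field_simp

section Measures

variable {O : Domain} {α γ : ℕ → ℂ} (hα0 : α 0 = basePoint O) (hα : ∀ n, α n ∈ region O)
  (hγ : ∀ n, ‖γ n‖ < 1)

theorem orf_eq_phi_bdryMap (n : ℕ) (t : Bdry O) :
    orf O α γ n t.1 = (diskData O α γ hα0 hα hγ).phi n (bdryMap O t) :=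
  orf_eq_diskData hα0 hα hγ (boundarySet_subset O t.2) n

theorem continuous_orf (hα0 : α 0 = basePoint O) (hα : ∀ n, α n ∈ region O)
    (hγ : ∀ n, ‖γ n‖ < 1) (n : ℕ) : Continuous fun t : Bdry O => orf O α γ n t.1 := by
  rw [funext (orf_eq_phi_bdryMap hα0 hα hγ n)]
  exact (diskData O α γ hα0 hα hγ).continuous_phi_comp (continuous_bdryMap O) norm_bdryMap n

theorem isApprox_approxMeasure (n : ℕ) :
    (diskData O α γ hα0 hα hγ).IsApprox (approxMeasure O α γ n) (bdryMap O) n := by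
  intro G hG
  have hphi := (diskData O α γ hα0 hα hγ).continuous_phi_comp (continuous_bdryMap O)
    norm_bdryMap n
  have hne : ∀ t : Bdry O, (diskData O α γ hα0 hα hγ).phi n (bdryMap O t) ≠ 0 := fun t =>
    (diskData O α γ hα0 hα hγ).phi_ne_zero n (norm_bdryMap t)
  have hGσ : Continuous fun t : Bdry O => G (bdryMap O t) := continuous_iff_continuousAt.2 fun t =>
    (hG _ (norm_bdryMap t)).comp (continuous_bdryMap O).continuousAt
  have hq : Continuous fun t : Bdry O =>
      1 / ‖(diskData O α γ hα0 hα hγ).phi n (bdryMap O t)‖ ^ 2 :=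
    continuous_const.div (hphi.norm.pow 2) fun t => pow_ne_zero 2 (norm_ne_zero_iff.2 (hne t))
  have hp := continuous_poissonDensity (hα n)
  have hqG : Continuous fun t : Bdry O =>
      (1 / ‖(diskData O α γ hα0 hα hγ).phi n (bdryMap O t)‖ ^ 2) • G (bdryMap O t) :=
    hq.smul hGσ
  simp only [approxMeasure, orf_eq_phi_bdryMap hα0 hα hγ]
  rw [integral_withDensity_eq_integral_toReal_smul hq.measurable.ennreal_ofReal
    (Eventually.of_forall fun _ => ENNReal.ofReal_lt_top)]
  simp only [ENNReal.toReal_ofReal (div_nonneg zero_le_one (sq_nonneg _))]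
  rw [poissonMeasure, integral_map (continuous_param O).aemeasurable
      hqG.aestronglyMeasurable,
    integral_withDensity_eq_integral_toReal_smul hp.measurable.ennreal_ofReal
      (Eventually.of_forall fun _ => ENNReal.ofReal_lt_top)]
  simp only [ENNReal.toReal_ofReal (poissonDensity_nonneg (hα n) _)]
  rw [integral_poissonDensity (hα n) fun s =>
    (1 / ‖(diskData O α γ hα0 hα hγ).phi n s‖ ^ 2) • G s]
  congr 1
  funext s
  rw [DiskData.approxDensity, Complex.real_smul, ← mul_assoc, ← Complex.ofReal_mul, mul_one_div]
  rfl

theorem orthoUpTo_of_mem_solutions {μ : Measure (Bdry O)} (hμ : μ ∈ solutions O α γ) (N : ℕ) :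
    (diskData O α γ hα0 hα hγ).OrthoUpTo μ (bdryMap O) N := by
  intro j _ k _
  rw [← hμ.2.orthonormal j k]
  simp only [orf_eq_phi_bdryMap hα0 hα hγ]
  rfl

theorem cFun_eq (μ : Measure (Bdry O)) (z : ℂ) : cFun O μ z =
    ∫ t, (bdryMap O t + toDisk O z) / (bdryMap O t - toDisk O z) ∂μ := by
  simp only [cFun, kernelD, zeta_basePoint_coe, bdryMap]

theorem sFun_eq (μ : Measure (Bdry O)) (z : ℂ) :
    sFun O μ z = DiskData.schur μ (bdryMap O) (toDisk O z) := by
  rw [sFun, cFun_eq, zeta_basePoint_coe, DiskData.schur]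

end Measures

/-! ### Weak-* limits and their Schur functions -/

theorem exists_subseq_tendsto_integral {T : Type*} [TopologicalSpace T] [CompactSpace T]
    [TopologicalSpace.MetrizableSpace T] [MeasurableSpace T] [BorelSpace T] (ν : ℕ → Measure T)
    (hν : ∀ n, IsProbabilityMeasure (ν n)) :
    ∃ (ψ : ℕ → ℕ) (μ : Measure T), StrictMono ψ ∧ IsProbabilityMeasure μ ∧ ∀ g : C(T, ℝ),
      Tendsto (fun k => ∫ t, g t ∂(ν (ψ k))) atTop (𝓝 (∫ t, g t ∂μ)) := by
  obtain ⟨μ, ψ, hψ, h⟩ := CompactSpace.tendsto_subseq fun n : ℕ =>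
    (show ProbabilityMeasure T from ⟨ν n, hν n⟩)
  refine ⟨ψ, μ, hψ, inferInstance, fun g => ?_⟩
  exact (ProbabilityMeasure.tendsto_iff_forall_integral_tendsto.1 h)
    (BoundedContinuousFunction.mkOfCompact g)

theorem tendsto_integral_complex {T : Type*} [TopologicalSpace T] [CompactSpace T]
    [MeasurableSpace T] [BorelSpace T] {ν : ℕ → Measure T} {μ : Measure T}
    (hν : ∀ n, IsProbabilityMeasure (ν n)) (hμ : IsProbabilityMeasure μ)
    (h : ∀ g : C(T, ℝ), Tendsto (fun k => ∫ t, g t ∂(ν k)) atTop (𝓝 (∫ t, g t ∂μ)))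
    {G : T → ℂ} (hG : Continuous G) :
    Tendsto (fun k => ∫ t, G t ∂(ν k)) atTop (𝓝 (∫ t, G t ∂μ)) := by
  have h1 := h ⟨fun t => (G t).re, Complex.continuous_re.comp hG⟩
  have h2 := h ⟨fun t => (G t).im, Complex.continuous_im.comp hG⟩
  have h3 := ((Complex.continuous_ofReal.tendsto _).comp h1).add
    (((Complex.continuous_ofReal.tendsto _).comp h2).mul_const Complex.I)
  have h4 : ∀ (ρ : Measure T) [IsProbabilityMeasure ρ],
      ((∫ t, (G t).re ∂ρ : ℝ) : ℂ) + (∫ t, (G t).im ∂ρ : ℝ) * Complex.I = ∫ t, G t ∂ρ :=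
    fun ρ _ => integral_re_add_im (integrable_of_continuous hG)
  rw [← h4 μ]
  refine h3.congr fun k => ?_
  exact h4 (ν k)

section Limits

variable {O : Domain} {α γ : ℕ → ℂ} (hα0 : α 0 = basePoint O) (hα : ∀ n, α n ∈ region O)
  (hγ : ∀ n, ‖γ n‖ < 1)

theorem isProbabilityMeasure_approxMeasure (hα0 : α 0 = basePoint O) (hα : ∀ n, α n ∈ region O)
    (hγ : ∀ n, ‖γ n‖ < 1) (n : ℕ) : IsProbabilityMeasure (approxMeasure O α γ n) :=
  (isApprox_approxMeasure hα0 hα hγ n).isProbabilityMeasure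

theorem mem_solutions_of_tendsto (hα0 : α 0 = basePoint O) (hα : ∀ n, α n ∈ region O)
    (hγ : ∀ n, ‖γ n‖ < 1) (hne : (solutions O α γ).Nonempty) {φ : ℕ → ℕ}
    (hφ : Tendsto φ atTop atTop) {μ : Measure (Bdry O)} (hμ : IsProbabilityMeasure μ)
    (h : ∀ g : C(Bdry O, ℝ), Tendsto (fun k => ∫ t, g t ∂(approxMeasure O α γ (φ k))) atTop
      (𝓝 (∫ t, g t ∂μ))) : μ ∈ solutions O α γ := by
  obtain ⟨μ0, hμ0⟩ := hne
  -- That `Φ_n` lies in the span of the Blaschke products does not involve the measure, so it is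
  -- inherited from any solution.
  refine ⟨hμ, hμ0.2.mem_span, fun m n => ?_⟩
  have h1 := tendsto_integral_complex
    (fun k => isProbabilityMeasure_approxMeasure hα0 hα hγ (φ k)) hμ h
    (G := fun t => orf O α γ m t.1 * star (orf O α γ n t.1))
    ((continuous_orf hα0 hα hγ m).mul (continuous_star.comp (continuous_orf hα0 hα hγ n)))
  refine tendsto_nhds_unique h1 (tendsto_const_nhds.congr' ?_)
  -- Once the index exceeds `m` and `n`, the orthogonality relation holds exactly, so the sequence
  -- of integrals is eventually constant.
  filter_upwards [hφ.eventually_ge_atTop m, hφ.eventually_ge_atTop n] with k hm hn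
  have h2 := (isApprox_approxMeasure hα0 hα hγ (φ k)).orthoUpTo m hm n hn
  rw [← h2]
  congr 1
  funext t
  rw [orf_eq_phi_bdryMap hα0 hα hγ, orf_eq_phi_bdryMap hα0 hα hγ]
  rfl

/-- The Schur functions of the approximating measures converge to that of a limit measure. -/
theorem tendsto_R_div_S {φ : ℕ → ℕ} {μ : Measure (Bdry O)} (hμ : μ ∈ solutions O α γ)
    (h : ∀ g : C(Bdry O, ℝ), Tendsto (fun k => ∫ t, g t ∂(approxMeasure O α γ (φ k + 1))) atTop
      (𝓝 (∫ t, g t ∂μ))) {w : ℂ} (hw : ‖w‖ < 1)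
    (hwa : ∀ k, w ≠ (diskData O α γ hα0 hα hγ).a k) :
    Tendsto (fun k => ((diskData O α γ hα0 hα hγ).wall (φ k) w).R /
      ((diskData O α γ hα0 hα hγ).wall (φ k) w).S) atTop
        (𝓝 (DiskData.schur μ (bdryMap O) w)) := by
  have := hμ.1
  have hσ := continuous_bdryMap O
  have h0 : (∫ t, (bdryMap O t + w) / (bdryMap O t - w) ∂μ) + 1 ≠ 0 := by
    rw [(diskData O α γ hα0 hα hγ).integral_kernel_add_one hσ norm_bdryMap hw]
    exact (orthoUpTo_of_mem_solutions hα0 hα hγ hμ 0).Q_zero_ne_zero hσ norm_bdryMap hw hwa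
  have h1 := tendsto_integral_complex
    (fun k => isProbabilityMeasure_approxMeasure hα0 hα hγ (φ k + 1)) hμ.1 h
    (G := fun t => (bdryMap O t + w) / (bdryMap O t - w))
    ((hσ.add continuous_const).div (hσ.sub continuous_const) fun t =>
      sub_ne_zero.2 (DiskData.ne_of_norm_lt norm_bdryMap hw t))
  have h2 : Tendsto (fun k => DiskData.schur (approxMeasure O α γ (φ k + 1)) (bdryMap O) w) atTop
      (𝓝 (DiskData.schur μ (bdryMap O) w)) :=
    tendsto_const_nhds.mul ((h1.sub_const 1).div (h1.add_const 1) h0)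
  refine h2.congr fun k => ?_
  rw [eq_div_iff ((diskData O α γ hα0 hα hγ).S_ne_zero _ hw.le)]
  exact (isApprox_approxMeasure hα0 hα hγ _).schur_mul hσ norm_bdryMap hw hwa

theorem toDisk_ne_of_mem_region0 (hα : ∀ n, α n ∈ region O) {z : ℂ} (hz : z ∈ region0 O α)
    (k : ℕ) : toDisk O z ≠ toDisk O (α k) := fun h =>
  hz.2 ⟨k, (toDisk_injOn O hz.1 (hα k) h).symm⟩

theorem cFun_add_one_ne_zero (hα0 : α 0 = basePoint O) (hα : ∀ n, α n ∈ region O)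
    (hγ : ∀ n, ‖γ n‖ < 1) {μ : Measure (Bdry O)} (hμ : μ ∈ solutions O α γ) {z : ℂ}
    (hz : z ∈ region0 O α) : cFun O μ z + 1 ≠ 0 := by
  have := hμ.1
  rw [cFun_eq, (diskData O α γ hα0 hα hγ).integral_kernel_add_one (continuous_bdryMap O)
    norm_bdryMap (norm_toDisk_lt hz.1)]
  exact (orthoUpTo_of_mem_solutions hα0 hα hγ hμ 0).Q_zero_ne_zero (continuous_bdryMap O)
    norm_bdryMap (norm_toDisk_lt hz.1) (toDisk_ne_of_mem_region0 hα hz)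

theorem toDisk_ne_zero_of_mem_region0 (hα0 : α 0 = basePoint O) (hα : ∀ n, α n ∈ region O)
    {z : ℂ} (hz : z ∈ region0 O α) : toDisk O z ≠ 0 := by
  have h := toDisk_ne_of_mem_region0 hα hz 0
  rwa [hα0, toDisk_basePoint] at h

theorem sFun_mul_eq (hα0 : α 0 = basePoint O) (hα : ∀ n, α n ∈ region O) (μ : Measure (Bdry O))
    {z : ℂ} (hz : z ∈ region0 O α) :
    toDisk O z * sFun O μ z = (cFun O μ z - 1) / (cFun O μ z + 1) := by
  have h := toDisk_ne_zero_of_mem_region0 hα0 hα hz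
  rw [sFun, zeta_basePoint_coe]
  field_simp

theorem sFun_eq_of_cFun_eq (hα0 : α 0 = basePoint O) (hα : ∀ n, α n ∈ region O)
    {μ : Measure (Bdry O)} {z y : ℂ} (hz : z ∈ region0 O α) (hy : 1 - toDisk O z * y ≠ 0)
    (h : cFun O μ z = (1 + toDisk O z * y) / (1 - toDisk O z * y)) : sFun O μ z = y := by
  have h0 := toDisk_ne_zero_of_mem_region0 hα0 hα hz
  refine mul_left_cancel₀ h0 ?_
  rw [sFun_mul_eq hα0 hα μ hz, h, div_sub_one hy, div_add_one hy, div_div_div_cancel_right₀ hy,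
    div_eq_iff (by ring_nf; norm_num)]
  ring

theorem cFun_eq_of_sFun (hα0 : α 0 = basePoint O) (hα : ∀ n, α n ∈ region O)
    {μ : Measure (Bdry O)} {z : ℂ} (hz : z ∈ region0 O α) (h : cFun O μ z + 1 ≠ 0) :
    1 - toDisk O z * sFun O μ z ≠ 0 ∧
    cFun O μ z = (1 + toDisk O z * sFun O μ z) / (1 - toDisk O z * sFun O μ z) := by
  rw [sFun_mul_eq hα0 hα μ hz, one_sub_div h, one_add_div h, div_div_div_cancel_right₀ h]
  have h2 : cFun O μ z + 1 - (cFun O μ z - 1) = 2 := by ring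
  rw [h2]
  exact ⟨div_ne_zero two_ne_zero h, by ring⟩

theorem mem_frontier_of_tendsto {A : Set ℂ} {x : ℂ} (hx : x ∈ A) {y : ℕ → ℂ}
    (hy : ∀ᶠ k in atTop, y k ∉ A) (h : Tendsto y atTop (𝓝 x)) : x ∈ frontier A := by
  rw [frontier_eq_closure_inter_closure]
  exact ⟨subset_closure hx, mem_closure_of_tendsto h hy⟩

/-- Points outside the Weyl disk that are close to `R_n(z) / S_n(z)`. -/
theorem exists_near_not_mem_schurWeylDisk (n : ℕ) {z : ℂ} (hz : z ∈ region0 O α) :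
    ∃ y : ℂ, ‖y - ((diskData O α γ hα0 hα hγ).wall n (toDisk O z)).R /
      ((diskData O α γ hα0 hα hγ).wall n (toDisk O z)).S‖ ≤
        2 * (1 - ‖(diskData O α γ hα0 hα hγ).ratio n (toDisk O z)‖ ^ 2) ∧
      y ∉ schurWeylDisk O α γ z := by
  set D := diskData O α γ hα0 hα hγ
  have hw := norm_toDisk_lt hz.1
  have hwa : ∀ k, toDisk O z ≠ D.a k := toDisk_ne_of_mem_region0 hα hz
  obtain ⟨y, hy, hy2⟩ := exists_near_not_mem (D.norm_Rstar_lt n hw.le)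
    (fun v hv => D.norm_wall_le n hw.le hv)
    (wallSeq_det_ne_zero (fun k => D.zeta_ne_zero_of_ne k hw.le (hwa k)) D.norm_γ n)
  refine ⟨y, hy, ?_⟩
  rintro ⟨μ, hμ, rfl⟩
  have := hμ.1
  obtain ⟨-, v, -, hv, h⟩ := (orthoUpTo_of_mem_solutions hα0 hα hγ hμ (n + 1)).schur_eq
    (continuous_bdryMap O) norm_bdryMap hw hwa le_rfl
  refine hy2 v hv ?_
  simp only [sFun_eq]
  exact h

end Limits

/-! ### The limit function on the boundary of the Weyl disk -/

theorem ball_subset_closure_of_countable {s : Set ℂ} (hs : s.Countable) :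
    Metric.ball (0 : ℂ) 1 ⊆ closure (sᶜ ∩ Metric.ball 0 1) := by
  rw [Set.inter_comm]
  exact (hs.dense_compl ℂ).open_subset_closure_inter Metric.isOpen_ball

/-- One subsequence serves all purposes: it makes the ratios tend to the circle, the measures
converge, and `R_n / S_n` converge. The last is known pointwise only off the countable set of the
`a_k`, and the bound by `1` extends it locally uniformly to the whole disk. -/
theorem exists_limit {O : Domain} {α γ : ℕ → ℂ} (hα0 : α 0 = basePoint O)
    (hα : ∀ n, α n ∈ region O) (hγ : ∀ n, ‖γ n‖ < 1) (hne : (solutions O α γ).Nonempty)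
    (hlimsup : limsup (fun n => ‖γ n‖) atTop = 1) :
    ∃ (φ : ℕ → ℕ) (f : ℂ → ℂ) (μ : Measure (Bdry O)), StrictMono φ ∧ μ ∈ solutions O α γ ∧
      TendstoLocallyUniformlyOn (fun k (z : ℂ) => (wall O α γ (φ k) (z : OnePoint ℂ)).R /
        (wall O α γ (φ k) (z : OnePoint ℂ)).S) f atTop (region O) ∧
      IsLimitMeasure (approxMeasure O α γ) μ ∧
      ∀ z ∈ region0 O α, f z = sFun O μ z ∧ ∃ y : ℕ → ℂ, (∀ k, y k ∉ schurWeylDisk O α γ z) ∧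
        Tendsto y atTop (𝓝 (sFun O μ z)) := by
  set D := diskData O α γ hα0 hα hγ with hD
  obtain ⟨φ, hφ, hφ1⟩ := D.exists_subseq_ratio (s := 0) (by simp) hlimsup
  obtain ⟨ψ, μ, hψ, hμ, hlim⟩ := exists_subseq_tendsto_integral
    -- The shift by one matches indices: the Schur function of `μ⁽ⁿ⁺¹⁾` is `R_n / S_n`.
    (fun k => approxMeasure O α γ (φ k + 1))
    (fun k => isProbabilityMeasure_approxMeasure hα0 hα hγ _)
  have hmono : StrictMono fun k => φ (ψ k) := hφ.comp hψ
  have hmono1 : StrictMono fun k => φ (ψ k) + 1 := fun i j h => Nat.succ_lt_succ (hmono h)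
  have hsol : μ ∈ solutions O α γ :=
    mem_solutions_of_tendsto hα0 hα hγ hne hmono1.tendsto_atTop hμ hlim
  have hwall : ∀ n, ∀ z ∈ region O, (wall O α γ n (z : OnePoint ℂ)).R /
      (wall O α γ n (z : OnePoint ℂ)).S =
      (D.wall n (toDisk O z)).R / (D.wall n (toDisk O z)).S := fun n z hz => by
    rw [wall_eq_diskData hα0 hα hγ (coe_mem_closedRegion hz), zeta_basePoint_coe]
  have hpt := fun {w : ℂ} => tendsto_R_div_S hα0 hα hγ hsol (φ := fun k => φ (ψ k)) hlim (w := w)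
  have hmaps : Set.MapsTo (toDisk O) (region O) (Metric.ball 0 1) := fun z hz =>
    mem_ball_zero_iff.2 (norm_toDisk_lt hz)
  obtain ⟨F, hF⟩ := exists_tendstoLocallyUniformlyOn
    (f := fun k s => (D.wall (φ (ψ k)) s).R / (D.wall (φ (ψ k)) s).S)
    (fun k s hs => (D.differentiableAt_R_div_S _
      (mem_ball_zero_iff.1 hs).le).differentiableWithinAt)
    (fun k s hs => D.norm_R_div_S_le _ (mem_ball_zero_iff.1 hs).le)
    (ball_subset_closure_of_countable (Set.countable_range D.a))
    (fun s hs => ⟨_, hpt (mem_ball_zero_iff.1 hs.2) fun k h => hs.1 ⟨k, h.symm⟩⟩)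
  refine ⟨fun k => φ (ψ k), F ∘ toDisk O, μ, hmono, hsol,
    (hF.comp _ hmaps (continuousOn_toDisk O)).congr fun k z hz => (hwall _ z hz).symm,
    ⟨_, hmono1, hlim⟩, fun z hz => ?_⟩
  have hw := norm_toDisk_lt hz.1
  have h1 := hpt hw (toDisk_ne_of_mem_region0 hα hz)
  rw [sFun_eq]
  refine ⟨tendsto_nhds_unique (hF.tendsto_at (hmaps hz.1)) h1, ?_⟩
  choose y hy hyn using fun k =>
    exists_near_not_mem_schurWeylDisk hα0 hα hγ (φ (ψ k)) hz
  refine ⟨y, hyn, ?_⟩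
  have h2 : Tendsto (fun k => 2 * (1 - ‖D.ratio (φ (ψ k)) (toDisk O z)‖ ^ 2)) atTop (𝓝 0) := by
    have := (((D.tendsto_norm_ratio hφ1 hw).comp hψ.tendsto_atTop).pow 2).const_sub 1
      |>.const_mul 2
    simpa using this
  have h3 := (squeeze_zero_norm hy h2).add h1
  simpa using h3

end RatORF

theorem propositionN2 (O : RatORF.Domain) (α γ : ℕ → ℂ)
    (hα0 : α 0 = RatORF.basePoint O) (hα : ∀ n, α n ∈ RatORF.region O)
    (hγ : ∀ n, ‖γ n‖ < 1)
    (hindet : (RatORF.solutions O α γ).Nontrivial)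
    (hlimsup : Filter.limsup (fun n => ‖γ n‖) Filter.atTop = 1) :
    (∃ (φ : ℕ → ℕ) (f : ℂ → ℂ), StrictMono φ ∧
      TendstoLocallyUniformlyOn
        (fun k (z : ℂ) => (RatORF.wall O α γ (φ k) (z : OnePoint ℂ)).R /
          (RatORF.wall O α γ (φ k) (z : OnePoint ℂ)).S)
        f Filter.atTop (RatORF.region O) ∧
      ∀ z ∈ RatORF.region0 O α, f z ∈ frontier (RatORF.schurWeylDisk O α γ z)) ∧
    ∃ μ : MeasureTheory.Measure (RatORF.Bdry O),
      RatORF.IsLimitMeasure (RatORF.approxMeasure O α γ) μ ∧ RatORF.IsNExtremal O α γ μ := by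
  obtain ⟨φ, f, μ, hφ, hμ, hf, hlim, h⟩ :=
    RatORF.exists_limit hα0 hα hγ hindet.nonempty hlimsup
  refine ⟨⟨φ, f, hφ, hf, fun z hz => ?_⟩, μ, hlim, hμ, fun z hz => ?_⟩
  · obtain ⟨h1, y, hy, hy1⟩ := h z hz
    rw [h1]
    exact RatORF.mem_frontier_of_tendsto ⟨μ, hμ, rfl⟩ (Eventually.of_forall hy) hy1
  · obtain ⟨-, y, hy, hy1⟩ := h z hz
    obtain ⟨h2, h3⟩ := RatORF.cFun_eq_of_sFun hα0 hα hz
      (RatORF.cFun_add_one_ne_zero hα0 hα hγ hμ hz)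
    -- The exterior points `y k` are moved to the disk of the C-functions by `F = (1 + ζ_0 f) / (1 -
    -- ζ_0 f)`. The denominator is nonzero in the limit, hence eventually, and that suffices for the
    -- images to stay outside.
    have h4 : Tendsto (fun k => 1 - RatORF.toDisk O z * y k) atTop
        (𝓝 (1 - RatORF.toDisk O z * RatORF.sFun O μ z)) :=
      tendsto_const_nhds.sub (tendsto_const_nhds.mul hy1)
    have h5 : Tendsto (fun k => (1 + RatORF.toDisk O z * y k) / (1 - RatORF.toDisk O z * y k))
        atTop (𝓝 (RatORF.cFun O μ z)) := by
      rw [h3]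
      exact (tendsto_const_nhds.add (tendsto_const_nhds.mul hy1)).div h4 h2
    refine RatORF.mem_frontier_of_tendsto ⟨μ, hμ, rfl⟩ ?_ h5
    filter_upwards [h4.eventually_ne h2] with k hk
    rintro ⟨μ', hμ', h6⟩
    exact hy k ⟨μ', hμ', RatORF.sFun_eq_of_cFun_eq hα0 hα hz hk h6⟩

end
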